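/- **Setting.** A (pseudo) double category $\mathbb{A}$ has objects, vertical arrows, 1-cells $M : A \to B$ and 2-cells $M \to N$ lying over a pair of vertical arrows $(f,g)$; $\mathcal{A}(A,B)$ is the local category of 1-cells $A \to B$ and 2-cells over identities. $\mathbb{A}$ is a *framed bicategory* if the functor sending a 1-cell to its pair (source, target) and a 2-cell to $(f,g)$ is a bifibration; a chosen cleavage gives restriction functors $f^*(-)g^* : \mathcal{A}(B,B') \to \mathcal{A}(A,A')$ for vertical arrows $f : A \to B$, $g : A' \to B'$. It is *closed* if horizontal composition $\odot$ has right adjoints in each variable on local categories, *abelian* if all $\mathcal{A}(A,B)$ are abelian and $\odot$ is additive in each variable, and *monoidal* if it is a pseudomonoid in framed bicategories (with an external product $M \otimes N : A \otimes C \to B \otimes D$ for $M : A \to B$, $N : C \to D$); for a *monoidal abelian* framed bicategory, $\otimes : \mathcal{A}(A,B) \times \mathcal{A}(C,D) \to \mathcal{A}(A \otimes C, B \otimes D)$ is required to be additive in each variable. A chain complex in $\mathbb{A}$ is a chain complex $K = (K_n)_{n \ge 0}$ in some $\mathcal{A}(A,B)$; a morphism is a pair of vertical arrows together with 2-cells over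 it commuting with the differentials; these form the category $\mathrm{Ch}(\mathbb{A})$. The tensor product is $(K \otimes K')_n = \bigoplus_{i+j=n} K_i \otimes K'_j$ with differential $\partial \otimes 1 + (-1)^i\, 1 \otimes \partial$ on $K_i \otimes K'_j$. Cycles, boundaries and homology $Z_i, B_i, H_i$ are taken in the local abelian category. **Algebraic Künneth conditions.** Let $t : \mathcal{A}_1 \times \mathcal{A}_2 \to \mathcal{A}'$ be a functor between abelian categories, covariant and additive in each variable, where $\mathcal{A}_1, \mathcal{A}_2$ have enough projectives. Put $\mathrm{Tor}_1(U,V) = H_1(t(P,Q))$, where $P \to U$, $Q \to V$ are projective resolutions and $t(P,Q)$ is the total complex. If $t$ is right exact in each variable and $K, K'$ are chain complexes in $\mathcal{A}_1$, $\mathcal{A}_2$ (in degrees $\geq 0$), let $$\alpha : \bigoplus_{i+j=n} t(H_i(K), H_j(K')) \to H_n(t(K,K'))$$ be the homomorphism induced by $t(Z_i(K), Z_j(K')) \to Z_n(t(K,K'))$. The triple $(t,K,K')$ satisfies the *algebraic Künneth conditions* if $t$ is right exact in each variable, the homomorphisms $\alpha_1 : t(B(K),H(K')) \to H\,t(B(K),K')$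 and $\alpha_2 : t(Z(K),H(K')) \to H\,t(Z(K),K')$ (the case of $\alpha$ in which $K$ is replaced by $B(K)$, resp. $Z(K)$, with zero differential) are isomorphisms in every degree, and $\mathrm{Tor}_1(B_i(K), K'_j) = 0 = \mathrm{Tor}_1(Z_i(K), H_j(K'))$ for all $i,j \ge 0$. **Theorem 6.1.** Let $\mathbb{A}$ be a closed monoidal abelian framed bicategory whose local categories have enough projectives, enough injectives and coproducts. Let $\mathcal{C}$ be a monoidal category and $M : \mathcal{C} \to \mathrm{Ch}(\mathbb{A})$ a functor; write $M(X)$ as a complex in $\mathcal{A}(L(X),R(X))$ and $H_n(X) = H_n(M(X))$. Let $l_{X,Y} : L(X \otimes Y) \to L(X) \otimes L(Y)$ and $r_{X,Y} : R(X \otimes Y) \to R(X) \otimes R(Y)$ be natural transformations, and suppose given, for all $n \ge 0$, isomorphisms in $\mathcal{A}(L(X\otimes Y),R(X\otimes Y))$, natural in $X$ and $Y$ (a weak Eilenberg–Zilber isomorphism), $$\mathrm{ez} : H_n(X \otimes Y) \cong l^*\, H_n(M(X) \otimes M(Y))\, r^* .$$ Let $X, Y$ be objects of $\mathcal{C}$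 such that the tensor product functor $\otimes : \mathcal{A}(L(X),R(X)) \times \mathcal{A}(L(Y),R(Y)) \to \mathcal{A}(L(X) \otimes L(Y), R(X) \otimes R(Y))$ and the complexes $M(X), M(Y)$ satisfy the algebraic Künneth conditions. Then for every $n \ge 0$ there is a short exact sequence in $\mathcal{A}(L(X \otimes Y), R(X \otimes Y))$ $$0 \to l^*\Big(\bigoplus_{i+j=n} H_i(X) \otimes H_j(Y)\Big) r^* \to H_n(X \otimes Y) \to l^*\Big(\bigoplus_{i+j=n-1} \mathrm{Tor}_1(H_i(X), H_j(Y))\Big) r^* \to 0,$$ where $l = l_{X,Y}$ and $r = r_{X,Y}$, whose first map, followed by $\mathrm{ez}$, is $l^*(\alpha)\, r^*$. (For $n = 0$ the last direct sum is empty, hence zero.) -/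

import Mathlib

open CategoryTheory Limits MonoidalCategory

universe w v₁ v u

/-- The collection of all 1-cells `left ⇸ right`, given the 1-cells `Hor A B` between any two
objects: the objects of the horizontal category of a double category. -/
structure OneCell {D : Type u} (Hor : D → D → Type w) where
  {left : D}
  {right : D}
  cell : Hor left right

/-- A (pseudo) double category with vertical category `D`.  Its horizontal category has the 1-cells
as objects and the 2-cells as morphisms; a 2-cell `α : M ⟶ N` has a left frame `L α` and a right
frame `R α`, which are vertical arrows.  Horizontal composition `hcomp` is associative and unital
up to globular isomorphisms. -/
class DoubleCategory (D : Type u) [Category.{v} D] where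
  /-- the 1-cells `A ⇸ B` -/
  Hor : D → D → Type w
  /-- the horizontal category: 1-cells, 2-cells and vertical composition of 2-cells -/
  [cat : Category.{v₁} (OneCell Hor)]
  L {M N : OneCell Hor} (α : M ⟶ N) : M.left ⟶ N.left
  R {M N : OneCell Hor} (α : M ⟶ N) : M.right ⟶ N.right
  L_id (M : OneCell Hor) : L (𝟙 M) = 𝟙 M.left
  R_id (M : OneCell Hor) : R (𝟙 M) = 𝟙 M.right
  L_comp {M N P : OneCell Hor} (α : M ⟶ N) (β : N ⟶ P) : L (α ≫ β) = L α ≫ L β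
  R_comp {M N P : OneCell Hor} (α : M ⟶ N) (β : N ⟶ P) : R (α ≫ β) = R α ≫ R β
  /-- the unit 1-cell `U_A` -/
  U (A : D) : Hor A A
  /-- the unit functor on vertical arrows -/
  Umap {A B : D} (f : A ⟶ B) : OneCell.mk (U A) ⟶ OneCell.mk (U B)
  L_Umap {A B : D} (f : A ⟶ B) : L (Umap f) = f
  R_Umap {A B : D} (f : A ⟶ B) : R (Umap f) = f
  Umap_id (A : D) : Umap (𝟙 A) = 𝟙 _
  Umap_comp {A B C : D} (f : A ⟶ B) (g : B ⟶ C) : Umap (f ≫ g) = Umap f ≫ Umap g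
  /-- horizontal composition `M ⊙ N` of 1-cells -/
  hcomp {A B C : D} (M : Hor A B) (N : Hor B C) : Hor A C
  /-- horizontal composition of 2-cells that agree on the middle frame -/
  hmap {A B C A' B' C' : D} {M : Hor A B} {N : Hor B C} {M' : Hor A' B'} {N' : Hor B' C'}
    (α : OneCell.mk M ⟶ OneCell.mk M') (β : OneCell.mk N ⟶ OneCell.mk N') (h : R α = L β) :
    OneCell.mk (hcomp M N) ⟶ OneCell.mk (hcomp M' N')
  L_hmap {A B C A' B' C' : D} {M : Hor A B} {N : Hor B C} {M' : Hor A' B'} {N' : Hor B' C'}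
    (α : OneCell.mk M ⟶ OneCell.mk M') (β : OneCell.mk N ⟶ OneCell.mk N') (h : R α = L β) :
    L (hmap α β h) = L α
  R_hmap {A B C A' B' C' : D} {M : Hor A B} {N : Hor B C} {M' : Hor A' B'} {N' : Hor B' C'}
    (α : OneCell.mk M ⟶ OneCell.mk M') (β : OneCell.mk N ⟶ OneCell.mk N') (h : R α = L β) :
    R (hmap α β h) = R β
  hmap_id {A B C : D} (M : Hor A B) (N : Hor B C) :
    hmap (𝟙 (OneCell.mk M)) (𝟙 (OneCell.mk N)) (by rw [R_id, L_id]) = 𝟙 _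
  hmap_comp {A B C A' B' C' A'' B'' C'' : D} {M : Hor A B} {N : Hor B C} {M' : Hor A' B'}
    {N' : Hor B' C'} {M'' : Hor A'' B''} {N'' : Hor B'' C''}
    (α : OneCell.mk M ⟶ OneCell.mk M') (β : OneCell.mk N ⟶ OneCell.mk N') (h : R α = L β)
    (α' : OneCell.mk M' ⟶ OneCell.mk M'') (β' : OneCell.mk N' ⟶ OneCell.mk N'')
    (h' : R α' = L β') :
    hmap (α ≫ α') (β ≫ β') (by rw [R_comp, L_comp, h, h']) = hmap α β h ≫ hmap α' β' h'
  /-- the associator `M ⊙ (N ⊙ P) ≅ (M ⊙ N) ⊙ P` -/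
  assoc {A B C E : D} (M : Hor A B) (N : Hor B C) (P : Hor C E) :
    OneCell.mk (hcomp M (hcomp N P)) ≅ OneCell.mk (hcomp (hcomp M N) P)
  L_assoc {A B C E : D} (M : Hor A B) (N : Hor B C) (P : Hor C E) :
    L (assoc M N P).hom = 𝟙 A
  R_assoc {A B C E : D} (M : Hor A B) (N : Hor B C) (P : Hor C E) :
    R (assoc M N P).hom = 𝟙 E
  assoc_naturality {A B C E A' B' C' E' : D} {M : Hor A B} {N : Hor B C} {P : Hor C E}
    {M' : Hor A' B'} {N' : Hor B' C'} {P' : Hor C' E'}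
    (α : OneCell.mk M ⟶ OneCell.mk M') (β : OneCell.mk N ⟶ OneCell.mk N')
    (γ : OneCell.mk P ⟶ OneCell.mk P') (h : R α = L β) (h' : R β = L γ) :
    hmap α (hmap β γ h') (by rw [L_hmap, h]) ≫ (assoc M' N' P').hom =
      (assoc M N P).hom ≫ hmap (hmap α β h) γ (by rw [R_hmap, h'])
  /-- the left unitor `U_A ⊙ M ≅ M` -/
  lunit {A B : D} (M : Hor A B) : OneCell.mk (hcomp (U A) M) ≅ OneCell.mk M
  L_lunit {A B : D} (M : Hor A B) : L (lunit M).hom = 𝟙 A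
  R_lunit {A B : D} (M : Hor A B) : R (lunit M).hom = 𝟙 B
  lunit_naturality {A B A' B' : D} {M : Hor A B} {M' : Hor A' B'}
    (α : OneCell.mk M ⟶ OneCell.mk M') :
    hmap (Umap (L α)) α (by rw [R_Umap]) ≫ (lunit M').hom = (lunit M).hom ≫ α
  /-- the right unitor `M ⊙ U_B ≅ M` -/
  runit {A B : D} (M : Hor A B) : OneCell.mk (hcomp M (U B)) ≅ OneCell.mk M
  L_runit {A B : D} (M : Hor A B) : L (runit M).hom = 𝟙 A
  R_runit {A B : D} (M : Hor A B) : R (runit M).hom = 𝟙 B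
  runit_naturality {A B A' B' : D} {M : Hor A B} {M' : Hor A' B'}
    (α : OneCell.mk M ⟶ OneCell.mk M') :
    hmap α (Umap (R α)) (by rw [L_Umap]) ≫ (runit M').hom = (runit M).hom ≫ α
  pentagon {A B C E F : D} (M : Hor A B) (N : Hor B C) (P : Hor C E) (Q : Hor E F) :
    (assoc M N (hcomp P Q)).hom ≫ (assoc (hcomp M N) P Q).hom =
      hmap (𝟙 (OneCell.mk M)) (assoc N P Q).hom (by rw [R_id, L_assoc]) ≫
        (assoc M (hcomp N P) Q).hom ≫
          hmap (assoc M N P).hom (𝟙 (OneCell.mk Q)) (by rw [R_assoc, L_id])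
  triangle {A B C : D} (M : Hor A B) (N : Hor B C) :
    (assoc M (U B) N).hom ≫ hmap (runit M).hom (𝟙 (OneCell.mk N)) (by rw [R_runit, L_id]) =
      hmap (𝟙 (OneCell.mk M)) (lunit N).hom (by rw [R_id, L_lunit])

attribute [reducible, instance] DoubleCategory.cat
attribute [simp] DoubleCategory.L_id DoubleCategory.R_id DoubleCategory.L_comp
  DoubleCategory.R_comp DoubleCategory.L_Umap DoubleCategory.R_Umap DoubleCategory.L_hmap
  DoubleCategory.R_hmap DoubleCategory.L_assoc DoubleCategory.R_assoc DoubleCategory.L_lunit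
  DoubleCategory.R_lunit DoubleCategory.L_runit DoubleCategory.R_runit

open DoubleCategory

section Local

variable {D : Type u} [Category.{v} D] [DoubleCategory.{w, v₁} D]

/-- Globular 2-cells, i.e. 2-cells whose two frames are identities. -/
@[ext]
structure Globular {A B : D} (M N : Hor A B) where
  cell : OneCell.mk M ⟶ OneCell.mk N
  left : L cell = 𝟙 A
  right : R cell = 𝟙 B

/-- The local category of 1-cells `A ⇸ B` and globular 2-cells. -/
instance localCategory (A B : D) : Category.{v₁} (Hor A B) where
  Hom M N := Globular M N
  id M := ⟨𝟙 _, L_id _, R_id _⟩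
  comp α β := ⟨α.cell ≫ β.cell, by rw [L_comp, α.left, β.left, Category.id_comp],
    by rw [R_comp, α.right, β.right, Category.id_comp]⟩
  id_comp _ := Globular.ext (Category.id_comp _)
  comp_id _ := Globular.ext (Category.comp_id _)
  assoc _ _ _ := Globular.ext (Category.assoc _ _ _)

/-- The 2-cell underlying a morphism of a local category. -/
def glob {A B : D} {M N : Hor A B} (α : M ⟶ N) : OneCell.mk M ⟶ OneCell.mk N :=
  Globular.cell α

/-- A 2-cell with identity frames, as a morphism of a local category. -/
def mkGlob {A B : D} {M N : Hor A B} (α : OneCell.mk M ⟶ OneCell.mk N) (h : L α = 𝟙 A)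
    (h' : R α = 𝟙 B) : M ⟶ N :=
  Globular.mk α h h'

@[simp] lemma glob_mkGlob {A B : D} {M N : Hor A B} (α : OneCell.mk M ⟶ OneCell.mk N)
    (h : L α = 𝟙 A) (h' : R α = 𝟙 B) : glob (mkGlob α h h') = α := rfl

@[ext] lemma glob_ext {A B : D} {M N : Hor A B} {α β : M ⟶ N} (h : glob α = glob β) : α = β :=
  Globular.ext h

@[simp] lemma L_glob {A B : D} {M N : Hor A B} (α : M ⟶ N) : L (glob α) = 𝟙 A := Globular.left α

@[simp] lemma R_glob {A B : D} {M N : Hor A B} (α : M ⟶ N) : R (glob α) = 𝟙 B := Globular.right α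

@[simp] lemma glob_id {A B : D} (M : Hor A B) : glob (𝟙 M) = 𝟙 (OneCell.mk M) := rfl

@[simp] lemma glob_comp {A B : D} {M N P : Hor A B} (α : M ⟶ N) (β : N ⟶ P) :
    glob (α ≫ β) = glob α ≫ glob β := rfl

/-- Horizontal composition as a functor of two variables on local categories. -/
def hcompFunctor (A B C : D) : Hor A B ⥤ Hor B C ⥤ Hor A C where
  obj M :=
    { obj N := hcomp M N
      map β := mkGlob (hmap (𝟙 (OneCell.mk M)) (glob β) (by simp)) (by simp) (by simp)
      map_id N := by ext; simp [hmap_id]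
      map_comp β β' := by ext; simp [← hmap_comp] }
  map α :=
    { app N := mkGlob (hmap (glob α) (𝟙 (OneCell.mk N)) (by simp)) (by simp) (by simp)
      naturality N N' β := by ext; simp [← hmap_comp] }
  map_id M := by ext; simp [hmap_id]
  map_comp α α' := by ext; simp [← hmap_comp]

end Local

/-- A framed bicategory: a double category whose frame functor `(L, R)` is a bifibration, together
with a choice of cartesian and cocartesian 2-cells. -/
class FramedBicategory (D : Type u) [Category.{v} D] [DoubleCategory.{w, v₁} D] where
  /-- the restriction `f^* M g^*` -/
  res {A B A' B' : D} (f : A ⟶ B) (g : A' ⟶ B') (M : Hor B B') : Hor A A'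
  /-- the cartesian 2-cell `f^* M g^* ⟶ M` -/
  cart {A B A' B' : D} (f : A ⟶ B) (g : A' ⟶ B') (M : Hor B B') :
    OneCell.mk (res f g M) ⟶ OneCell.mk M
  L_cart {A B A' B' : D} (f : A ⟶ B) (g : A' ⟶ B') (M : Hor B B') : L (cart f g M) = f
  R_cart {A B A' B' : D} (f : A ⟶ B) (g : A' ⟶ B') (M : Hor B B') : R (cart f g M) = g
  cartesian {A B A' B' : D} (f : A ⟶ B) (g : A' ⟶ B') (M : Hor B B') (N : OneCell Hor)
    (γ : N ⟶ OneCell.mk M) (h : N.left ⟶ A) (k : N.right ⟶ A') (hL : L γ = h ≫ f)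
    (hR : R γ = k ≫ g) :
    ∃! δ : N ⟶ OneCell.mk (res f g M), L δ = h ∧ R δ = k ∧ δ ≫ cart f g M = γ
  /-- the extension `f_! M g_!` -/
  ext {A B A' B' : D} (f : A ⟶ B) (g : A' ⟶ B') (M : Hor A A') : Hor B B'
  /-- the cocartesian 2-cell `M ⟶ f_! M g_!` -/
  cocart {A B A' B' : D} (f : A ⟶ B) (g : A' ⟶ B') (M : Hor A A') :
    OneCell.mk M ⟶ OneCell.mk (ext f g M)
  L_cocart {A B A' B' : D} (f : A ⟶ B) (g : A' ⟶ B') (M : Hor A A') : L (cocart f g M) = f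
  R_cocart {A B A' B' : D} (f : A ⟶ B) (g : A' ⟶ B') (M : Hor A A') : R (cocart f g M) = g
  cocartesian {A B A' B' : D} (f : A ⟶ B) (g : A' ⟶ B') (M : Hor A A') (N : OneCell Hor)
    (γ : OneCell.mk M ⟶ N) (h : B ⟶ N.left) (k : B' ⟶ N.right) (hL : L γ = f ≫ h)
    (hR : R γ = g ≫ k) :
    ∃! δ : OneCell.mk (ext f g M) ⟶ N, L δ = h ∧ R δ = k ∧ cocart f g M ≫ δ = γ

attribute [simp] FramedBicategory.L_cart FramedBicategory.R_cart FramedBicategory.L_cocart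
  FramedBicategory.R_cocart

open FramedBicategory

noncomputable section Framed

variable {D : Type u} [Category.{v} D] [DoubleCategory.{w, v₁} D] [FramedBicategory D]

/-- The globular factorization of a 2-cell over `(f, g)` through the cartesian 2-cell. -/
def resLift {A B A' B' : D} {f : A ⟶ B} {g : A' ⟶ B'} {N : Hor A A'} {M : Hor B B'}
    (γ : OneCell.mk N ⟶ OneCell.mk M) (hL : L γ = f) (hR : R γ = g) : N ⟶ res f g M :=
  have h := cartesian f g M _ γ (𝟙 _) (𝟙 _) (by simp [hL]) (by simp [hR])
  mkGlob h.choose h.choose_spec.1.1 h.choose_spec.1.2.1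

@[simp] lemma resLift_cart {A B A' B' : D} {f : A ⟶ B} {g : A' ⟶ B'} {N : Hor A A'}
    {M : Hor B B'} (γ : OneCell.mk N ⟶ OneCell.mk M) (hL : L γ = f) (hR : R γ = g) :
    glob (resLift γ hL hR) ≫ cart f g M = γ :=
  (cartesian f g M _ γ (𝟙 _) (𝟙 _) (by simp [hL]) (by simp [hR])).choose_spec.1.2.2

lemma resLift_cart_assoc {A B A' B' : D} {f : A ⟶ B} {g : A' ⟶ B'} {N : Hor A A'}
    {M : Hor B B'} (γ : OneCell.mk N ⟶ OneCell.mk M) (hL : L γ = f) (hR : R γ = g)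
    {P : OneCell (Hor (D := D))} (δ : OneCell.mk M ⟶ P) :
    glob (resLift γ hL hR) ≫ cart f g M ≫ δ = γ ≫ δ := by
  rw [← Category.assoc, resLift_cart]

lemma res_hom_ext {A B A' B' : D} {f : A ⟶ B} {g : A' ⟶ B'} {N : Hor A A'} {M : Hor B B'}
    {α β : N ⟶ res f g M} (h : glob α ≫ cart f g M = glob β ≫ cart f g M) : α = β := by
  ext
  exact (cartesian f g M _ (glob β ≫ cart f g M) (𝟙 _) (𝟙 _) (by simp) (by simp)).unique
    ⟨by simp, by simp, h⟩ ⟨by simp, by simp, rfl⟩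

/-- The globular factorization of a 2-cell over `(f, g)` through the cocartesian 2-cell. -/
def extDesc {A B A' B' : D} {f : A ⟶ B} {g : A' ⟶ B'} {N : Hor A A'} {M : Hor B B'}
    (γ : OneCell.mk N ⟶ OneCell.mk M) (hL : L γ = f) (hR : R γ = g) : ext f g N ⟶ M :=
  have h := cocartesian f g N _ γ (𝟙 _) (𝟙 _) (by simp [hL]) (by simp [hR])
  mkGlob h.choose h.choose_spec.1.1 h.choose_spec.1.2.1

@[simp] lemma cocart_extDesc {A B A' B' : D} {f : A ⟶ B} {g : A' ⟶ B'} {N : Hor A A'}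
    {M : Hor B B'} (γ : OneCell.mk N ⟶ OneCell.mk M) (hL : L γ = f) (hR : R γ = g) :
    cocart f g N ≫ glob (extDesc γ hL hR) = γ :=
  (cocartesian f g N _ γ (𝟙 _) (𝟙 _) (by simp [hL]) (by simp [hR])).choose_spec.1.2.2

lemma cocart_extDesc_assoc {A B A' B' : D} {f : A ⟶ B} {g : A' ⟶ B'} {N : Hor A A'}
    {M : Hor B B'} (γ : OneCell.mk N ⟶ OneCell.mk M) (hL : L γ = f) (hR : R γ = g)
    {P : OneCell (Hor (D := D))} (δ : OneCell.mk M ⟶ P) :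
    cocart f g N ≫ glob (extDesc γ hL hR) ≫ δ = γ ≫ δ := by
  rw [← Category.assoc, cocart_extDesc]

lemma ext_hom_ext {A B A' B' : D} {f : A ⟶ B} {g : A' ⟶ B'} {N : Hor A A'} {M : Hor B B'}
    {α β : ext f g N ⟶ M} (h : cocart f g N ≫ glob α = cocart f g N ≫ glob β) : α = β := by
  ext
  exact (cocartesian f g N _ (cocart f g N ≫ glob β) (𝟙 _) (𝟙 _) (by simp) (by simp)).unique
    ⟨by simp, by simp, h⟩ ⟨by simp, by simp, rfl⟩

/-- The restriction functor `f^* (-) g^*` between local categories. -/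
def resFunctor {A B A' B' : D} (f : A ⟶ B) (g : A' ⟶ B') : Hor B B' ⥤ Hor A A' where
  obj M := res f g M
  map {M N} α := resLift (cart f g M ≫ glob α) (by simp) (by simp)
  map_id M := res_hom_ext (by simp)
  map_comp α β := res_hom_ext (by simp [resLift_cart_assoc])

@[simp] lemma resFunctor_map_cart {A B A' B' : D} (f : A ⟶ B) (g : A' ⟶ B')
    {M N : Hor B B'} (α : M ⟶ N) :
    glob ((resFunctor f g).map α) ≫ cart f g N = cart f g M ≫ glob α :=
  resLift_cart (cart f g M ≫ glob α) (by simp) (by simp)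

/-- The extension functor `f_! (-) g_!` between local categories. -/
def extFunctor {A B A' B' : D} (f : A ⟶ B) (g : A' ⟶ B') : Hor A A' ⥤ Hor B B' where
  obj M := ext f g M
  map {M N} α := extDesc (glob α ≫ cocart f g N) (by simp) (by simp)
  map_id M := ext_hom_ext (by simp)
  map_comp α β := ext_hom_ext (by simp [cocart_extDesc_assoc])

@[simp] lemma cocart_extFunctor_map {A B A' B' : D} (f : A ⟶ B) (g : A' ⟶ B')
    {M N : Hor A A'} (α : M ⟶ N) :
    cocart f g M ≫ glob ((extFunctor f g).map α) = glob α ≫ cocart f g N :=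
  cocart_extDesc (glob α ≫ cocart f g N) (by simp) (by simp)

/-- Globular 2-cells out of an extension are globular 2-cells into a restriction. -/
def extResEquiv {A B A' B' : D} (f : A ⟶ B) (g : A' ⟶ B') (M : Hor A A') (N : Hor B B') :
    (ext f g M ⟶ N) ≃ (M ⟶ res f g N) where
  toFun α := resLift (cocart f g M ≫ glob α) (by simp) (by simp)
  invFun β := extDesc (glob β ≫ cart f g N) (by simp) (by simp)
  left_inv α := ext_hom_ext (by simp)
  right_inv β := res_hom_ext (by simp)

lemma extResEquiv_cart {A B A' B' : D} (f : A ⟶ B) (g : A' ⟶ B') {M : Hor A A'}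
    {N : Hor B B'} (α : ext f g M ⟶ N) :
    glob (extResEquiv f g M N α) ≫ cart f g N = cocart f g M ≫ glob α :=
  resLift_cart (cocart f g M ≫ glob α) (by simp) (by simp)

lemma cocart_extResEquiv_symm {A B A' B' : D} (f : A ⟶ B) (g : A' ⟶ B')
    {M : Hor A A'} {N : Hor B B'} (β : M ⟶ res f g N) :
    cocart f g M ≫ glob ((extResEquiv f g M N).symm β) = glob β ≫ cart f g N :=
  cocart_extDesc (glob β ≫ cart f g N) (by simp) (by simp)

/-- Extension is left adjoint to restriction. -/
def extResAdjunction {A B A' B' : D} (f : A ⟶ B) (g : A' ⟶ B') :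
    (extFunctor f g : Hor A A' ⥤ Hor B B') ⊣ resFunctor f g :=
  Adjunction.mkOfHomEquiv
    { homEquiv M N := extResEquiv f g M N
      homEquiv_naturality_left_symm {_ M N} α β := ext_hom_ext <|
        (cocart_extResEquiv_symm f g (α ≫ β)).trans <|
        (Category.assoc (glob α) (glob β) (cart f g N)).trans <|
        (congrArg (glob α ≫ ·) (cocart_extResEquiv_symm f g β).symm).trans <|
        (Category.assoc (glob α) (cocart f g M) _).symm.trans <|
        (congrArg (· ≫ glob ((extResEquiv f g M N).symm β)) (cocart_extFunctor_map f g α)).symm.trans <|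
        Category.assoc _ _ _
      homEquiv_naturality_right {M N _} α β := res_hom_ext <|
        (extResEquiv_cart f g (α ≫ β)).trans <|
        (Category.assoc (cocart f g M) (glob α) (glob β)).symm.trans <|
        (congrArg (· ≫ glob β) (extResEquiv_cart f g α).symm).trans <|
        (Category.assoc _ (cart f g N) (glob β)).trans <|
        (congrArg (glob (extResEquiv f g M N α) ≫ ·) (resFunctor_map_cart f g β).symm).trans <|
        (Category.assoc _ _ _).symm }

instance {A B A' B' : D} (f : A ⟶ B) (g : A' ⟶ B') :
    (resFunctor f g : Hor B B' ⥤ Hor A A').IsRightAdjoint :=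
  (extResAdjunction f g).isRightAdjoint

/-- The cartesian 2-cell, with source written as a value of the restriction functor. -/
def resCart {A B A' B' : D} (f : A ⟶ B) (g : A' ⟶ B') (M : Hor B B') :
    OneCell.mk ((resFunctor f g).obj M) ⟶ OneCell.mk M :=
  cart f g M

@[simp] lemma L_resCart {A B A' B' : D} (f : A ⟶ B) (g : A' ⟶ B') (M : Hor B B') :
    L (resCart f g M) = f := L_cart f g M

@[simp] lemma R_resCart {A B A' B' : D} (f : A ⟶ B) (g : A' ⟶ B') (M : Hor B B') :
    R (resCart f g M) = g := R_cart f g M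

/-- The factorization of a 2-cell, with target written as a value of the restriction functor. -/
def resFactor {A B A' B' : D} {f : A ⟶ B} {g : A' ⟶ B'} {N : Hor A A'} {M : Hor B B'}
    (γ : OneCell.mk N ⟶ OneCell.mk M) (hL : L γ = f) (hR : R γ = g) :
    N ⟶ (resFunctor f g).obj M :=
  resLift γ hL hR

@[simp] lemma resFactor_cart {A B A' B' : D} {f : A ⟶ B} {g : A' ⟶ B'} {N : Hor A A'}
    {M : Hor B B'} (γ : OneCell.mk N ⟶ OneCell.mk M) (hL : L γ = f) (hR : R γ = g) :
    glob (resFactor γ hL hR) ≫ resCart f g M = γ :=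
  resLift_cart γ hL hR

lemma resFactor_cart_assoc {A B A' B' : D} {f : A ⟶ B} {g : A' ⟶ B'} {N : Hor A A'}
    {M : Hor B B'} (γ : OneCell.mk N ⟶ OneCell.mk M) (hL : L γ = f) (hR : R γ = g)
    {P : OneCell (Hor (D := D))} (δ : OneCell.mk M ⟶ P) :
    glob (resFactor γ hL hR) ≫ resCart f g M ≫ δ = γ ≫ δ := by
  rw [← Category.assoc, resFactor_cart]

lemma resFunctor_hom_ext {A B A' B' : D} {f : A ⟶ B} {g : A' ⟶ B'} {N : Hor A A'} {M : Hor B B'}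
    {α β : N ⟶ (resFunctor f g).obj M}
    (h : glob α ≫ resCart f g M = glob β ≫ resCart f g M) : α = β :=
  res_hom_ext h

@[simp] lemma map_resCart {A B A' B' : D} (f : A ⟶ B) (g : A' ⟶ B') {M N : Hor B B'}
    (α : M ⟶ N) :
    glob ((resFunctor f g).map α) ≫ resCart f g N = resCart f g M ≫ glob α :=
  resFunctor_map_cart f g α

end Framed

/-- A framed bicategory is closed when horizontal composition has right adjoints in both variables,
i.e. when its horizontal bicategory is closed. -/
class ClosedFramedBicategory (D : Type u) [Category.{v} D] [DoubleCategory.{w, v₁} D]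
    [FramedBicategory D] : Prop where
  left {A B C : D} (M : Hor A B) : ((hcompFunctor A B C).obj M).IsLeftAdjoint
  right {A B C : D} (N : Hor B C) : ((hcompFunctor A B C).flip.obj N).IsLeftAdjoint

/-- A framed bicategory is abelian when its local categories are abelian and horizontal composition
is additive in both variables. -/
class AbelianFramedBicategory (D : Type u) [Category.{v} D] [DoubleCategory.{w, v₁} D]
    [FramedBicategory D] where
  abelian (A B : D) : Abelian (Hor A B)
  additive_left {A B C : D} (M : Hor A B) : ((hcompFunctor A B C).obj M).Additive
  additive_right {A B C : D} (N : Hor B C) : ((hcompFunctor A B C).flip.obj N).Additive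

attribute [reducible, instance] AbelianFramedBicategory.abelian

/-- The data of a monoidal structure on a double category whose vertical category is monoidal: a
tensor product `M ⊗ N : A ⊗ C ⇸ B ⊗ E` of 1-cells `M : A ⇸ B`, `N : C ⇸ E`, a tensor product of
2-cells, and constraint isomorphisms in the horizontal category, whose monoidal unit is `U I`. -/
class MonoidalDoubleCategoryStruct (D : Type u) [Category.{v} D] [MonoidalCategory D]
    [DoubleCategory.{w, v₁} D] where
  tens {A B C E : D} (M : Hor A B) (N : Hor C E) : Hor (A ⊗ C) (B ⊗ E)
  tensMap {M M' N N' : OneCell (Hor (D := D))} (α : M ⟶ M') (β : N ⟶ N') :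
    OneCell.mk (tens M.cell N.cell) ⟶ OneCell.mk (tens M'.cell N'.cell)
  tassoc (M N P : OneCell (Hor (D := D))) :
    OneCell.mk (tens (tens M.cell N.cell) P.cell) ≅ OneCell.mk (tens M.cell (tens N.cell P.cell))
  tlunit (M : OneCell (Hor (D := D))) : OneCell.mk (tens (U (𝟙_ D)) M.cell) ≅ M
  trunit (M : OneCell (Hor (D := D))) : OneCell.mk (tens M.cell (U (𝟙_ D))) ≅ M
  /-- the interchange isomorphism `(M ⊗ P) ⊙ (N ⊗ Q) ≅ (M ⊙ N) ⊗ (P ⊙ Q)` -/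
  inter {A B C A' B' C' : D} (M : Hor A B) (N : Hor B C) (P : Hor A' B') (Q : Hor B' C') :
    OneCell.mk (hcomp (tens M P) (tens N Q)) ≅ OneCell.mk (tens (hcomp M N) (hcomp P Q))
  /-- the isomorphism `U (A ⊗ B) ≅ U A ⊗ U B` -/
  interU (A B : D) : OneCell.mk (U (A ⊗ B)) ≅ OneCell.mk (tens (U A) (U B))

open MonoidalDoubleCategoryStruct

/-- The tensor product on the horizontal category. -/
instance horizontalMonoidalStruct (D : Type u) [Category.{v} D] [MonoidalCategory D]
    [DoubleCategory.{w, v₁} D] [MonoidalDoubleCategoryStruct D] :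
    MonoidalCategoryStruct (OneCell (Hor (D := D))) where
  tensorObj M N := OneCell.mk (tens M.cell N.cell)
  tensorHom α β := tensMap α β
  whiskerLeft M _ _ β := tensMap (𝟙 M) β
  whiskerRight α N := tensMap α (𝟙 N)
  tensorUnit := OneCell.mk (U (𝟙_ D))
  associator M N P := tassoc M N P
  leftUnitor M := tlunit M
  rightUnitor M := trunit M

/-- A monoidal double category, i.e. a pseudomonoid in double categories: the vertical and the
horizontal category are monoidal, the frame functors `L` and `R` are strict monoidal, the
interchange isomorphisms are natural and globular and make the tensor product a (pseudo) double
functor, and the associativity and unit isomorphisms are transformations of double functors. -/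
class MonoidalDoubleCategory (D : Type u) [Category.{v} D] [MonoidalCategory D]
    [DoubleCategory.{w, v₁} D] extends MonoidalDoubleCategoryStruct D where
  L_tensMap {M M' N N' : OneCell (Hor (D := D))} (α : M ⟶ M') (β : N ⟶ N') :
    L (tensMap α β) = L α ⊗ₘ L β
  R_tensMap {M M' N N' : OneCell (Hor (D := D))} (α : M ⟶ M') (β : N ⟶ N') :
    R (tensMap α β) = R α ⊗ₘ R β
  L_tassoc (M N P : OneCell (Hor (D := D))) :
    L (tassoc M N P).hom = (α_ M.left N.left P.left).hom
  R_tassoc (M N P : OneCell (Hor (D := D))) :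
    R (tassoc M N P).hom = (α_ M.right N.right P.right).hom
  L_tlunit (M : OneCell (Hor (D := D))) : L (tlunit M).hom = (λ_ M.left).hom
  R_tlunit (M : OneCell (Hor (D := D))) : R (tlunit M).hom = (λ_ M.right).hom
  L_trunit (M : OneCell (Hor (D := D))) : L (trunit M).hom = (ρ_ M.left).hom
  R_trunit (M : OneCell (Hor (D := D))) : R (trunit M).hom = (ρ_ M.right).hom
  L_inter {A B C A' B' C' : D} (M : Hor A B) (N : Hor B C) (P : Hor A' B') (Q : Hor B' C') :
    L (inter M N P Q).hom = 𝟙 (A ⊗ A')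
  R_inter {A B C A' B' C' : D} (M : Hor A B) (N : Hor B C) (P : Hor A' B') (Q : Hor B' C') :
    R (inter M N P Q).hom = 𝟙 (C ⊗ C')
  L_interU (A B : D) : L (interU A B).hom = 𝟙 (A ⊗ B)
  R_interU (A B : D) : R (interU A B).hom = 𝟙 (A ⊗ B)
  -- the horizontal category is monoidal
  tensMap_id (M N : OneCell (Hor (D := D))) : (𝟙 M ⊗ₘ 𝟙 N) = 𝟙 (M ⊗ N)
  tensMap_comp {M M' M'' N N' N'' : OneCell (Hor (D := D))} (α : M ⟶ M') (β : N ⟶ N')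
    (α' : M' ⟶ M'') (β' : N' ⟶ N'') :
    ((α ≫ α') ⊗ₘ (β ≫ β')) = (α ⊗ₘ β) ≫ (α' ⊗ₘ β')
  tassoc_naturality {M M' N N' P P' : OneCell (Hor (D := D))} (α : M ⟶ M') (β : N ⟶ N')
    (γ : P ⟶ P') :
    ((α ⊗ₘ β) ⊗ₘ γ) ≫ (α_ M' N' P').hom = (α_ M N P).hom ≫ (α ⊗ₘ (β ⊗ₘ γ))
  tlunit_naturality {M M' : OneCell (Hor (D := D))} (α : M ⟶ M') :
    (𝟙 (𝟙_ (OneCell (Hor (D := D)))) ⊗ₘ α) ≫ (λ_ M').hom = (λ_ M).hom ≫ α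
  trunit_naturality {M M' : OneCell (Hor (D := D))} (α : M ⟶ M') :
    (α ⊗ₘ 𝟙 (𝟙_ (OneCell (Hor (D := D))))) ≫ (ρ_ M').hom = (ρ_ M).hom ≫ α
  tens_pentagon (M N P Q : OneCell (Hor (D := D))) :
    ((α_ M N P).hom ⊗ₘ 𝟙 Q) ≫ (α_ M (N ⊗ P) Q).hom ≫ (𝟙 M ⊗ₘ (α_ N P Q).hom) =
      (α_ (M ⊗ N) P Q).hom ≫ (α_ M N (P ⊗ Q)).hom
  tens_triangle (M N : OneCell (Hor (D := D))) :
    (α_ M (𝟙_ _) N).hom ≫ (𝟙 M ⊗ₘ (λ_ N).hom) = (ρ_ M).hom ⊗ₘ 𝟙 N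
  -- the tensor product is a double functor
  inter_naturality {A₁ B₁ C₁ A₂ B₂ C₂ A₁' B₁' C₁' A₂' B₂' C₂' : D}
    {M : Hor A₁ B₁} {N : Hor B₁ C₁} {P : Hor A₂ B₂} {Q : Hor B₂ C₂}
    {M' : Hor A₁' B₁'} {N' : Hor B₁' C₁'} {P' : Hor A₂' B₂'} {Q' : Hor B₂' C₂'}
    (α : OneCell.mk M ⟶ OneCell.mk M') (β : OneCell.mk N ⟶ OneCell.mk N')
    (γ : OneCell.mk P ⟶ OneCell.mk P') (δ : OneCell.mk Q ⟶ OneCell.mk Q')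
    (h : R α = L β) (h' : R γ = L δ) :
    hmap (tensMap α γ) (tensMap β δ) (by rw [R_tensMap, L_tensMap, h, h']) ≫
        (inter M' N' P' Q').hom =
      (inter M N P Q).hom ≫ tensMap (hmap α β h) (hmap γ δ h')
  interU_naturality {A B A' B' : D} (f : A ⟶ A') (g : B ⟶ B') :
    Umap (f ⊗ₘ g) ≫ (interU A' B').hom = (interU A B).hom ≫ tensMap (Umap f) (Umap g)
  inter_assoc {A B C E A' B' C' E' : D} (M : Hor A B) (N : Hor B C) (P : Hor C E)
    (M' : Hor A' B') (N' : Hor B' C') (P' : Hor C' E') :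
    (assoc (tens M M') (tens N N') (tens P P')).hom ≫
        hmap (inter M N M' N').hom (𝟙 (OneCell.mk (tens P P'))) (by rw [R_inter, L_id]) ≫
          (inter (hcomp M N) P (hcomp M' N') P').hom =
      hmap (𝟙 (OneCell.mk (tens M M'))) (inter N P N' P').hom (by rw [L_inter, R_id]) ≫
        (inter M (hcomp N P) M' (hcomp N' P')).hom ≫
          tensMap (assoc M N P).hom (assoc M' N' P').hom
  inter_lunit {A B A' B' : D} (M : Hor A B) (N : Hor A' B') :
    hmap (interU A A').hom (𝟙 (OneCell.mk (tens M N))) (by rw [R_interU, L_id]) ≫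
        (inter (U A) M (U A') N).hom ≫ tensMap (lunit M).hom (lunit N).hom =
      (lunit (tens M N)).hom
  inter_runit {A B A' B' : D} (M : Hor A B) (N : Hor A' B') :
    hmap (𝟙 (OneCell.mk (tens M N))) (interU B B').hom (by rw [L_interU, R_id]) ≫
        (inter M (U B) N (U B')).hom ≫ tensMap (runit M).hom (runit N).hom =
      (runit (tens M N)).hom
  -- the associativity isomorphism is a transformation of double functors
  tassoc_inter {A₁ B₁ C₁ A₂ B₂ C₂ A₃ B₃ C₃ : D} (M₁ : Hor A₁ B₁) (N₁ : Hor B₁ C₁)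
    (M₂ : Hor A₂ B₂) (N₂ : Hor B₂ C₂) (M₃ : Hor A₃ B₃) (N₃ : Hor B₃ C₃) :
    hmap (tassoc (OneCell.mk M₁) (OneCell.mk M₂) (OneCell.mk M₃)).hom
          (tassoc (OneCell.mk N₁) (OneCell.mk N₂) (OneCell.mk N₃)).hom
          (by rw [R_tassoc, L_tassoc]) ≫
        (inter M₁ N₁ (tens M₂ M₃) (tens N₂ N₃)).hom ≫
          tensMap (𝟙 (OneCell.mk (hcomp M₁ N₁))) (inter M₂ N₂ M₃ N₃).hom =
      (inter (tens M₁ M₂) (tens N₁ N₂) M₃ N₃).hom ≫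
        tensMap (inter M₁ N₁ M₂ N₂).hom (𝟙 (OneCell.mk (hcomp M₃ N₃))) ≫
          (tassoc (OneCell.mk (hcomp M₁ N₁)) (OneCell.mk (hcomp M₂ N₂))
            (OneCell.mk (hcomp M₃ N₃))).hom
  tassoc_interU (A B C : D) :
    Umap (α_ A B C).hom ≫ (interU A (B ⊗ C)).hom ≫
        tensMap (𝟙 (OneCell.mk (U A))) (interU B C).hom =
      (interU (A ⊗ B) C).hom ≫ tensMap (interU A B).hom (𝟙 (OneCell.mk (U C))) ≫
        (tassoc (OneCell.mk (U A)) (OneCell.mk (U B)) (OneCell.mk (U C))).hom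
  -- the unit isomorphisms are transformations of double functors
  tlunit_inter {A B C : D} (M : Hor A B) (N : Hor B C) :
    hmap (tlunit (OneCell.mk M)).hom (tlunit (OneCell.mk N)).hom (by rw [R_tlunit, L_tlunit]) =
      (inter (U (𝟙_ D)) (U (𝟙_ D)) M N).hom ≫
        tensMap (lunit (U (𝟙_ D))).hom (𝟙 (OneCell.mk (hcomp M N))) ≫
          (tlunit (OneCell.mk (hcomp M N))).hom
  tlunit_interU (A : D) :
    (interU (𝟙_ D) A).hom ≫ (tlunit (OneCell.mk (U A))).hom = Umap (λ_ A).hom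
  trunit_inter {A B C : D} (M : Hor A B) (N : Hor B C) :
    hmap (trunit (OneCell.mk M)).hom (trunit (OneCell.mk N)).hom (by rw [R_trunit, L_trunit]) =
      (inter M N (U (𝟙_ D)) (U (𝟙_ D))).hom ≫
        tensMap (𝟙 (OneCell.mk (hcomp M N))) (lunit (U (𝟙_ D))).hom ≫
          (trunit (OneCell.mk (hcomp M N))).hom
  trunit_interU (A : D) :
    (interU A (𝟙_ D)).hom ≫ (trunit (OneCell.mk (U A))).hom = Umap (ρ_ A).hom

attribute [simp] MonoidalDoubleCategory.L_tensMap MonoidalDoubleCategory.R_tensMap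

section Tensor

variable {D : Type u} [Category.{v} D] [MonoidalCategory D] [DoubleCategory.{w, v₁} D]
  [MonoidalDoubleCategory D]

open MonoidalDoubleCategory

lemma tensMap_id' {A B C E : D} (M : Hor A B) (N : Hor C E) :
    tensMap (𝟙 (OneCell.mk M)) (𝟙 (OneCell.mk N)) = 𝟙 (OneCell.mk (tens M N)) :=
  tensMap_id _ _

lemma tensMap_comp' {M M' M'' N N' N'' : OneCell (Hor (D := D))} (α : M ⟶ M') (β : N ⟶ N')
    (α' : M' ⟶ M'') (β' : N' ⟶ N'') :
    tensMap (α ≫ α') (β ≫ β') = tensMap α β ≫ tensMap α' β' :=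
  tensMap_comp _ _ _ _

/-- The external tensor product as a functor of two variables on local categories. -/
def tensFunctor (A B C E : D) : Hor A B ⥤ Hor C E ⥤ Hor (A ⊗ C) (B ⊗ E) where
  obj M :=
    { obj N := tens M N
      map β := mkGlob (tensMap (𝟙 (OneCell.mk M)) (glob β)) (by simp) (by simp)
      map_id N := by ext; simp [tensMap_id']
      map_comp β β' := by ext; simp [← tensMap_comp'] }
  map α :=
    { app N := mkGlob (tensMap (glob α) (𝟙 (OneCell.mk N))) (by simp) (by simp)
      naturality N N' β := by ext; simp [← tensMap_comp'] }
  map_id M := by ext; simp [tensMap_id']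
  map_comp α α' := by ext; simp [← tensMap_comp']

/-- The tensor product of 2-cells, with source and target written as values of `tensFunctor`. -/
def tensCell {A B C E A' B' C' E' : D} {M : Hor A B} {N : Hor C E} {M' : Hor A' B'}
    {N' : Hor C' E'} (α : OneCell.mk M ⟶ OneCell.mk M') (β : OneCell.mk N ⟶ OneCell.mk N') :
    OneCell.mk (((tensFunctor A B C E).obj M).obj N) ⟶
      OneCell.mk (((tensFunctor A' B' C' E').obj M').obj N') :=
  tensMap α β

lemma L_tensCell {A B C E A' B' C' E' : D} {M : Hor A B} {N : Hor C E} {M' : Hor A' B'}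
    {N' : Hor C' E'} (α : OneCell.mk M ⟶ OneCell.mk M') (β : OneCell.mk N ⟶ OneCell.mk N') :
    L (tensCell α β) = L α ⊗ₘ L β := L_tensMap _ _

lemma R_tensCell {A B C E A' B' C' E' : D} {M : Hor A B} {N : Hor C E} {M' : Hor A' B'}
    {N' : Hor C' E'} (α : OneCell.mk M ⟶ OneCell.mk M') (β : OneCell.mk N ⟶ OneCell.mk N') :
    R (tensCell α β) = R α ⊗ₘ R β := R_tensMap _ _

lemma tensCell_comp {A B C E A' B' C' E' A'' B'' C'' E'' : D} {M : Hor A B} {N : Hor C E}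
    {M' : Hor A' B'} {N' : Hor C' E'} {M'' : Hor A'' B''} {N'' : Hor C'' E''}
    (α : OneCell.mk M ⟶ OneCell.mk M') (β : OneCell.mk N ⟶ OneCell.mk N')
    (α' : OneCell.mk M' ⟶ OneCell.mk M'') (β' : OneCell.mk N' ⟶ OneCell.mk N'') :
    tensCell (α ≫ α') (β ≫ β') = tensCell α β ≫ tensCell α' β' := tensMap_comp _ _ _ _

lemma glob_tensFunctor_map_app {A B C E : D} {M M' : Hor A B} (α : M ⟶ M') (N : Hor C E) :
    glob (((tensFunctor A B C E).map α).app N) = tensCell (glob α) (𝟙 _) := rfl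

lemma glob_tensFunctor_obj_map {A B C E : D} (M : Hor A B) {N N' : Hor C E} (β : N ⟶ N') :
    glob (((tensFunctor A B C E).obj M).map β) = tensCell (𝟙 _) (glob β) := rfl

end Tensor

/-- A monoidal abelian framed bicategory: monoidal, abelian, and the tensor product is additive in
both variables on local categories. -/
class MonoidalAbelianFramedBicategory (D : Type u) [Category.{v} D] [MonoidalCategory D]
    [DoubleCategory.{w, v₁} D] [FramedBicategory D] [AbelianFramedBicategory D]
    [MonoidalDoubleCategory D] : Prop where
  additive_left {A B C E : D} (M : Hor A B) : ((tensFunctor A B C E).obj M).Additive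
  additive_right {A B C E : D} (N : Hor C E) : ((tensFunctor A B C E).flip.obj N).Additive

attribute [instance] MonoidalAbelianFramedBicategory.additive_left

attribute [instance] Abelian.hasFiniteBiproducts

noncomputable section KunnethMap

variable {A₁ A₂ A : Type*} [Category* A₁] [Category* A₂] [Category* A] [Abelian A₁] [Abelian A₂]
  [Abelian A] (t : A₁ ⥤ A₂ ⥤ A) [t.Additive] [∀ X, (t.obj X).Additive]
  (K₁ : ChainComplex A₁ ℕ) (K₂ : ChainComplex A₂ ℕ)

instance additive_flip_obj (Y : A₂) : (t.flip.obj Y).Additive where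
  map_add {_ _ f g} := by simp [t.map_add]

instance finite_bidegree (k n : ℕ) : Finite {p : ℕ × ℕ // p.1 + p.2 + k = n} :=
  Finite.of_injective
    (fun p => ((⟨p.1.1, by omega⟩, ⟨p.1.2, by omega⟩) : Fin (n + 1) × Fin (n + 1)))
    (fun p q h => by
      simp only [Prod.mk.injEq, Fin.mk.injEq] at h
      exact Subtype.ext (Prod.ext h.1 h.2))

instance hasMapBifunctor :
    HomologicalComplex.HasMapBifunctor K₁ K₂ t (ComplexShape.down ℕ) := fun n => by
  have : Finite ((ComplexShape.π (ComplexShape.down ℕ) (ComplexShape.down ℕ)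
      (ComplexShape.down ℕ)) ⁻¹' {n}) :=
    Finite.of_injective (β := {p : ℕ × ℕ // p.1 + p.2 + 0 = n}) (fun p => ⟨p.1, p.2⟩)
      (fun p q h => Subtype.ext (congrArg (fun r => r.1) h))
  infer_instance

/-- The chain complex `t(K₁, K₂)`: in degree `n` it is the direct sum of the `t((K₁)_i, (K₂)_j)`
with `i + j = n`, with differential `t(d, 1) + (-1)^i t(1, d)` on the summand `(i, j)`. -/
abbrev tensorComplex : ChainComplex A ℕ :=
  HomologicalComplex.mapBifunctor K₁ K₂ t (ComplexShape.down ℕ)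

/-- The first left derived functor of the bifunctor `t`: the first homology of `t(P, Q)` where `P`
and `Q` are projective resolutions of the two arguments. -/
def tor₁ [EnoughProjectives A₁] [EnoughProjectives A₂] (X : A₁) (Y : A₂) : A :=
  (tensorComplex t (projectiveResolution X).complex (projectiveResolution Y).complex).homology 1

/-- A functor of two variables is right exact if it is so in each variable. -/
structure RightExactBifunctor : Prop where
  left (Y : A₂) : PreservesFiniteColimits (t.flip.obj Y)
  right (X : A₁) : PreservesFiniteColimits (t.obj X)

/-- The direct sum, over all `i` and `j` with `i + j + k = n`, of the objects `F i j`.  For `k = 0`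
this is the degree `n` part of a bigraded object; for `k = 1` it is the degree `n - 1` part. -/
abbrev gradedSum (F : ℕ → ℕ → A) (k n : ℕ) : A :=
  ⨁ fun p : {p : ℕ × ℕ // p.1 + p.2 + k = n} => F p.1.1 p.1.2

/-- A morphism out of `G (H_i K)`, for a right exact functor `G`, from a morphism out of `G (Z_i K)`
that vanishes on boundaries. -/
def homologyDesc (G : A₁ ⥤ A) [G.Additive] (hG : PreservesFiniteColimits G) (i : ℕ) {W : A}
    (φ : G.obj (K₁.cycles i) ⟶ W) (hφ : G.map (K₁.toCycles (i + 1) i) ≫ φ = 0) :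
    G.obj (K₁.homology i) ⟶ W :=
  (CokernelCofork.mapIsColimit _ (K₁.homologyIsCokernel (i + 1) i (by simp)) G).desc
    (CokernelCofork.ofπ φ hφ)

lemma map_π_homologyDesc (G : A₁ ⥤ A) [G.Additive] (hG : PreservesFiniteColimits G)
    (i : ℕ) {W : A} (φ : G.obj (K₁.cycles i) ⟶ W) (hφ : G.map (K₁.toCycles (i + 1) i) ≫ φ = 0) :
    G.map (K₁.homologyπ i) ≫ homologyDesc K₁ G hG i φ hφ = φ :=
  (CokernelCofork.mapIsColimit _ (K₁.homologyIsCokernel (i + 1) i (by simp)) G).fac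
    (CokernelCofork.ofπ φ hφ) WalkingParallelPair.one

/-- The inclusion `t((K₁)_i, (K₂)_j) ⟶ t(K₁, K₂)_n`, for `i + j = n`. -/
abbrev ιTensor (i j n : ℕ) (h : i + j = n) :
    (t.obj (K₁.X i)).obj (K₂.X j) ⟶ (tensorComplex t K₁ K₂).X n :=
  HomologicalComplex.ιMapBifunctor K₁ K₂ t (ComplexShape.down ℕ) i j n h

lemma iCycles_d₁ (i j m : ℕ) : (t.map (K₁.iCycles i)).app (K₂.X j) ≫
    HomologicalComplex.mapBifunctor.d₁ K₁ K₂ t (ComplexShape.down ℕ) i j m = 0 := by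
  by_cases hi : (ComplexShape.down ℕ).Rel i ((ComplexShape.down ℕ).next i)
  · rw [HomologicalComplex.mapBifunctor.d₁_eq' _ _ _ _ hi, Linear.comp_units_smul,
      ← NatTrans.comp_app_assoc, ← t.map_comp]
    simp
  · rw [HomologicalComplex.mapBifunctor.d₁_eq_zero _ _ _ _ _ _ _ hi, comp_zero]

lemma iCycles_d₂ (i j m : ℕ) : (t.obj (K₁.X i)).map (K₂.iCycles j) ≫
    HomologicalComplex.mapBifunctor.d₂ K₁ K₂ t (ComplexShape.down ℕ) i j m = 0 := by
  by_cases hj : (ComplexShape.down ℕ).Rel j ((ComplexShape.down ℕ).next j)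
  · rw [HomologicalComplex.mapBifunctor.d₂_eq' _ _ _ _ _ hj, Linear.comp_units_smul,
      ← Functor.map_comp_assoc]
    simp
  · rw [HomologicalComplex.mapBifunctor.d₂_eq_zero _ _ _ _ _ _ _ hj, comp_zero]

/-- The exterior product of cycles is a cycle: `t(Z_i K₁, Z_j K₂) ⟶ Z_n t(K₁, K₂)`. -/
def cyclesProduct (i j n : ℕ) (h : i + j = n) :
    (t.obj (K₁.cycles i)).obj (K₂.cycles j) ⟶ (tensorComplex t K₁ K₂).cycles n :=
  (tensorComplex t K₁ K₂).liftCycles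
    ((t.obj _).map (K₂.iCycles j) ≫ (t.map (K₁.iCycles i)).app _ ≫ ιTensor t K₁ K₂ i j n h) _ rfl
    (by
      rw [HomologicalComplex.mapBifunctor.d_eq]
      simp only [Category.assoc, Preadditive.comp_add, HomologicalComplex.mapBifunctor.ι_D₁,
        HomologicalComplex.mapBifunctor.ι_D₂]
      rw [iCycles_d₁, NatTrans.naturality_assoc, iCycles_d₂, comp_zero, comp_zero, add_zero])

lemma cyclesProduct_i (i j n : ℕ) (h : i + j = n) :
    cyclesProduct t K₁ K₂ i j n h ≫ (tensorComplex t K₁ K₂).iCycles n =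
      (t.obj _).map (K₂.iCycles j) ≫ (t.map (K₁.iCycles i)).app _ ≫ ιTensor t K₁ K₂ i j n h :=
  HomologicalComplex.liftCycles_i _ _ _ _ _

lemma boundary_cyclesProduct (i j n : ℕ) (h : i + j = n) :
    (t.map (K₁.toCycles (i + 1) i)).app (K₂.cycles j) ≫ cyclesProduct t K₁ K₂ i j n h ≫
      (tensorComplex t K₁ K₂).homologyπ n = 0 := by
  have e : (t.map (K₁.toCycles (i + 1) i)).app (K₂.cycles j) ≫ cyclesProduct t K₁ K₂ i j n h =
      ComplexShape.ε₁ (ComplexShape.down ℕ) (ComplexShape.down ℕ) (ComplexShape.down ℕ) (i + 1, j) •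
      ((t.obj (K₁.X (i + 1))).map (K₂.iCycles j) ≫
        ιTensor t K₁ K₂ (i + 1) j (n + 1) (by omega) ≫
          (tensorComplex t K₁ K₂).toCycles (n + 1) n) := by
    rw [← cancel_mono ((tensorComplex t K₁ K₂).iCycles n), Category.assoc, cyclesProduct_i,
      Linear.units_smul_comp]
    simp only [Category.assoc, HomologicalComplex.toCycles_i]
    rw [HomologicalComplex.mapBifunctor.d_eq]
    simp only [Preadditive.comp_add, HomologicalComplex.mapBifunctor.ι_D₁,
      HomologicalComplex.mapBifunctor.ι_D₂]
    rw [iCycles_d₂, add_zero, HomologicalComplex.mapBifunctor.d₁_eq K₁ K₂ t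
      (ComplexShape.down ℕ) (i₁ := i + 1) (i₁' := i) (by simp) j n h, Linear.comp_units_smul,
      smul_smul, Int.units_mul_self, one_smul, ← NatTrans.naturality_assoc,
      ← NatTrans.comp_app_assoc, ← t.map_comp, HomologicalComplex.toCycles_i,
      NatTrans.naturality_assoc]
  rw [← Category.assoc, e, Linear.units_smul_comp]
  simp

lemma cyclesProduct_boundary (i j n : ℕ) (h : i + j = n) :
    (t.obj (K₁.cycles i)).map (K₂.toCycles (j + 1) j) ≫ cyclesProduct t K₁ K₂ i j n h ≫
      (tensorComplex t K₁ K₂).homologyπ n = 0 := by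
  have e : (t.obj (K₁.cycles i)).map (K₂.toCycles (j + 1) j) ≫ cyclesProduct t K₁ K₂ i j n h =
      ComplexShape.ε₂ (ComplexShape.down ℕ) (ComplexShape.down ℕ) (ComplexShape.down ℕ) (i, j + 1) •
      ((t.map (K₁.iCycles i)).app (K₂.X (j + 1)) ≫
        ιTensor t K₁ K₂ i (j + 1) (n + 1) (by omega) ≫
          (tensorComplex t K₁ K₂).toCycles (n + 1) n) := by
    rw [← cancel_mono ((tensorComplex t K₁ K₂).iCycles n), Category.assoc, cyclesProduct_i,
      Linear.units_smul_comp]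
    simp only [Category.assoc, HomologicalComplex.toCycles_i]
    rw [HomologicalComplex.mapBifunctor.d_eq]
    simp only [Preadditive.comp_add, HomologicalComplex.mapBifunctor.ι_D₁,
      HomologicalComplex.mapBifunctor.ι_D₂]
    rw [iCycles_d₁, zero_add, HomologicalComplex.mapBifunctor.d₂_eq K₁ K₂ t
      (ComplexShape.down ℕ) i (i₂ := j + 1) (i₂' := j) (by simp) n h, Linear.comp_units_smul,
      smul_smul, Int.units_mul_self, one_smul, ← Functor.map_comp_assoc,
      HomologicalComplex.toCycles_i, NatTrans.naturality_assoc]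
  rw [← Category.assoc, e, Linear.units_smul_comp]
  simp

variable {t} (ht : RightExactBifunctor t)

/-- The map `t(H_i K₁, H_j K₂) ⟶ H_n t(K₁, K₂)` for `i + j = n`: the unique one which is induced by
the exterior product of cycles, see `π_kunnethComponent`. -/
def kunnethComponent (i j n : ℕ) (h : i + j = n) :
    (t.obj (K₁.homology i)).obj (K₂.homology j) ⟶ (tensorComplex t K₁ K₂).homology n :=
  homologyDesc K₂ (t.obj (K₁.homology i)) (ht.right _) j
    (homologyDesc K₁ (t.flip.obj (K₂.cycles j)) (ht.left _) i
      (cyclesProduct t K₁ K₂ i j n h ≫ (tensorComplex t K₁ K₂).homologyπ n)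
      (boundary_cyclesProduct t K₁ K₂ i j n h))
    (by
      have := ht.left (K₂.X (j + 1))
      have : Epi ((t.map (K₁.homologyπ i)).app (K₂.X (j + 1))) :=
        inferInstanceAs (Epi ((t.flip.obj (K₂.X (j + 1))).map (K₁.homologyπ i)))
      rw [← cancel_epi ((t.map (K₁.homologyπ i)).app (K₂.X (j + 1))), comp_zero,
        ← NatTrans.naturality_assoc]
      refine Eq.trans ?_ (cyclesProduct_boundary t K₁ K₂ i j n h)
      exact congrArg ((t.obj (K₁.cycles i)).map (K₂.toCycles (j + 1) j) ≫ ·)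
        (map_π_homologyDesc K₁ (t.flip.obj (K₂.cycles j)) (ht.left _) i _ _))

lemma π_kunnethComponent (i j n : ℕ) (h : i + j = n) :
    (t.map (K₁.homologyπ i)).app (K₂.cycles j) ≫ (t.obj (K₁.homology i)).map (K₂.homologyπ j) ≫
        kunnethComponent K₁ K₂ ht i j n h =
      cyclesProduct t K₁ K₂ i j n h ≫ (tensorComplex t K₁ K₂).homologyπ n :=
  (congrArg ((t.map (K₁.homologyπ i)).app (K₂.cycles j) ≫ ·)
    (map_π_homologyDesc K₂ (t.obj (K₁.homology i)) (ht.right _) j _ _)).trans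
    (map_π_homologyDesc K₁ (t.flip.obj (K₂.cycles j)) (ht.left _) i _ _)

/-- The Künneth homomorphism `α` in degree `n`, from the direct sum of the `t(H_i K₁, H_j K₂)` with
`i + j = n` to `H_n t(K₁, K₂)`. -/
def kunnethMap (n : ℕ) :
    gradedSum (fun i j => (t.obj (K₁.homology i)).obj (K₂.homology j)) 0 n ⟶
      (tensorComplex t K₁ K₂).homology n :=
  biproduct.desc fun p => kunnethComponent K₁ K₂ ht p.1.1 p.1.2 n p.2

/-- A graded object, as a complex with zero differential. -/
@[simps] def zeroDiff (G : ℕ → A₁) : ChainComplex A₁ ℕ where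
  X := G
  d _ _ := 0

/-- The graded object `B(K)` of boundaries of `K`. -/
abbrev boundaries (i : ℕ) : A₁ := image (K₁.d (i + 1) i)

/-- The conditions of the algebraic Künneth theorem for the additive bifunctor `t` and the complexes
`K₁`, `K₂`: `t` is right exact; the homomorphisms
`α₁ : t(B(K₁), H(K₂)) ⟶ H t(B(K₁), K₂)` and `α₂ : t(Z(K₁), H(K₂)) ⟶ H t(Z(K₁), K₂)` are
isomorphisms, where the graded objects `B(K₁)` and `Z(K₁)` are complexes with zero differential
(which are their own homology); and `t₁(B(K₁), K₂) = 0 = t₁(Z(K₁), H(K₂))`. -/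
structure AlgebraicKunnethConditions (t : A₁ ⥤ A₂ ⥤ A) [t.Additive] [∀ X, (t.obj X).Additive]
    [EnoughProjectives A₁] [EnoughProjectives A₂]
    (K₁ : ChainComplex A₁ ℕ) (K₂ : ChainComplex A₂ ℕ) : Prop where
  rightExact : RightExactBifunctor t
  isIso_boundaries (n : ℕ) : IsIso (kunnethMap (zeroDiff (boundaries K₁)) K₂ rightExact n)
  isIso_cycles (n : ℕ) : IsIso (kunnethMap (zeroDiff fun i => K₁.cycles i) K₂ rightExact n)
  tor_boundaries (i j : ℕ) : IsZero (tor₁ t (boundaries K₁ i) (K₂.X j))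
  tor_cycles (i j : ℕ) : IsZero (tor₁ t (K₁.cycles i) (K₂.homology j))

end KunnethMap

noncomputable section Chains

variable {D : Type u} [Category.{v} D] [DoubleCategory.{w, v₁} D] [FramedBicategory D]
  [AbelianFramedBicategory D]

/-- A chain complex (in nonnegative degrees) in an abelian framed bicategory: a chain complex in one
of its local categories. -/
structure FramedComplex (D : Type u) [Category.{v} D] [DoubleCategory.{w, v₁} D]
    [FramedBicategory D] [AbelianFramedBicategory D] where
  {left : D}
  {right : D}
  cplx : ChainComplex (Hor left right) ℕ

instance {A B A' B' : D} (f : A ⟶ B) (g : A' ⟶ B') :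
    PreservesLimits (resFunctor f g : Hor B B' ⥤ Hor A A') :=
  (extResAdjunction f g).rightAdjoint_preservesLimits

instance additive_resFunctor {A B A' B' : D} (f : A ⟶ B) (g : A' ⟶ B') :
    (resFunctor f g : Hor B B' ⥤ Hor A A').Additive :=
  have := (resFunctor f g : Hor B B' ⥤ Hor A A').preservesZeroMorphisms_of_isRightAdjoint
  Functor.additive_of_preserves_binary_products _

namespace FramedComplex

/-- A morphism of chain complexes in an abelian framed bicategory: a pair of vertical arrows and a
sequence of 2-cells over it that commute with the differentials. -/
@[ext]
structure Hom (K K' : FramedComplex D) where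
  f : K.left ⟶ K'.left
  g : K.right ⟶ K'.right
  cell (n : ℕ) : OneCell.mk (K.cplx.X n) ⟶ OneCell.mk (K'.cplx.X n)
  L_cell (n : ℕ) : L (cell n) = f
  R_cell (n : ℕ) : R (cell n) = g
  comm (n : ℕ) : glob (K.cplx.d (n + 1) n) ≫ cell n = cell (n + 1) ≫ glob (K'.cplx.d (n + 1) n)

attribute [simp] Hom.L_cell Hom.R_cell

/-- The category of chain complexes in an abelian framed bicategory. -/
instance : Category (FramedComplex D) where
  Hom K K' := Hom K K'
  id K :=
    { f := 𝟙 _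
      g := 𝟙 _
      cell _ := 𝟙 _
      L_cell := by simp
      R_cell := by simp
      comm := by simp }
  comp φ ψ :=
    { f := φ.f ≫ ψ.f
      g := φ.g ≫ ψ.g
      cell n := φ.cell n ≫ ψ.cell n
      L_cell := by simp
      R_cell := by simp
      comm n := by rw [← Category.assoc, φ.comm, Category.assoc, ψ.comm, Category.assoc] }
  id_comp φ := by
    apply Hom.ext
    · exact Category.id_comp _
    · exact Category.id_comp _
    · exact funext fun _ => Category.id_comp _
  comp_id φ := by
    apply Hom.ext
    · exact Category.comp_id _
    · exact Category.comp_id _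
    · exact funext fun _ => Category.comp_id _
  assoc φ ψ χ := by
    apply Hom.ext
    · exact Category.assoc _ _ _
    · exact Category.assoc _ _ _
    · exact funext fun _ => Category.assoc _ _ _

/-- The left frame of chain complexes. -/
@[simps] def leftFrame : FramedComplex D ⥤ D where
  obj K := K.left
  map φ := Hom.f φ

/-- The right frame of chain complexes. -/
@[simps] def rightFrame : FramedComplex D ⥤ D where
  obj K := K.right
  map φ := Hom.g φ

/-- The globular factorization of the components of a morphism of chain complexes. -/
def Hom.lift {K K' : FramedComplex D} (φ : Hom K K') (n : ℕ) :
    K.cplx.X n ⟶ (resFunctor φ.f φ.g).obj (K'.cplx.X n) :=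
  resFactor (φ.cell n) (φ.L_cell n) (φ.R_cell n)

@[simp] lemma Hom.lift_cart {K K' : FramedComplex D} (φ : Hom K K') (n : ℕ) :
    glob (φ.lift n) ≫ resCart φ.f φ.g (K'.cplx.X n) = φ.cell n :=
  resFactor_cart _ _ _

lemma Hom.lift_comm {K K' : FramedComplex D} (φ : Hom K K') (i j : ℕ) :
    K.cplx.d i j ≫ φ.lift j = φ.lift i ≫ (resFunctor φ.f φ.g).map (K'.cplx.d i j) := by
  by_cases h : j + 1 = i
  · subst h
    apply resFunctor_hom_ext
    rw [glob_comp, glob_comp, Category.assoc, Category.assoc, map_resCart, lift_cart,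
      ← Category.assoc, lift_cart, φ.comm]
  · rw [K.cplx.shape i j h, K'.cplx.shape i j h, Functor.map_zero, comp_zero, zero_comp]

/-- The map induced on cycles by a morphism of chain complexes. -/
def Hom.cyclesLift {K K' : FramedComplex D} (φ : Hom K K') (n : ℕ) :
    K.cplx.cycles n ⟶ (resFunctor φ.f φ.g).obj (K'.cplx.cycles n) :=
  (KernelFork.mapIsLimit _ (K'.cplx.cyclesIsKernel n _ rfl) (resFunctor φ.f φ.g)).lift
    (KernelFork.ofι (K.cplx.iCycles n ≫ φ.lift n) (by
      rw [Category.assoc, ← φ.lift_comm, HomologicalComplex.iCycles_d_assoc, zero_comp]))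

lemma Hom.cyclesLift_i {K K' : FramedComplex D} (φ : Hom K K') (n : ℕ) :
    φ.cyclesLift n ≫ (resFunctor φ.f φ.g).map (K'.cplx.iCycles n) =
      K.cplx.iCycles n ≫ φ.lift n :=
  (KernelFork.mapIsLimit _ (K'.cplx.cyclesIsKernel n _ rfl) (resFunctor φ.f φ.g)).fac _
    WalkingParallelPair.zero

lemma Hom.toCycles_cyclesLift {K K' : FramedComplex D} (φ : Hom K K') (n : ℕ) :
    K.cplx.toCycles (n + 1) n ≫ φ.cyclesLift n =
      φ.lift (n + 1) ≫ (resFunctor φ.f φ.g).map (K'.cplx.toCycles (n + 1) n) := by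
  rw [← cancel_mono ((resFunctor φ.f φ.g).map (K'.cplx.iCycles n)), Category.assoc,
    Category.assoc, φ.cyclesLift_i, ← Functor.map_comp, HomologicalComplex.toCycles_i,
    HomologicalComplex.toCycles_i_assoc, φ.lift_comm]

/-- The globular map induced on homology by a morphism of chain complexes. -/
def Hom.homologyLift {K K' : FramedComplex D} (φ : Hom K K') (n : ℕ) :
    K.cplx.homology n ⟶ (resFunctor φ.f φ.g).obj (K'.cplx.homology n) :=
  (K.cplx.homologyIsCokernel (n + 1) n (by simp)).desc (CokernelCofork.ofπ
    (φ.cyclesLift n ≫ (resFunctor φ.f φ.g).map (K'.cplx.homologyπ n)) (by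
      rw [← Category.assoc, φ.toCycles_cyclesLift, Category.assoc, ← Functor.map_comp,
        HomologicalComplex.toCycles_comp_homologyπ, Functor.map_zero, comp_zero]))

lemma Hom.π_homologyLift {K K' : FramedComplex D} (φ : Hom K K') (n : ℕ) :
    K.cplx.homologyπ n ≫ φ.homologyLift n =
      φ.cyclesLift n ≫ (resFunctor φ.f φ.g).map (K'.cplx.homologyπ n) :=
  (K.cplx.homologyIsCokernel (n + 1) n (by simp)).fac _ WalkingParallelPair.one

/-- The 2-cell `H_n K ⟶ H_n K'` induced on homology by a morphism of chain complexes: the unique one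
over the same vertical arrows that is compatible with the induced 2-cell on cycles. -/
def Hom.homologyCell {K K' : FramedComplex D} (φ : Hom K K') (n : ℕ) :
    OneCell.mk (K.cplx.homology n) ⟶ OneCell.mk (K'.cplx.homology n) :=
  glob (φ.homologyLift n) ≫ resCart φ.f φ.g (K'.cplx.homology n)

end FramedComplex

end Chains

noncomputable section ChainsTensor

variable {D : Type u} [Category.{v} D] [MonoidalCategory D] [DoubleCategory.{w, v₁} D]
  [FramedBicategory D] [AbelianFramedBicategory D] [MonoidalDoubleCategory D]

instance additive_tensFunctor [MonoidalAbelianFramedBicategory D] (A B C E : D) : (tensFunctor A B C E).Additive where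
  map_add {M M' α β} := by
    ext N : 2
    exact (MonoidalAbelianFramedBicategory.additive_right (A := A) (B := B) N).map_add

namespace FramedComplex

/-- The tensor product of 2-cells of two morphisms of complexes, factored through a restriction. -/
def Hom.tensorLift {K K' N N' : FramedComplex D} (φ : Hom K K') (ψ : Hom N N') (i j : ℕ) :
    ((tensFunctor K.left K.right N.left N.right).obj (K.cplx.X i)).obj (N.cplx.X j) ⟶
      (resFunctor (φ.f ⊗ₘ ψ.f) (φ.g ⊗ₘ ψ.g)).obj
        (((tensFunctor K'.left K'.right N'.left N'.right).obj (K'.cplx.X i)).obj (N'.cplx.X j)) :=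
  resFactor (tensCell (φ.cell i) (ψ.cell j))
    (by rw [L_tensCell, φ.L_cell, ψ.L_cell]) (by rw [R_tensCell, φ.R_cell, ψ.R_cell])

lemma Hom.d_tensorLift {K K' N N' : FramedComplex D} (φ : Hom K K') (ψ : Hom N N') (i j : ℕ) :
    ((tensFunctor _ _ _ _).map (K.cplx.d (i + 1) i)).app (N.cplx.X j) ≫ φ.tensorLift ψ i j =
      φ.tensorLift ψ (i + 1) j ≫ (resFunctor (φ.f ⊗ₘ ψ.f) (φ.g ⊗ₘ ψ.g)).map
        (((tensFunctor _ _ _ _).map (K'.cplx.d (i + 1) i)).app (N'.cplx.X j)) := by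
  apply resFunctor_hom_ext
  rw [glob_comp, glob_comp, Category.assoc, Category.assoc, map_resCart, tensorLift,
    resFactor_cart, tensorLift, resFactor_cart_assoc]
  rw [glob_tensFunctor_map_app, glob_tensFunctor_map_app, ← tensCell_comp, ← tensCell_comp, φ.comm,
    Category.id_comp, Category.comp_id]

lemma Hom.tensorLift_d {K K' N N' : FramedComplex D} (φ : Hom K K') (ψ : Hom N N') (i j : ℕ) :
    ((tensFunctor _ _ _ _).obj (K.cplx.X i)).map (N.cplx.d (j + 1) j) ≫ φ.tensorLift ψ i j =
      φ.tensorLift ψ i (j + 1) ≫ (resFunctor (φ.f ⊗ₘ ψ.f) (φ.g ⊗ₘ ψ.g)).map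
        (((tensFunctor _ _ _ _).obj (K'.cplx.X i)).map (N'.cplx.d (j + 1) j)) := by
  apply resFunctor_hom_ext
  rw [glob_comp, glob_comp, Category.assoc, Category.assoc, map_resCart, tensorLift,
    resFactor_cart, tensorLift, resFactor_cart_assoc]
  rw [glob_tensFunctor_obj_map, glob_tensFunctor_obj_map, ← tensCell_comp, ← tensCell_comp, ψ.comm,
    Category.id_comp, Category.comp_id]

variable [MonoidalAbelianFramedBicategory D]

/-- The degree `n` part of `φ ⊗ ψ`, factored through a restriction: on the summand `(i, j)` it is
`φ_i ⊗ ψ_j`. -/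
def Hom.tensorLiftTotal {K K' N N' : FramedComplex D} (φ : Hom K K') (ψ : Hom N N') (n : ℕ) :
    (tensorComplex (tensFunctor K.left K.right N.left N.right) K.cplx N.cplx).X n ⟶
      (resFunctor (φ.f ⊗ₘ ψ.f) (φ.g ⊗ₘ ψ.g)).obj
        ((tensorComplex (tensFunctor K'.left K'.right N'.left N'.right) K'.cplx N'.cplx).X n) :=
  HomologicalComplex.mapBifunctorDesc fun i j h => φ.tensorLift ψ i j ≫
    (resFunctor (φ.f ⊗ₘ ψ.f) (φ.g ⊗ₘ ψ.g)).map
      (ιTensor (tensFunctor K'.left K'.right N'.left N'.right) K'.cplx N'.cplx i j n h)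

lemma Hom.d_tensorLiftTotal {K K' N N' : FramedComplex D} (φ : Hom K K') (ψ : Hom N N') (n : ℕ) :
    (tensorComplex (tensFunctor K.left K.right N.left N.right) K.cplx N.cplx).d (n + 1) n ≫
        φ.tensorLiftTotal ψ n =
      φ.tensorLiftTotal ψ (n + 1) ≫ (resFunctor (φ.f ⊗ₘ ψ.f) (φ.g ⊗ₘ ψ.g)).map
        ((tensorComplex (tensFunctor K'.left K'.right N'.left N'.right)
          K'.cplx N'.cplx).d (n + 1) n) := by
  apply HomologicalComplex.mapBifunctor.hom_ext
  intro i j h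
  have h : i + j = n + 1 := h
  simp only [tensorLiftTotal, HomologicalComplex.ι_mapBifunctorDesc_assoc, Category.assoc,
    ← Functor.map_comp]
  rw [HomologicalComplex.mapBifunctor.d_eq, HomologicalComplex.mapBifunctor.d_eq]
  simp only [Preadditive.comp_add, Preadditive.add_comp, Functor.map_add,
    HomologicalComplex.mapBifunctor.ι_D₁, HomologicalComplex.mapBifunctor.ι_D₂,
    HomologicalComplex.mapBifunctor.ι_D₁_assoc, HomologicalComplex.mapBifunctor.ι_D₂_assoc]
  congr 1
  · obtain _ | i := i
    · rw [HomologicalComplex.mapBifunctor.d₁_eq_zero _ _ _ _ _ _ _ (by simp),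
        HomologicalComplex.mapBifunctor.d₁_eq_zero _ _ _ _ _ _ _ (by simp)]
      simp
    · have h' : i + j = n := by omega
      rw [HomologicalComplex.mapBifunctor.d₁_eq _ _ _ _ (i₁ := i + 1) (i₁' := i) (by simp) j n h',
        HomologicalComplex.mapBifunctor.d₁_eq _ _ _ _ (i₁ := i + 1) (i₁' := i) (by simp) j n h',
        Functor.map_units_smul, Linear.units_smul_comp, Linear.comp_units_smul, Category.assoc,
        HomologicalComplex.ι_mapBifunctorDesc, Functor.map_comp, ← Category.assoc,
        φ.d_tensorLift ψ, Category.assoc]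
  · obtain _ | j := j
    · rw [HomologicalComplex.mapBifunctor.d₂_eq_zero _ _ _ _ _ _ _ (by simp),
        HomologicalComplex.mapBifunctor.d₂_eq_zero _ _ _ _ _ _ _ (by simp)]
      simp
    · have h' : i + j = n := by omega
      rw [HomologicalComplex.mapBifunctor.d₂_eq _ _ _ _ i (i₂ := j + 1) (i₂' := j) (by simp) n h',
        HomologicalComplex.mapBifunctor.d₂_eq _ _ _ _ i (i₂ := j + 1) (i₂' := j) (by simp) n h',
        Functor.map_units_smul, Linear.units_smul_comp, Linear.comp_units_smul, Category.assoc,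
        HomologicalComplex.ι_mapBifunctorDesc, Functor.map_comp, ← Category.assoc,
        φ.tensorLift_d ψ, Category.assoc]

/-- The tensor product of chain complexes. -/
abbrev tensor (K N : FramedComplex D) : FramedComplex D where
  left := K.left ⊗ N.left
  right := K.right ⊗ N.right
  cplx := tensorComplex (tensFunctor K.left K.right N.left N.right) K.cplx N.cplx

/-- The tensor product `φ ⊗ ψ` of morphisms of chain complexes, given by `φ_i ⊗ ψ_j` on summands. -/
def Hom.tensor {K K' N N' : FramedComplex D} (φ : Hom K K') (ψ : Hom N N') :
    Hom (K.tensor N) (K'.tensor N') where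
  f := φ.f ⊗ₘ ψ.f
  g := φ.g ⊗ₘ ψ.g
  cell n := glob (φ.tensorLiftTotal ψ n) ≫ resCart _ _ _
  L_cell n := (L_comp _ _).trans <|
    (congrArg₂ (· ≫ ·) (L_glob _) (L_resCart _ _ _)).trans (Category.id_comp _)
  R_cell n := (R_comp _ _).trans <|
    (congrArg₂ (· ≫ ·) (R_glob _) (R_resCart _ _ _)).trans (Category.id_comp _)
  comm n := by
    refine (Category.assoc _ _ _).symm.trans ?_
    refine Eq.trans ?_ (Category.assoc _ _ _).symm
    refine Eq.trans ?_ (congrArg (glob (φ.tensorLiftTotal ψ (n + 1)) ≫ ·) (map_resCart _ _ _))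
    refine Eq.trans ?_ (Category.assoc _ _ _)
    exact congrArg (fun γ => glob γ ≫ resCart _ _ _) (φ.d_tensorLiftTotal ψ n)

end FramedComplex

end ChainsTensor

section Comparison

variable {D : Type u} [Category.{v} D] [MonoidalCategory D] [DoubleCategory.{w, v₁} D]
  [FramedBicategory D] [AbelianFramedBicategory D] {C : Type*} [Category* C] [MonoidalCategory C]

open FramedComplex

/-- Natural transformations `L(X ⊗ Y) ⟶ L(X) ⊗ L(Y)`, where `L(X)` is the left frame of the complex
`M(X)`. -/
abbrev LeftComparison (M : C ⥤ FramedComplex D) :=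
  MonoidalCategory.tensor C ⋙ (M ⋙ leftFrame) ⟶
    (M ⋙ leftFrame).prod (M ⋙ leftFrame) ⋙ MonoidalCategory.tensor D

/-- Natural transformations `R(X ⊗ Y) ⟶ R(X) ⊗ R(Y)`, where `R(X)` is the right frame of the complex
`M(X)`. -/
abbrev RightComparison (M : C ⥤ FramedComplex D) :=
  MonoidalCategory.tensor C ⋙ (M ⋙ rightFrame) ⟶
    (M ⋙ rightFrame).prod (M ⋙ rightFrame) ⋙ MonoidalCategory.tensor D

/-- The component of a left comparison. -/
abbrev LeftComparison.at {M : C ⥤ FramedComplex D} (l : LeftComparison M) (X Y : C) :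
    (M.obj (X ⊗ Y)).left ⟶ (M.obj X).left ⊗ (M.obj Y).left :=
  l.app (X, Y)

/-- The component of a right comparison. -/
abbrev RightComparison.at {M : C ⥤ FramedComplex D} (r : RightComparison M) (X Y : C) :
    (M.obj (X ⊗ Y)).right ⟶ (M.obj X).right ⊗ (M.obj Y).right :=
  r.app (X, Y)

/-- A weak Eilenberg–Zilber isomorphism: isomorphisms `H_n(X ⊗ Y) ≅ l^* H_n(M(X) ⊗ M(Y)) r^*`,
natural in `X` and `Y`.  (A 2-cell into a restriction is determined by its composite with the
cartesian 2-cell, and naturality is expressed after this composition.) -/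
structure WeakEilenbergZilber [MonoidalDoubleCategory D] [MonoidalAbelianFramedBicategory D]
    (M : C ⥤ FramedComplex D) (l : LeftComparison M) (r : RightComparison M) where
  iso (n : ℕ) (X Y : C) :
    (M.obj (X ⊗ Y)).cplx.homology n ≅
      (resFunctor (l.at X Y) (r.at X Y)).obj (((M.obj X).tensor (M.obj Y)).cplx.homology n)
  naturality (n : ℕ) {X X' Y Y' : C} (a : X ⟶ X') (b : Y ⟶ Y') :
    Hom.homologyCell (M.map (a ⊗ₘ b)) n ≫ glob (iso n X' Y').hom ≫
        resCart (l.at X' Y') (r.at X' Y') (((M.obj X').tensor (M.obj Y')).cplx.homology n) =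
      glob (iso n X Y).hom ≫
        resCart (l.at X Y) (r.at X Y) (((M.obj X).tensor (M.obj Y)).cplx.homology n) ≫
          Hom.homologyCell (Hom.tensor (M.map a) (M.map b)) n

end Comparison

/-!
The restriction functor `f^* (-) g^*` is a right adjoint, hence left exact.  It is also a natural
retract of `M ↦ f̂ ⊙ (M ⊙ ǧ)`, where `f̂` and `ǧ` are the restrictions of the unit 1-cells along `f`
and `g`; in a closed framed bicategory this functor is a left adjoint, so restriction preserves
epimorphisms as well and is exact (`shortExact_map_resFunctor`).  By the weak Eilenberg–Zilber
isomorphism the theorem thus reduces to the algebraic Künneth theorem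
`AlgebraicKunnethConditions.exists_shortExact` for a right exact bifunctor `t` on abelian categories
and complexes `K` and `L`.

For the algebraic theorem let `Z` be the graded object of cycles of `K` and `Q` the one of boundaries,
moved up by one degree, both regarded as complexes with zero differential.  The degreewise short exact
sequence `0 ⟶ Z ⟶ K ⟶ Q ⟶ 0` stays exact after applying `t(-, L)`, because `Tor₁(B(K), L) = 0`
(`shortExact_tensorMap`).  By the hypotheses on `α₁` and `α₂` its long exact homology sequence
consists of the sums of the `t(B_i K, H_j L)` and of the `t(Z_i K, H_j L)` and of `H t(K, L)`, and the
connecting homomorphism is induced by the inclusion of `B(K)` into `Z(K)`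
(`gradedComponent_δ`).  Its cokernel is the sum of the `t(H_i K, H_j L)` since `t` is right exact, and
its kernel is the sum of the `Tor₁(H_i K, H_j L)` since `Tor₁(Z(K), H(L)) = 0`.

The last step, and the first use of `Tor₁`, need the exact sequence
`Tor₁(X, Y) ⟶ Tor₁(X'', Y) ⟶ t(X', Y) ⟶ t(X, Y)` of a short exact sequence `X' ⟶ X ⟶ X''`
(`exact_tor`), where `Tor₁` is the first homology of the tensor product of *both* resolutions.  If the
resolutions of `X` and `X''` start with the same projective object `P₀`, then `t(X', Y)` is the
cokernel of the map induced on opcycles in degree `1`, and the sequence is a part of a kernel-cokernel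
sequence (`exact_homology_tensorComplex`).
-/

set_option linter.unusedSectionVars false

/-! ### Restriction functors of a closed abelian framed bicategory are exact -/

noncomputable section RestrictionExact

variable {D : Type u} [Category.{v} D] [DoubleCategory.{w, v₁} D]

lemma L_inv_eq_id {A B : D} {M N : Hor A B} (e : OneCell.mk M ≅ OneCell.mk N)
    (h : L e.hom = 𝟙 A) : L e.inv = 𝟙 A := by
  have := congrArg L e.hom_inv_id
  rwa [L_comp, h, L_id, Category.id_comp] at this

lemma R_inv_eq_id {A B : D} {M N : Hor A B} (e : OneCell.mk M ≅ OneCell.mk N)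
    (h : R e.hom = 𝟙 B) : R e.inv = 𝟙 B := by
  have := congrArg R e.hom_inv_id
  rwa [R_comp, h, R_id, Category.id_comp] at this

lemma hmap_id_lunit {A B : D} {M N : Hor A B} (α : OneCell.mk M ⟶ OneCell.mk N)
    (h : L α = 𝟙 A) :
    hmap (𝟙 (OneCell.mk (U A))) α (by simp [h]) ≫ (lunit N).hom = (lunit M).hom ≫ α := by
  rw [← lunit_naturality]
  congr 2
  rw [h, Umap_id]

lemma hmap_id_runit {A B : D} {M N : Hor A B} (α : OneCell.mk M ⟶ OneCell.mk N)
    (h : R α = 𝟙 B) :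
    hmap α (𝟙 (OneCell.mk (U B))) (by simp [h]) ≫ (runit N).hom = (runit M).hom ≫ α := by
  rw [← runit_naturality]
  congr 2
  rw [h, Umap_id]

variable [FramedBicategory D]

/-- The 1-cell `f̂ ⊙ (M ⊙ ǧ)`, where `f̂ = f^* U_B` and `ǧ = U_B' g^*` are the base change 1-cells of
the two vertical arrows. -/
abbrev baseChange {A B A' B' : D} (f : A ⟶ B) (g : A' ⟶ B') (M : Hor B B') : Hor A A' :=
  hcomp (res f (𝟙 B) (U B)) (hcomp M (res (𝟙 B') g (U B')))

/-- The functoriality of `f̂ ⊙ (M ⊙ ǧ)` in `M`. -/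
def baseChangeMap {A B A' B' : D} (f : A ⟶ B) (g : A' ⟶ B') {M N : Hor B B'} (α : M ⟶ N) :
    baseChange f g M ⟶ baseChange f g N :=
  ((hcompFunctor A B A').obj (res f (𝟙 B) (U B))).map
    (((hcompFunctor B B' A').flip.obj (res (𝟙 B') g (U B'))).map α)

lemma glob_baseChangeMap {A B A' B' : D} (f : A ⟶ B) (g : A' ⟶ B') {M N : Hor B B'}
    (α : M ⟶ N) :
    glob (baseChangeMap f g α) = hmap (𝟙 _) (hmap (glob α) (𝟙 _) (by simp)) (by simp) :=
  rfl

/-- The 2-cell `f̂ ⊙ (M ⊙ ǧ) ⟶ M` over `(f, g)` obtained from the cartesian 2-cells of the two base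
change 1-cells. -/
def baseChangeCell {A B A' B' : D} (f : A ⟶ B) (g : A' ⟶ B') (M : Hor B B') :
    OneCell.mk (baseChange f g M) ⟶ OneCell.mk M :=
  hmap (cart f (𝟙 B) (U B)) (hmap (𝟙 _) (cart (𝟙 B') g (U B')) (by simp)) (by simp) ≫
    (lunit (hcomp M (U B'))).hom ≫ (runit M).hom

lemma L_baseChangeCell {A B A' B' : D} (f : A ⟶ B) (g : A' ⟶ B') (M : Hor B B') :
    L (baseChangeCell f g M) = f := by
  rw [baseChangeCell, L_comp, L_comp, L_hmap, L_cart, L_lunit, L_runit, Category.id_comp,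
    Category.comp_id]

lemma R_baseChangeCell {A B A' B' : D} (f : A ⟶ B) (g : A' ⟶ B') (M : Hor B B') :
    R (baseChangeCell f g M) = g := by
  rw [baseChangeCell, R_comp, R_comp, R_hmap, R_hmap, R_cart, R_lunit, R_runit, Category.comp_id,
    Category.comp_id]

lemma baseChangeCell_naturality {A B A' B' : D} (f : A ⟶ B) (g : A' ⟶ B') {M N : Hor B B'}
    (α : M ⟶ N) :
    glob (baseChangeMap f g α) ≫ baseChangeCell f g N = baseChangeCell f g M ≫ glob α := by
  have h := hmap_id_lunit (hmap (glob α) (𝟙 (OneCell.mk (U B'))) (by simp)) (by simp)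
  rw [baseChangeCell, baseChangeCell, Category.assoc, Category.assoc,
    ← hmap_id_runit _ (R_glob α), ← reassoc_of% h, glob_baseChangeMap]
  simp only [← Category.assoc]
  congr 2
  refine (hmap_comp _ _ _ _ _ _).symm.trans (Eq.trans ?_ (hmap_comp _ _ _ _ _ _))
  congr 1
  · rw [Category.id_comp, Category.comp_id]
  · refine (hmap_comp _ _ _ _ _ _).symm.trans (Eq.trans ?_ (hmap_comp _ _ _ _ _ _))
    congr 1
    · rw [Category.id_comp, Category.comp_id]
    · rw [Category.id_comp, Category.comp_id]

lemma exists_companion_unit {A B : D} (f : A ⟶ B) :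
    ∃ η : OneCell.mk (U A) ⟶ OneCell.mk (res f (𝟙 B) (U B)),
      L η = 𝟙 A ∧ R η = f ∧ η ≫ cart f (𝟙 B) (U B) = Umap f :=
  (cartesian f (𝟙 B) (U B) (OneCell.mk (U A)) (Umap f) (𝟙 A) f (by simp) (by simp)).exists

lemma exists_conjoint_unit {A B : D} (g : A ⟶ B) :
    ∃ η : OneCell.mk (U A) ⟶ OneCell.mk (res (𝟙 B) g (U B)),
      L η = g ∧ R η = 𝟙 A ∧ η ≫ cart (𝟙 B) g (U B) = Umap g :=
  (cartesian (𝟙 B) g (U B) (OneCell.mk (U A)) (Umap g) g (𝟙 A) (by simp) (by simp)).exists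

/-- The globular 2-cell `f̂ ⊙ (M ⊙ ǧ) ⟶ f^* M g^*`. -/
def baseChangeToRes {A B A' B' : D} (f : A ⟶ B) (g : A' ⟶ B') (M : Hor B B') :
    baseChange f g M ⟶ (resFunctor f g).obj M :=
  resFactor (baseChangeCell f g M) (L_baseChangeCell f g M) (R_baseChangeCell f g M)

lemma baseChangeToRes_naturality {A B A' B' : D} (f : A ⟶ B) (g : A' ⟶ B') {M N : Hor B B'}
    (α : M ⟶ N) :
    baseChangeMap f g α ≫ baseChangeToRes f g N =
      baseChangeToRes f g M ≫ (resFunctor f g).map α := by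
  apply resFunctor_hom_ext
  rw [glob_comp, glob_comp, Category.assoc, Category.assoc, map_resCart, baseChangeToRes,
    baseChangeToRes, resFactor_cart, resFactor_cart_assoc, baseChangeCell_naturality]

/-- A section of `baseChangeToRes` is built from the units `U_A ⟶ f̂` and `U_A' ⟶ ǧ` over `(1, f)`
and `(g, 1)`, which exist since `f̂` and `ǧ` are restrictions of unit 1-cells. -/
lemma exists_section_baseChangeToRes {A B A' B' : D} (f : A ⟶ B) (g : A' ⟶ B') (M : Hor B B') :
    ∃ s : res f g M ⟶ baseChange f g M,
      glob s ≫ baseChangeCell f g M = cart f g M := by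
  obtain ⟨η, hηL, hηR, hη⟩ := exists_companion_unit f
  obtain ⟨θ, hθL, hθR, hθ⟩ := exists_conjoint_unit g
  let σ : OneCell.mk (hcomp (U A) (hcomp (res f g M) (U A'))) ⟶
      OneCell.mk (baseChange f g M) :=
    hmap η (hmap (cart f g M) θ (by rw [R_cart, hθL])) (by rw [L_hmap, L_cart, hηR])
  have hσ : σ ≫ baseChangeCell f g M =
      (lunit (hcomp (res f g M) (U A'))).hom ≫ (runit (res f g M)).hom ≫ cart f g M := by
    have h₁ := runit_naturality (cart f g M)
    have h₂ := lunit_naturality (hmap (cart f g M) (Umap (R (cart f g M))) (by simp))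
    rw [← h₁, ← reassoc_of% h₂, baseChangeCell, ← Category.assoc, ← hmap_comp]
    congr 2
    · rw [hη, L_hmap, L_cart]
    · rw [← hmap_comp]
      congr 1
      · rw [Category.comp_id]
      · rw [hθ, R_cart]
  refine ⟨mkGlob ((runit (res f g M)).inv ≫ (lunit (hcomp (res f g M) (U A'))).inv ≫ σ)
    ?_ ?_, ?_⟩
  · rw [L_comp, L_comp, L_inv_eq_id _ (L_lunit _), L_inv_eq_id _ (L_runit _), L_hmap, hηL,
      Category.comp_id, Category.comp_id]
  · rw [R_comp, R_comp, R_inv_eq_id _ (R_lunit _), R_inv_eq_id _ (R_runit _), R_hmap, R_hmap, hθR,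
      Category.comp_id, Category.comp_id]
  · rw [glob_mkGlob, Category.assoc, Category.assoc, hσ, Iso.inv_hom_id_assoc,
      Iso.inv_hom_id_assoc]

lemma epi_baseChangeToRes {A B A' B' : D} (f : A ⟶ B) (g : A' ⟶ B') (M : Hor B B') :
    Epi (baseChangeToRes f g M) := by
  obtain ⟨s, hs⟩ := exists_section_baseChangeToRes f g M
  have : s ≫ baseChangeToRes f g M = 𝟙 (res f g M) := by
    apply res_hom_ext
    rw [glob_id, Category.id_comp]
    refine Eq.trans ?_ hs
    refine (Category.assoc _ _ _).trans ?_
    exact congrArg (glob s ≫ ·) (resFactor_cart _ _ _)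
  have : IsSplitEpi (baseChangeToRes f g M) := ⟨⟨⟨s, this⟩⟩⟩
  infer_instance

/-- In a closed framed bicategory `f̂ ⊙ (- ⊙ ǧ)` is a left adjoint, hence preserves epimorphisms;
and so does its natural retract `f^* (-) g^*`. -/
lemma epi_resFunctor_map [ClosedFramedBicategory D] {A B A' B' : D} (f : A ⟶ B) (g : A' ⟶ B')
    {M N : Hor B B'} (α : M ⟶ N) [Epi α] : Epi ((resFunctor f g).map α) := by
  have := ClosedFramedBicategory.left (C := A') (res f (𝟙 B) (U B))
  have := ClosedFramedBicategory.right (A := B) (res (𝟙 B') g (U B'))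
  have : Epi (baseChangeMap f g α) := by
    have : Epi (((hcompFunctor B B' A').flip.obj (res (𝟙 B') g (U B'))).map α) :=
      inferInstance
    exact inferInstanceAs (Epi (((hcompFunctor A B A').obj (res f (𝟙 B) (U B))).map
      (((hcompFunctor B B' A').flip.obj (res (𝟙 B') g (U B'))).map α)))
  have := epi_baseChangeToRes f g N
  have : Epi (baseChangeToRes f g M ≫ (resFunctor f g).map α) := by
    rw [← baseChangeToRes_naturality]
    infer_instance
  exact epi_of_epi (baseChangeToRes f g M) ((resFunctor f g).map α)

lemma shortExact_map_resFunctor [ClosedFramedBicategory D] [AbelianFramedBicategory D]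
    {A B A' B' : D} (f : A ⟶ B) (g : A' ⟶ B') {S : ShortComplex (Hor B B')} (hS : S.ShortExact) :
    (S.map (resFunctor f g)).ShortExact := by
  have := hS.mono_f
  have := hS.epi_g
  have : Mono (S.map (resFunctor f g)).f := inferInstanceAs (Mono ((resFunctor f g).map S.f))
  have : Epi (S.map (resFunctor f g)).g := epi_resFunctor_map f g S.g
  exact ⟨ShortComplex.exact_of_f_is_kernel _
    (KernelFork.mapIsLimit _ hS.exact.fIsKernel (resFunctor f g))⟩

end RestrictionExact

/-! ### Exact sequences and biproducts -/


section Exactness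

variable {A : Type*} [Category* A] [Abelian A]

lemma exact_of_forall_comp_eq_zero {S : ShortComplex A}
    (h : ∀ {W V : A} (x : W ⟶ S.X₂) (y : S.X₂ ⟶ V), x ≫ S.g = 0 → S.f ≫ y = 0 → x ≫ y = 0) :
    S.Exact :=
  S.exact_iff_kernel_ι_comp_cokernel_π_zero.2 (h _ _ (kernel.condition _) (cokernel.condition _))

lemma exact_epi_comp {W X Y Z : A} (e : W ⟶ X) [Epi e] {f : X ⟶ Y} {g : Y ⟶ Z} {w : f ≫ g = 0}
    (h : (ShortComplex.mk f g w).Exact) :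
    (ShortComplex.mk (e ≫ f) g (by rw [Category.assoc, w, comp_zero])).Exact :=
  exact_of_forall_comp_eq_zero fun x y hx hy => h.comp_eq_zero hx (by
    rwa [← cancel_epi e, comp_zero, ← Category.assoc])

lemma exact_biproduct_map {J : Type} [Finite J] {X Y Z : J → A} (f : ∀ j, X j ⟶ Y j)
    (g : ∀ j, Y j ⟶ Z j) (w : ∀ j, f j ≫ g j = 0)
    (h : ∀ j, (ShortComplex.mk (f j) (g j) (w j)).Exact) :
    (ShortComplex.mk (biproduct.map f) (biproduct.map g)
      (by ext; simp [w])).Exact := by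
  refine exact_of_forall_comp_eq_zero fun {W V} x y hx hy => ?_
  dsimp at x y hx hy
  have := Fintype.ofFinite J
  rw [← Category.id_comp y, ← biproduct.total, Preadditive.sum_comp, Preadditive.comp_sum]
  refine Finset.sum_eq_zero fun j _ => ?_
  have hx' : (x ≫ biproduct.π _ j) ≫ g j = 0 := by
    rw [Category.assoc, ← biproduct.map_π, reassoc_of% hx, zero_comp]
  have hy' : f j ≫ biproduct.ι _ j ≫ y = 0 := by
    rw [← biproduct.ι_map_assoc, hy, comp_zero]
  simpa using (h j).comp_eq_zero hx' hy'

/-- A part of the kernel-cokernel sequence of a composite `a ≫ b`: if `U` and `W` are the cokernels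
of `a` and `a ≫ b`, then `ker b ⟶ U ⟶ W` is exact, with kernel a quotient of `ker (a ≫ b)`. -/
lemma exact_kernel_cokernel_comp {O O' T H U W : A} {a : O ⟶ O'} {b : O' ⟶ T} {c : O' ⟶ U}
    {q : T ⟶ W} {m : U ⟶ W} {k : H ⟶ O'} (comm : c ≫ m = b ≫ q) (hac : a ≫ c = 0)
    (ex₁ : (ShortComplex.mk a c hac).Exact) [Epi c] (hq : (a ≫ b) ≫ q = 0)
    (ex₂ : (ShortComplex.mk (a ≫ b) q hq).Exact) (hk : k ≫ b = 0)
    (ex₃ : (ShortComplex.mk k b hk).Exact) [Mono k] :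
    (ShortComplex.mk (k ≫ c) m (by rw [Category.assoc, comm, reassoc_of% hk, zero_comp])).Exact ∧
      (Mono (a ≫ b) → Mono (k ≫ c)) := by
  constructor
  · rw [ShortComplex.exact_iff_exact_up_to_refinements]
    intro V x hx
    dsimp at x hx ⊢
    obtain ⟨V₁, π₁, _, y, hy⟩ := surjective_up_to_refinements_of_epi c x
    obtain ⟨V₂, π₂, _, z, hz⟩ := ex₂.exact_up_to_refinements (y ≫ b) (by
      dsimp
      rw [Category.assoc, ← comm, ← reassoc_of% hy, hx, comp_zero])
    obtain ⟨V₃, π₃, _, t, ht⟩ := ex₃.exact_up_to_refinements (π₂ ≫ y - z ≫ a) (by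
      dsimp at hz ⊢
      rw [Preadditive.sub_comp, Category.assoc, Category.assoc, hz, sub_self])
    refine ⟨V₃, π₃ ≫ π₂ ≫ π₁, inferInstance, t, ?_⟩
    dsimp at ht
    rw [← reassoc_of% ht, Category.assoc, Category.assoc, hy, Preadditive.sub_comp,
      Category.assoc, Category.assoc, hac, comp_zero, sub_zero]
  · intro _
    rw [Preadditive.mono_iff_cancel_zero]
    intro V x hx
    obtain ⟨V₁, π₁, _, z, hz⟩ := ex₁.exact_up_to_refinements (x ≫ k) (by simpa using hx)
    dsimp at z hz
    have : z = 0 := by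
      rw [← cancel_mono (a ≫ b), ← reassoc_of% hz, hk, comp_zero, comp_zero, zero_comp]
    rw [this, zero_comp] at hz
    rw [← cancel_epi π₁, ← cancel_mono k, Category.assoc, hz, comp_zero, zero_comp]

end Exactness

/-! ### Right exact bifunctors and total complexes -/

section Bifunctor

variable {A₁ A₂ A : Type*} [Category* A₁] [Category* A₂] [Category* A] [Abelian A₁] [Abelian A₂]
  [Abelian A] {t : A₁ ⥤ A₂ ⥤ A} [t.Additive] [∀ X, (t.obj X).Additive]

namespace RightExactBifunctor

variable (ht : RightExactBifunctor t)

include ht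

lemma epi_map_app {X X' : A₁} (f : X ⟶ X') [Epi f] (Y : A₂) : Epi ((t.map f).app Y) :=
  have := ht.left Y
  inferInstanceAs (Epi ((t.flip.obj Y).map f))

lemma epi_obj_map (X : A₁) {Y Y' : A₂} (g : Y ⟶ Y') [Epi g] : Epi ((t.obj X).map g) :=
  have := ht.right X
  inferInstance

lemma exact_map_app {X₁ X₂ X₃ : A₁} {f : X₁ ⟶ X₂} {g : X₂ ⟶ X₃} {w : f ≫ g = 0}
    (h : (ShortComplex.mk f g w).Exact) [Epi g] (Y : A₂) :
    (ShortComplex.mk ((t.map f).app Y) ((t.map g).app Y)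
      (by rw [← NatTrans.comp_app, ← t.map_comp, w, t.map_zero, zero_app])).Exact :=
  have := ht.left Y
  h.map_of_epi_of_preservesCokernel (t.flip.obj Y) inferInstance inferInstance

lemma exact_obj_map (X : A₁) {Y₁ Y₂ Y₃ : A₂} {f : Y₁ ⟶ Y₂} {g : Y₂ ⟶ Y₃} {w : f ≫ g = 0}
    (h : (ShortComplex.mk f g w).Exact) [Epi g] :
    (ShortComplex.mk ((t.obj X).map f) ((t.obj X).map g)
      (by rw [← Functor.map_comp, w, Functor.map_zero])).Exact :=
  have := ht.right X
  h.map_of_epi_of_preservesCokernel (t.obj X) inferInstance inferInstance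

/-- A morphism out of `t(X₂, Y₂)` which vanishes on `t(X₁, Y₂)` and on `t(X₂, Y₁)` factors through
`t(coker (X₁ ⟶ X₂), coker (Y₁ ⟶ Y₂))`. -/
lemma exists_desc {X₁ X₂ X₃ : A₁} {f : X₁ ⟶ X₂} {g : X₂ ⟶ X₃} {w : f ≫ g = 0}
    (h : (ShortComplex.mk f g w).Exact) [Epi g] {Y₁ Y₂ Y₃ : A₂} {f' : Y₁ ⟶ Y₂} {g' : Y₂ ⟶ Y₃}
    {w' : f' ≫ g' = 0} (h' : (ShortComplex.mk f' g' w').Exact) [Epi g'] {W : A}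
    (κ : (t.obj X₂).obj Y₂ ⟶ W) (hκ : (t.map f).app Y₂ ≫ κ = 0)
    (hκ' : (t.obj X₂).map f' ≫ κ = 0) :
    ∃ κ' : (t.obj X₃).obj Y₃ ⟶ W, (t.map g).app Y₂ ≫ (t.obj X₃).map g' ≫ κ' = κ := by
  have := ht.epi_map_app g Y₂
  have := ht.epi_map_app g Y₁
  have := ht.epi_obj_map X₃ g'
  let κ₁ := (ht.exact_map_app h Y₂).desc κ hκ
  have hκ₁ : (t.map g).app Y₂ ≫ κ₁ = κ := (ht.exact_map_app h Y₂).g_desc κ hκ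
  have hκ₁' : (t.obj X₃).map f' ≫ κ₁ = 0 := by
    rw [← cancel_epi ((t.map g).app Y₁), comp_zero, ← NatTrans.naturality_assoc, hκ₁, hκ']
  exact ⟨(ht.exact_obj_map X₃ h').desc κ₁ hκ₁', by
    rw [(ht.exact_obj_map X₃ h').g_desc κ₁ hκ₁', hκ₁]⟩

end RightExactBifunctor

variable (t) (K : ChainComplex A₁ ℕ) (L : ChainComplex A₂ ℕ)

lemma ιTensor_d (i j n m : ℕ) (h : i + j = n) :
    ιTensor t K L i j n h ≫ (tensorComplex t K L).d n m =
      HomologicalComplex.mapBifunctor.d₁ K L t (ComplexShape.down ℕ) i j m +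
        HomologicalComplex.mapBifunctor.d₂ K L t (ComplexShape.down ℕ) i j m := by
  rw [HomologicalComplex.mapBifunctor.d_eq, Preadditive.comp_add,
    HomologicalComplex.mapBifunctor.ι_D₁, HomologicalComplex.mapBifunctor.ι_D₂]

lemma tensorComplex_d₁_succ (i j n : ℕ) (h : i + j = n) :
    HomologicalComplex.mapBifunctor.d₁ K L t (ComplexShape.down ℕ) (i + 1) j n =
      (t.map (K.d (i + 1) i)).app (L.X j) ≫ ιTensor t K L i j n h := by
  rw [HomologicalComplex.mapBifunctor.d₁_eq K L t (ComplexShape.down ℕ) (i₁ := i + 1) (i₁' := i)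
    (by simp) j n h]
  exact one_smul _ _

lemma tensorComplex_d₂_succ (i j n : ℕ) (h : i + j = n) :
    HomologicalComplex.mapBifunctor.d₂ K L t (ComplexShape.down ℕ) i (j + 1) n =
      ComplexShape.ε₂ (ComplexShape.down ℕ) (ComplexShape.down ℕ) (ComplexShape.down ℕ)
        (i, j + 1) • (t.obj (K.X i)).map (L.d (j + 1) j) ≫ ιTensor t K L i j n h :=
  HomologicalComplex.mapBifunctor.d₂_eq K L t (ComplexShape.down ℕ) i (i₂ := j + 1) (i₂' := j)
    (by simp) n h

lemma tensorComplex_d₁_zero (j n : ℕ) :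
    HomologicalComplex.mapBifunctor.d₁ K L t (ComplexShape.down ℕ) 0 j n = 0 :=
  HomologicalComplex.mapBifunctor.d₁_eq_zero _ _ _ _ _ _ _ (by simp)

lemma tensorComplex_d₂_zero (i n : ℕ) :
    HomologicalComplex.mapBifunctor.d₂ K L t (ComplexShape.down ℕ) i 0 n = 0 :=
  HomologicalComplex.mapBifunctor.d₂_eq_zero _ _ _ _ _ _ _ (by simp)

variable {t K L}

lemma tensorComplex_hom_ext {n : ℕ} {W : A} {x y : (tensorComplex t K L).X n ⟶ W}
    (h : ∀ (i j : ℕ) (h : i + j = n), ιTensor t K L i j n h ≫ x = ιTensor t K L i j n h ≫ y) :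
    x = y :=
  HomologicalComplex.mapBifunctor.hom_ext h

variable (t L)

/-- The chain map `t(K, L) ⟶ t(K', L)` induced by a chain map `K ⟶ K'`. -/
noncomputable abbrev tensorMap {K K' : ChainComplex A₁ ℕ} (φ : K ⟶ K') :
    tensorComplex t K L ⟶ tensorComplex t K' L :=
  HomologicalComplex.mapBifunctorMap φ (𝟙 L) t (ComplexShape.down ℕ)

lemma ιTensor_tensorMap {K K' : ChainComplex A₁ ℕ} (φ : K ⟶ K') (i j n : ℕ) (h : i + j = n) :
    ιTensor t K L i j n h ≫ (tensorMap t L φ).f n =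
      (t.map (φ.f i)).app (L.X j) ≫ ιTensor t K' L i j n h := by
  rw [HomologicalComplex.ι_mapBifunctorMap, HomologicalComplex.id_f, CategoryTheory.Functor.map_id,
    Category.id_comp]

end Bifunctor

/-! ### Projective resolutions -/

noncomputable section Resolutions

variable {A : Type*} [Category* A] [Abelian A]

/-- The augmentation `P₀ ⟶ X` of a projective resolution. -/
def resAug {X : A} (P : ProjectiveResolution X) : P.complex.X 0 ⟶ X := P.π.f 0

instance {X : A} (P : ProjectiveResolution X) : Epi (resAug P) :=
  inferInstanceAs (Epi (P.π.f 0))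

lemma d_resAug {X : A} (P : ProjectiveResolution X) : P.complex.d 1 0 ≫ resAug P = 0 :=
  P.complex_d_comp_π_f_zero

lemma exact_resAug {X : A} (P : ProjectiveResolution X) :
    (ShortComplex.mk _ _ (d_resAug P)).Exact := P.exact₀

lemma lift_resAug {X Y : A} (f : X ⟶ Y) (P : ProjectiveResolution X)
    (Q : ProjectiveResolution Y) :
    (ProjectiveResolution.lift f P Q).f 0 ≫ resAug Q = resAug P ≫ f :=
  ProjectiveResolution.lift_commutes_zero f P Q

/-- The complex `⋯ ⟶ R₁ ⟶ R₀ ⟶ P₀` obtained from an epimorphism `p : P₀ ⟶ X` and a resolution `R` of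
its kernel. -/
abbrev spliceComplex {P₀ X : A} (p : P₀ ⟶ X) (R : ProjectiveResolution (kernel p)) :
    ChainComplex A ℕ :=
  R.complex.augment (resAug R ≫ kernel.ι p) (by rw [← Category.assoc, d_resAug, zero_comp])

lemma spliceComplex_d_comp {P₀ X : A} (p : P₀ ⟶ X) (R : ProjectiveResolution (kernel p)) :
    (spliceComplex p R).d 1 0 ≫ p = 0 := by
  have : (resAug R ≫ kernel.ι p) ≫ p = 0 := by
    rw [Category.assoc, kernel.condition, comp_zero]
  exact this

lemma exact_splice_zero {P₀ X : A} (p : P₀ ⟶ X) (R : ProjectiveResolution (kernel p)) :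
    (ShortComplex.mk _ _ (spliceComplex_d_comp p R)).Exact := by
  let α : ShortComplex.mk _ _ (spliceComplex_d_comp p R) ⟶
      ShortComplex.mk (kernel.ι p) p (kernel.condition p) :=
    { τ₁ := resAug R
      τ₂ := 𝟙 _
      τ₃ := 𝟙 _
      comm₁₂ := (Category.comp_id _).symm }
  have : Epi α.τ₁ := inferInstanceAs (Epi (resAug R))
  have : IsIso α.τ₂ := inferInstanceAs (IsIso (𝟙 _))
  have : Mono α.τ₃ := inferInstanceAs (Mono (𝟙 _))
  rw [ShortComplex.exact_iff_of_epi_of_isIso_of_mono α]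
  exact ShortComplex.exact_of_f_is_kernel _ (kernelIsKernel p)

lemma exact_splice_one {P₀ X : A} (p : P₀ ⟶ X) (R : ProjectiveResolution (kernel p)) :
    (ShortComplex.mk (R.complex.d 1 0) (resAug R ≫ kernel.ι p)
      (by rw [← Category.assoc, d_resAug, zero_comp])).Exact := by
  let α : ShortComplex.mk _ _ (d_resAug R) ⟶
      ShortComplex.mk (R.complex.d 1 0) (resAug R ≫ kernel.ι p)
        (by rw [← Category.assoc, d_resAug, zero_comp]) :=
    { τ₁ := 𝟙 _
      τ₂ := 𝟙 _
      τ₃ := kernel.ι p }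
  have : Epi α.τ₁ := inferInstanceAs (Epi (𝟙 _))
  have : IsIso α.τ₂ := inferInstanceAs (IsIso (𝟙 _))
  have : Mono α.τ₃ := inferInstanceAs (Mono (kernel.ι p))
  rw [← ShortComplex.exact_iff_of_epi_of_isIso_of_mono α]
  exact exact_resAug R

/-- The projective resolution of `X` which starts with a given epimorphism `p : P₀ ⟶ X` and
continues with a given resolution of its kernel. -/
def splice {P₀ X : A} [Projective P₀] (p : P₀ ⟶ X) [Epi p] (R : ProjectiveResolution (kernel p)) :
    ProjectiveResolution X where
  complex := spliceComplex p R
  projective n := by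
    cases n with
    | zero => assumption
    | succ n => exact R.projective n
  π := (ChainComplex.toSingle₀Equiv _ _).symm ⟨p, spliceComplex_d_comp p R⟩
  quasiIso := ⟨fun n => by
    cases n with
    | zero =>
      rw [ChainComplex.quasiIsoAt₀_iff, ShortComplex.quasiIso_iff_of_zeros']
      · dsimp
        refine (ShortComplex.exact_and_epi_g_iff_of_iso ?_).2
          ⟨exact_splice_zero p R, by dsimp; infer_instance⟩
        exact ShortComplex.isoMk (Iso.refl _) (Iso.refl _) (Iso.refl _)
          ((Category.id_comp _).trans (Category.comp_id _).symm)
          ((Category.id_comp p).trans ((ChainComplex.toSingle₀Equiv_symm_apply_f_zero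
            (C := spliceComplex p R) p (spliceComplex_d_comp p R)).symm.trans
              (Category.comp_id _).symm))
      all_goals rfl
    | succ n =>
      rw [quasiIsoAt_iff_exactAt' _ _ (ChainComplex.exactAt_succ_single_obj _ _),
        HomologicalComplex.exactAt_iff' _ (n + 2) (n + 1) n (by simp) (by simp)]
      cases n with
      | zero => exact exact_splice_one p R
      | succ n => exact R.exact_succ n⟩

end Resolutions

/-! ### The exact sequence of `Tor₁` -/

noncomputable section Tor

variable {A₁ A₂ A : Type*} [Category* A₁] [Category* A₂] [Category* A] [Abelian A₁] [Abelian A₂]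
  [Abelian A] {t : A₁ ⥤ A₂ ⥤ A} [t.Additive] [∀ X, (t.obj X).Additive]

variable (t) in
/-- The morphism `t(P, Q)₀ = t(P₀, Q₀) ⟶ W` given by a morphism out of `t(P₀, Q₀)`. -/
def tensorDesc₀ (P : ChainComplex A₁ ℕ) (Q : ChainComplex A₂ ℕ) {W : A}
    (κ : (t.obj (P.X 0)).obj (Q.X 0) ⟶ W) : (tensorComplex t P Q).X 0 ⟶ W :=
  HomologicalComplex.mapBifunctorDesc fun i j _ =>
    match i, j with
    | 0, 0 => κ
    | _, _ => 0

lemma ι_tensorDesc₀ (P : ChainComplex A₁ ℕ) (Q : ChainComplex A₂ ℕ) {W : A}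
    (κ : (t.obj (P.X 0)).obj (Q.X 0) ⟶ W) :
    ιTensor t P Q 0 0 0 rfl ≫ tensorDesc₀ t P Q κ = κ :=
  HomologicalComplex.ι_mapBifunctorDesc _ _ _ _

variable (t) in
/-- The morphism `t(P, Q)₁ ⟶ W` which is given on the summand `t(P₁, Q₀)` and is zero on the summand
`t(P₀, Q₁)`. -/
def tensorDesc₁ (P : ChainComplex A₁ ℕ) (Q : ChainComplex A₂ ℕ) {W : A}
    (κ : (t.obj (P.X 1)).obj (Q.X 0) ⟶ W) : (tensorComplex t P Q).X 1 ⟶ W :=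
  HomologicalComplex.mapBifunctorDesc fun i j _ =>
    match i, j with
    | 1, 0 => κ
    | _, _ => 0

lemma ι_tensorDesc₁ (P : ChainComplex A₁ ℕ) (Q : ChainComplex A₂ ℕ) {W : A}
    (κ : (t.obj (P.X 1)).obj (Q.X 0) ⟶ W) :
    ιTensor t P Q 1 0 1 rfl ≫ tensorDesc₁ t P Q κ = κ :=
  HomologicalComplex.ι_mapBifunctorDesc _ _ _ _

lemma ι_tensorDesc₁' (P : ChainComplex A₁ ℕ) (Q : ChainComplex A₂ ℕ) {W : A}
    (κ : (t.obj (P.X 1)).obj (Q.X 0) ⟶ W) :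
    ιTensor t P Q 0 1 1 rfl ≫ tensorDesc₁ t P Q κ = 0 :=
  HomologicalComplex.ι_mapBifunctorDesc _ _ _ _

section

variable (P : ChainComplex A₁ ℕ) (Q : ChainComplex A₂ ℕ)

lemma tensor_hom_ext₀ {W : A} {x y : (tensorComplex t P Q).X 0 ⟶ W}
    (h : ιTensor t P Q 0 0 0 rfl ≫ x = ιTensor t P Q 0 0 0 rfl ≫ y) : x = y := by
  refine tensorComplex_hom_ext fun i j hij => ?_
  obtain rfl : i = 0 := by omega
  obtain rfl : j = 0 := by omega
  exact h

lemma tensor_hom_ext₁ {W : A} {x y : (tensorComplex t P Q).X 1 ⟶ W}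
    (h : ιTensor t P Q 1 0 1 rfl ≫ x = ιTensor t P Q 1 0 1 rfl ≫ y)
    (h' : ιTensor t P Q 0 1 1 rfl ≫ x = ιTensor t P Q 0 1 1 rfl ≫ y) : x = y := by
  refine tensorComplex_hom_ext fun i j hij => ?_
  match i, j, hij with
  | 1, 0, _ => exact h
  | 0, 1, _ => exact h'
  | i + 2, j, hij => omega
  | 1, j + 1, hij => omega
  | 0, j + 2, hij => omega

lemma tensor_hom_ext₂ {W : A} {x y : (tensorComplex t P Q).X 2 ⟶ W}
    (h : ιTensor t P Q 2 0 2 rfl ≫ x = ιTensor t P Q 2 0 2 rfl ≫ y)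
    (h' : ιTensor t P Q 1 1 2 rfl ≫ x = ιTensor t P Q 1 1 2 rfl ≫ y)
    (h'' : ιTensor t P Q 0 2 2 rfl ≫ x = ιTensor t P Q 0 2 2 rfl ≫ y) : x = y := by
  refine tensorComplex_hom_ext fun i j hij => ?_
  match i, j, hij with
  | 2, 0, _ => exact h
  | 1, 1, _ => exact h'
  | 0, 2, _ => exact h''
  | i + 3, j, hij => omega
  | 2, j + 1, hij => omega
  | 1, j + 2, hij => omega
  | 1, 0, hij => omega
  | 0, j + 3, hij => omega
  | 0, 0, hij => omega
  | 0, 1, hij => omega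

lemma ιTensor_d₁₀ : ιTensor t P Q 1 0 1 rfl ≫ (tensorComplex t P Q).d 1 0 =
    (t.map (P.d 1 0)).app (Q.X 0) ≫ ιTensor t P Q 0 0 0 rfl := by
  rw [ιTensor_d, tensorComplex_d₁_succ t P Q 0 0 0 rfl, tensorComplex_d₂_zero, add_zero]

lemma ιTensor_d₀₁ : ιTensor t P Q 0 1 1 rfl ≫ (tensorComplex t P Q).d 1 0 =
    ComplexShape.ε₂ (ComplexShape.down ℕ) (ComplexShape.down ℕ) (ComplexShape.down ℕ) (0, 1) •
      (t.obj (P.X 0)).map (Q.d 1 0) ≫ ιTensor t P Q 0 0 0 rfl := by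
  rw [ιTensor_d, tensorComplex_d₂_succ t P Q 0 0 0 rfl, tensorComplex_d₁_zero, zero_add]

lemma ιTensor_d₂₀ : ιTensor t P Q 2 0 2 rfl ≫ (tensorComplex t P Q).d 2 1 =
    (t.map (P.d 2 1)).app (Q.X 0) ≫ ιTensor t P Q 1 0 1 rfl := by
  rw [ιTensor_d, tensorComplex_d₁_succ t P Q 1 0 1 rfl, tensorComplex_d₂_zero, add_zero]

lemma ιTensor_d₁₁ : ιTensor t P Q 1 1 2 rfl ≫ (tensorComplex t P Q).d 2 1 =
    (t.map (P.d 1 0)).app (Q.X 1) ≫ ιTensor t P Q 0 1 1 rfl +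
      ComplexShape.ε₂ (ComplexShape.down ℕ) (ComplexShape.down ℕ) (ComplexShape.down ℕ) (1, 1) •
        (t.obj (P.X 1)).map (Q.d 1 0) ≫ ιTensor t P Q 1 0 1 rfl := by
  rw [ιTensor_d, tensorComplex_d₁_succ t P Q 0 1 1 rfl, tensorComplex_d₂_succ t P Q 1 0 1 rfl]

lemma ιTensor_d₀₂ : ιTensor t P Q 0 2 2 rfl ≫ (tensorComplex t P Q).d 2 1 =
    ComplexShape.ε₂ (ComplexShape.down ℕ) (ComplexShape.down ℕ) (ComplexShape.down ℕ) (0, 2) •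
      (t.obj (P.X 0)).map (Q.d 2 1) ≫ ιTensor t P Q 0 1 1 rfl := by
  rw [ιTensor_d, tensorComplex_d₂_succ t P Q 0 1 1 rfl, tensorComplex_d₁_zero, zero_add]

end

/-- For two complexes `P ⟶ P''` which agree in degree `0` and are the beginnings of resolutions of
the terms of `X ⟶ X''`, and a resolution `Q` of `Y`: the exact sequence
`H₁ t(P, Q) ⟶ H₁ t(P'', Q) ⟶ t(X', Y) ⟶ t(X, Y)`, where `X'` is the kernel of `X ⟶ X''`,
presented as a quotient of the first syzygy `Ω''` of `X''`. -/
lemma exact_homology_tensorComplex (ht : RightExactBifunctor t) {P P'' : ChainComplex A₁ ℕ}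
    (φ : P ⟶ P'') [IsIso (φ.f 0)] (Q : ChainComplex A₂ ℕ) {X' X Ω'' : A₁} {Y : A₂}
    (y : Q.X 0 ⟶ Y) [Epi y] (hy : Q.d 1 0 ≫ y = 0) (exy : (ShortComplex.mk _ _ hy).Exact)
    (r : P''.X 0 ⟶ X) [Epi r] (hr : (P.d 1 0 ≫ φ.f 0) ≫ r = 0)
    (exr : (ShortComplex.mk _ _ hr).Exact)
    (u : P''.X 1 ⟶ Ω'') [Epi u] (hu : P''.d 2 1 ≫ u = 0) (exu : (ShortComplex.mk _ _ hu).Exact)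
    (k : Ω'' ⟶ X') [Epi k] (hk : (φ.f 1 ≫ u) ≫ k = 0) (exk : (ShortComplex.mk _ _ hk).Exact)
    (i : X' ⟶ X) (hi : u ≫ k ≫ i = P''.d 1 0 ≫ r) :
    ∃ (δ : (tensorComplex t P'' Q).homology 1 ⟶ (t.obj X').obj Y)
      (w : δ ≫ (t.map i).app Y = 0), (ShortComplex.mk _ _ w).Exact ∧
      (IsZero ((tensorComplex t P Q).homology 1) → Mono δ) := by
  -- the morphism `t(P''₁, Q₀) ⟶ t(X', Y)`
  let κ : (t.obj (P''.X 1)).obj (Q.X 0) ⟶ (t.obj X').obj Y :=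
    (t.map (u ≫ k)).app _ ≫ (t.obj X').map y
  let c₁ := tensorDesc₁ t P'' Q κ
  have hκ₁ : ∀ {Z : A₁} (z : Z ⟶ P''.X 1), z ≫ u ≫ k = 0 → (t.map z).app _ ≫ κ = 0 := by
    intro Z z hz
    dsimp only [κ]
    rw [← NatTrans.comp_app_assoc, ← t.map_comp, hz, t.map_zero, zero_app, zero_comp]
  have hκ₂ : (t.obj (P''.X 1)).map (Q.d 1 0) ≫ κ = 0 := by
    dsimp only [κ]
    rw [NatTrans.naturality_assoc, ← Functor.map_comp, hy, Functor.map_zero, comp_zero]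
  have hc₁ : (tensorComplex t P'' Q).d 2 1 ≫ c₁ = 0 := by
    apply tensor_hom_ext₂
    · rw [← Category.assoc, ιTensor_d₂₀, Category.assoc, ι_tensorDesc₁, comp_zero,
        hκ₁ _ (by rw [reassoc_of% hu, zero_comp])]
    · rw [← Category.assoc, ιTensor_d₁₁, Preadditive.add_comp, Category.assoc, ι_tensorDesc₁',
        Linear.units_smul_comp, Category.assoc, ι_tensorDesc₁, hκ₂, comp_zero, comp_zero,
        smul_zero, add_zero]
    · rw [← Category.assoc, ιTensor_d₀₂, Linear.units_smul_comp, Category.assoc,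
        ι_tensorDesc₁', comp_zero, comp_zero, smul_zero]
  let c : (tensorComplex t P'' Q).opcycles 1 ⟶ (t.obj X').obj Y :=
    (tensorComplex t P'' Q).descOpcycles c₁ 2 (by simp) hc₁
  have hc : (tensorComplex t P'' Q).pOpcycles 1 ≫ c = c₁ :=
    HomologicalComplex.p_descOpcycles _ _ _ _ _
  have : Epi κ := by
    have := ht.epi_map_app (u ≫ k) (Q.X 0)
    have := ht.epi_obj_map X' y
    exact epi_comp _ _
  have : Epi c := by
    have : Epi (ιTensor t P'' Q 1 0 1 rfl ≫ (tensorComplex t P'' Q).pOpcycles 1 ≫ c) := by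
      rw [hc, ι_tensorDesc₁]
      infer_instance
    have := epi_of_epi (ιTensor t P'' Q 1 0 1 rfl) ((tensorComplex t P'' Q).pOpcycles 1 ≫ c)
    exact epi_of_epi ((tensorComplex t P'' Q).pOpcycles 1) c
  -- the morphism `t(P''₀, Q₀) ⟶ t(X, Y)`
  let q : (tensorComplex t P'' Q).X 0 ⟶ (t.obj X).obj Y :=
    tensorDesc₀ t P'' Q ((t.map r).app _ ≫ (t.obj X).map y)
  have hq' : ιTensor t P'' Q 0 0 0 rfl ≫ q = (t.map r).app _ ≫ (t.obj X).map y :=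
    ι_tensorDesc₀ _ _ _
  let a := HomologicalComplex.opcyclesMap (tensorMap t Q φ) 1
  let b := (tensorComplex t P'' Q).fromOpcycles 1 0
  have comm : c ≫ (t.map i).app Y = b ≫ q := by
    rw [← cancel_epi ((tensorComplex t P'' Q).pOpcycles 1), reassoc_of% hc,
      HomologicalComplex.p_fromOpcycles_assoc]
    apply tensor_hom_ext₁
    · rw [← Category.assoc, ι_tensorDesc₁, ← Category.assoc, ιTensor_d₁₀, Category.assoc, Category.assoc,
        hq', NatTrans.naturality, ← NatTrans.comp_app_assoc, ← t.map_comp,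
        ← NatTrans.comp_app_assoc, ← t.map_comp, Category.assoc, hi]
    · rw [← Category.assoc, ι_tensorDesc₁', ← Category.assoc, ιTensor_d₀₁,
        Linear.units_smul_comp, Category.assoc, hq', NatTrans.naturality_assoc,
        ← Functor.map_comp, hy, Functor.map_zero, comp_zero, smul_zero, zero_comp]
  have hpa : (tensorComplex t P Q).pOpcycles 1 ≫ a =
      (tensorMap t Q φ).f 1 ≫ (tensorComplex t P'' Q).pOpcycles 1 :=
    HomologicalComplex.p_opcyclesMap _ _
  have hac : a ≫ c = 0 := by
    rw [← cancel_epi ((tensorComplex t P Q).pOpcycles 1), reassoc_of% hpa, hc, comp_zero]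
    apply tensor_hom_ext₁
    · rw [← Category.assoc, ιTensor_tensorMap, Category.assoc, ι_tensorDesc₁, comp_zero,
        hκ₁ _ (by rw [← Category.assoc, hk])]
    · rw [← Category.assoc, ιTensor_tensorMap, Category.assoc, ι_tensorDesc₁', comp_zero,
        comp_zero]
  have isIso₀ (j : ℕ) : Epi ((t.map (φ.f 0)).app (Q.X j)) := ht.epi_map_app _ _
  -- `t(X', Y)` is the cokernel of `a`
  have ex₁ : (ShortComplex.mk a c hac).Exact := by
    apply ShortComplex.exact_of_g_is_cokernel
    refine CokernelCofork.IsColimit.ofπ' _ _ (fun {W} l hl => ?_)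
    dsimp at l hl
    apply Classical.indefiniteDescription
    let l₁ := (tensorComplex t P'' Q).pOpcycles 1 ≫ l
    have hl₁ : (tensorMap t Q φ).f 1 ≫ l₁ = 0 := by
      dsimp only [l₁]
      rw [← reassoc_of% hpa, hl, comp_zero]
    have hl₂ : (tensorComplex t P'' Q).d 2 1 ≫ l₁ = 0 := by
      dsimp only [l₁]
      rw [HomologicalComplex.d_pOpcycles_assoc, zero_comp]
    have h₀₁ : ιTensor t P'' Q 0 1 1 rfl ≫ l₁ = 0 := by
      rw [← cancel_epi ((t.map (φ.f 0)).app (Q.X 1)), ← Category.assoc, ← ιTensor_tensorMap,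
        Category.assoc, hl₁, comp_zero, comp_zero]
    have h₂₀ : (t.map (P''.d 2 1)).app (Q.X 0) ≫ ιTensor t P'' Q 1 0 1 rfl ≫ l₁ = 0 := by
      rw [← Category.assoc, ← ιTensor_d₂₀, Category.assoc, hl₂, comp_zero]
    have h₁₁ : (t.obj (P''.X 1)).map (Q.d 1 0) ≫ ιTensor t P'' Q 1 0 1 rfl ≫ l₁ = 0 := by
      have := ιTensor t P'' Q 1 1 2 rfl ≫= hl₂
      rw [← Category.assoc, ιTensor_d₁₁, Preadditive.add_comp, Category.assoc, h₀₁, comp_zero,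
        comp_zero, zero_add, Linear.units_smul_comp, Category.assoc] at this
      exact (smul_eq_zero_iff_eq _).1 this
    obtain ⟨l₃, hl₃⟩ := ht.exists_desc exu exy (ιTensor t P'' Q 1 0 1 rfl ≫ l₁) h₂₀ h₁₁
    have := ht.epi_obj_map (P.X 1) y
    have hl₄ : (t.map (φ.f 1 ≫ u)).app Y ≫ l₃ = 0 := by
      rw [← cancel_epi ((t.obj (P.X 1)).map y), NatTrans.naturality_assoc, t.map_comp,
        NatTrans.comp_app_assoc, hl₃, ← Category.assoc, ← ιTensor_tensorMap, Category.assoc, hl₁,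
        comp_zero, comp_zero]
    have := ht.epi_map_app k Y
    refine ⟨(ht.exact_map_app exk Y).desc l₃ hl₄, ?_⟩
    dsimp
    have hl₅ : (t.map k).app Y ≫ (ht.exact_map_app exk Y).desc l₃ hl₄ = l₃ :=
      (ht.exact_map_app exk Y).g_desc l₃ hl₄
    rw [← cancel_epi ((tensorComplex t P'' Q).pOpcycles 1), reassoc_of% hc]
    apply tensor_hom_ext₁
    · rw [← Category.assoc, ι_tensorDesc₁, ← hl₃, Category.assoc, t.map_comp,
        NatTrans.comp_app_assoc, ← NatTrans.naturality_assoc, hl₅]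
    · rw [← Category.assoc, ι_tensorDesc₁', zero_comp, h₀₁]
  have hpab : (tensorComplex t P Q).pOpcycles 1 ≫ a ≫ b =
      (tensorComplex t P Q).d 1 0 ≫ (tensorMap t Q φ).f 0 := by
    rw [reassoc_of% hpa, HomologicalComplex.p_fromOpcycles, HomologicalComplex.Hom.comm]
  have hq : (a ≫ b) ≫ q = 0 := by
    rw [Category.assoc, ← comm, reassoc_of% hac, zero_comp]
  -- `t(X, Y)` is the cokernel of `a ≫ b`
  have ex₂ : (ShortComplex.mk (a ≫ b) q hq).Exact := by
    have : Epi q := by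
      have : Epi (ιTensor t P'' Q 0 0 0 rfl ≫ q) := by
        rw [hq']
        have := ht.epi_map_app r (Q.X 0)
        have := ht.epi_obj_map X y
        exact epi_comp _ _
      exact epi_of_epi (ιTensor t P'' Q 0 0 0 rfl) q
    apply ShortComplex.exact_of_g_is_cokernel
    refine CokernelCofork.IsColimit.ofπ' _ _ (fun {W} l hl => ?_)
    dsimp at l hl
    apply Classical.indefiniteDescription
    have hl₁ : (tensorComplex t P Q).d 1 0 ≫ (tensorMap t Q φ).f 0 ≫ l = 0 := by
      rw [← reassoc_of% hpab, ← Category.assoc a, hl, comp_zero]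
    have h₁₀ : (t.map (P.d 1 0 ≫ φ.f 0)).app (Q.X 0) ≫ ιTensor t P'' Q 0 0 0 rfl ≫ l = 0 := by
      have := ιTensor t P Q 1 0 1 rfl ≫= hl₁
      rw [← Category.assoc, ιTensor_d₁₀, Category.assoc, ← Category.assoc (ιTensor t P Q 0 0 0 _),
        ιTensor_tensorMap, comp_zero] at this
      rw [t.map_comp, NatTrans.comp_app_assoc, ← this, Category.assoc]
    have h₀₁ : (t.obj (P''.X 0)).map (Q.d 1 0) ≫ ιTensor t P'' Q 0 0 0 rfl ≫ l = 0 := by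
      have := ιTensor t P Q 0 1 1 rfl ≫= hl₁
      rw [← Category.assoc, ιTensor_d₀₁, Linear.units_smul_comp, comp_zero] at this
      have := (smul_eq_zero_iff_eq _).1 this
      rw [Category.assoc, ← Category.assoc (ιTensor t P Q 0 0 0 _),
        ιTensor_tensorMap] at this
      rw [← cancel_epi ((t.map (φ.f 0)).app (Q.X 1)), ← NatTrans.naturality_assoc, comp_zero,
        ← this, Category.assoc]
    obtain ⟨l₃, hl₃⟩ := ht.exists_desc exr exy _ h₁₀ h₀₁
    refine ⟨l₃, tensor_hom_ext₀ _ _ ?_⟩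
    dsimp
    rw [← Category.assoc, hq', Category.assoc, hl₃]
  have hb : (tensorComplex t P'' Q).homologyι 1 ≫ b = 0 :=
    HomologicalComplex.homologyι_comp_fromOpcycles _ _ _
  have ex₃ : (ShortComplex.mk _ _ hb).Exact :=
    ShortComplex.exact_of_f_is_kernel _
      ((tensorComplex t P'' Q).homologyIsKernel 1 0 (by simp))
  obtain ⟨h₁, h₂⟩ := exact_kernel_cokernel_comp comm hac ex₁ hq ex₂ hb ex₃
  refine ⟨_, _, h₁, fun hzero => h₂ ?_⟩
  have hab : a ≫ b = (tensorComplex t P Q).fromOpcycles 1 0 ≫ (tensorMap t Q φ).f 0 := by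
    rw [← cancel_epi ((tensorComplex t P Q).pOpcycles 1), hpab,
      HomologicalComplex.p_fromOpcycles_assoc]
  have : Mono ((tensorComplex t P Q).fromOpcycles 1 0) := by
    have ex : (ShortComplex.mk _ _
        ((tensorComplex t P Q).homologyι_comp_fromOpcycles 1 0)).Exact :=
      ShortComplex.exact_of_f_is_kernel _
        ((tensorComplex t P Q).homologyIsKernel 1 0 (by simp))
    exact ex.mono_g (hzero.eq_of_src _ _)
  have : Mono ((tensorMap t Q φ).f 0) := by
    let s : (tensorComplex t P'' Q).X 0 ⟶ (tensorComplex t P Q).X 0 :=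
      tensorDesc₀ t P'' Q ((t.map (inv (φ.f 0))).app _ ≫ ιTensor t P Q 0 0 0 rfl)
    have hs : (tensorMap t Q φ).f 0 ≫ s = 𝟙 _ := by
      apply tensor_hom_ext₀
      rw [← Category.assoc, ιTensor_tensorMap, Category.assoc, ι_tensorDesc₀,
        ← NatTrans.comp_app_assoc, ← t.map_comp, IsIso.hom_inv_id, t.map_id, NatTrans.id_app,
        Category.id_comp, Category.comp_id]
    exact mono_of_mono_fac hs
  rw [hab]
  exact mono_comp _ _

variable (t) (L : ChainComplex A₂ ℕ)

lemma tensorMap_id (K : ChainComplex A₁ ℕ) : tensorMap t L (𝟙 K) = 𝟙 _ := by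
  ext n : 1
  refine tensorComplex_hom_ext fun i j h => ?_
  rw [ιTensor_tensorMap, HomologicalComplex.id_f, t.map_id, NatTrans.id_app, Category.id_comp,
    HomologicalComplex.id_f, Category.comp_id]

lemma tensorMap_comp {K K' K'' : ChainComplex A₁ ℕ} (φ : K ⟶ K') (ψ : K' ⟶ K'') :
    tensorMap t L (φ ≫ ψ) = tensorMap t L φ ≫ tensorMap t L ψ := by
  ext n : 1
  refine tensorComplex_hom_ext fun i j h => ?_
  rw [ιTensor_tensorMap, HomologicalComplex.comp_f, t.map_comp, NatTrans.comp_app,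
    HomologicalComplex.comp_f, ← Category.assoc (ιTensor t K L i j n h), ιTensor_tensorMap,
    Category.assoc, Category.assoc, ιTensor_tensorMap]

/-- A homotopy equivalence `K ≃ K'` induces a homotopy equivalence `t(K, L) ≃ t(K', L)`. -/
def tensorHomotopyEquiv {K K' : ChainComplex A₁ ℕ} (e : HomotopyEquiv K K') :
    HomotopyEquiv (tensorComplex t K L) (tensorComplex t K' L) where
  hom := tensorMap t L e.hom
  inv := tensorMap t L e.inv
  homotopyHomInvId := (Homotopy.ofEq (tensorMap_comp t L _ _).symm).trans <|
    (HomologicalComplex.mapBifunctorMapHomotopy₁ e.homotopyHomInvId (𝟙 L) t _).trans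
      (Homotopy.ofEq (tensorMap_id t L K))
  homotopyInvHomId := (Homotopy.ofEq (tensorMap_comp t L _ _).symm).trans <|
    (HomologicalComplex.mapBifunctorMapHomotopy₁ e.homotopyInvHomId (𝟙 L) t _).trans
      (Homotopy.ofEq (tensorMap_id t L K'))

/-- `Tor₁(X, Y)` may be computed with any projective resolution of `X`. -/
def torIso [EnoughProjectives A₁] [EnoughProjectives A₂] {X : A₁} (P : ProjectiveResolution X)
    (Y : A₂) :
    tor₁ t X Y ≅ (tensorComplex t P.complex (projectiveResolution Y).complex).homology 1 :=
  (tensorHomotopyEquiv t _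
    (ProjectiveResolution.homotopyEquiv (projectiveResolution X) P)).toHomologyIso 1

variable {t}

/-- The exact sequence `Tor₁(X, Y) ⟶ Tor₁(X'', Y) ⟶ t(X', Y) ⟶ t(X, Y)` of a short exact sequence
`0 ⟶ X' ⟶ X ⟶ X'' ⟶ 0`.  The resolutions of `X` and `X''` are chosen to start with the same
projective object, which maps onto `X`. -/
lemma exact_tor [EnoughProjectives A₁] [EnoughProjectives A₂] (ht : RightExactBifunctor t)
    {S : ShortComplex A₁} (hS : S.ShortExact) (Y : A₂) :
    ∃ (δ : tor₁ t S.X₃ Y ⟶ (t.obj S.X₁).obj Y) (w : δ ≫ (t.map S.f).app Y = 0),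
      (ShortComplex.mk _ _ w).Exact ∧ (IsZero (tor₁ t S.X₂ Y) → Mono δ) := by
  have := hS.mono_f
  have := hS.epi_g
  let p : Projective.over S.X₂ ⟶ S.X₂ := Projective.π S.X₂
  let R := projectiveResolution (kernel p)
  let R'' := projectiveResolution (kernel (p ≫ S.g))
  let Q := projectiveResolution Y
  have : Epi p := inferInstanceAs (Epi (Projective.π S.X₂))
  let j : kernel p ⟶ kernel (p ≫ S.g) :=
    kernel.lift _ (kernel.ι p) (by rw [kernel.condition_assoc, zero_comp])
  have hj : j ≫ kernel.ι (p ≫ S.g) = kernel.ι p := kernel.lift_ι _ _ _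
  let l := ProjectiveResolution.lift j R R''
  have hl : l.f 0 ≫ resAug R'' = resAug R ≫ j := lift_resAug j R R''
  let φ : spliceComplex p R ⟶ spliceComplex (p ≫ S.g) R'' :=
    { f := fun n => match n with
        | 0 => 𝟙 _
        | n + 1 => l.f n
      comm' := by
        rintro m n hmn
        obtain rfl : n + 1 = m := hmn
        match n with
        | 0 =>
          have : l.f 0 ≫ resAug R'' ≫ kernel.ι (p ≫ S.g) = (resAug R ≫ kernel.ι p) ≫ 𝟙 _ := by
            rw [reassoc_of% hl, hj, Category.comp_id]
          exact this
        | n + 1 => exact l.comm (n + 1) n }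
  have : IsIso (φ.f 0) := inferInstanceAs (IsIso (𝟙 _))
  let k : kernel (p ≫ S.g) ⟶ S.X₁ := hS.exact.lift (kernel.ι (p ≫ S.g) ≫ p) (by
    rw [Category.assoc, kernel.condition])
  have hk : k ≫ S.f = kernel.ι (p ≫ S.g) ≫ p := hS.exact.lift_f _ _
  have : Epi k := by
    rw [epi_iff_surjective_up_to_refinements]
    intro V x
    obtain ⟨V', π, _, z, hz⟩ := surjective_up_to_refinements_of_epi p (x ≫ S.f)
    refine ⟨V', π, inferInstance, kernel.lift _ z ?_, ?_⟩
    · rw [← reassoc_of% hz, S.zero, comp_zero, comp_zero]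
    · rw [← cancel_mono S.f, Category.assoc, Category.assoc, hk, kernel.lift_ι_assoc, hz]
  have hφk : (l.f 0 ≫ resAug R'') ≫ k = 0 := by
    rw [hl, ← cancel_mono S.f, Category.assoc, Category.assoc, hk, reassoc_of% hj,
      kernel.condition, comp_zero, zero_comp]
  have exk : (ShortComplex.mk (l.f 0 ≫ resAug R'') k hφk).Exact := by
    rw [ShortComplex.exact_iff_exact_up_to_refinements]
    intro V x hx
    dsimp at x hx ⊢
    obtain ⟨V', π, _, z, hz⟩ := surjective_up_to_refinements_of_epi (resAug R)
      (kernel.lift p (x ≫ kernel.ι (p ≫ S.g)) (by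
        rw [Category.assoc, ← hk, reassoc_of% hx, zero_comp]))
    refine ⟨V', π, inferInstance, z, ?_⟩
    have := hz =≫ kernel.ι p
    rw [Category.assoc, kernel.lift_ι, Category.assoc] at this
    rw [← cancel_mono (kernel.ι (p ≫ S.g)), Category.assoc, this, Category.assoc, hl,
      Category.assoc, hj]
  have hr : ((resAug R ≫ kernel.ι p) ≫ 𝟙 _) ≫ p = 0 := by
    rw [Category.comp_id, Category.assoc, kernel.condition, comp_zero]
  have exr : (ShortComplex.mk ((resAug R ≫ kernel.ι p) ≫ 𝟙 _) p hr).Exact := by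
    have h : (ShortComplex.mk (resAug R ≫ kernel.ι p) p (spliceComplex_d_comp p R)).Exact :=
      exact_splice_zero p R
    simpa only [Category.comp_id] using h
  let r : (spliceComplex (p ≫ S.g) R'').X 0 ⟶ S.X₂ := p
  let u : (spliceComplex (p ≫ S.g) R'').X 1 ⟶ kernel (p ≫ S.g) := resAug R''
  have : Epi r := inferInstanceAs (Epi p)
  have : Epi u := inferInstanceAs (Epi (resAug R''))
  obtain ⟨δ, w, ex, hδ⟩ := exact_homology_tensorComplex ht φ Q.complex (X' := S.X₁) (X := S.X₂)
    (resAug Q) (d_resAug Q) (exact_resAug Q) r hr exr u (d_resAug R'')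
    (exact_resAug R'') k hφk exk S.f
    (by
      have : resAug R'' ≫ k ≫ S.f = (resAug R'' ≫ kernel.ι (p ≫ S.g)) ≫ p := by
        rw [hk, Category.assoc]
      exact this)
  let e : tor₁ t S.X₂ Y ≅ (tensorComplex t (spliceComplex p R) Q.complex).homology 1 :=
    torIso t (splice p R) Y
  let e'' : tor₁ t S.X₃ Y ≅
      (tensorComplex t (spliceComplex (p ≫ S.g) R'') Q.complex).homology 1 :=
    torIso t (splice (p ≫ S.g) R'') Y
  refine ⟨e''.hom ≫ δ, by rw [Category.assoc, w, comp_zero], exact_epi_comp e''.hom ex,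
    fun h => ?_⟩
  have := hδ (h.of_iso e.symm)
  exact mono_comp _ _

end Tor

/-! ### Shifted complexes -/

noncomputable section Shift

variable {A : Type*} [Category* A] [Abelian A] {C E : ChainComplex A ℕ}

lemma next_d_eq_zero (f : ∀ n, C.X (n + 1) ≅ E.X n)
    (hf : ∀ n, (f (n + 1)).hom ≫ E.d (n + 1) n = -(C.d (n + 2) (n + 1) ≫ (f n).hom)) (n : ℕ)
    {W : A} (z : W ⟶ C.X (n + 1)) (hz : z ≫ C.d (n + 1) n = 0) :
    (z ≫ (f n).hom) ≫ E.d n ((ComplexShape.down ℕ).next n) = 0 := by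
  cases n with
  | zero => rw [E.shape _ _ (by simp), comp_zero]
  | succ n =>
    rw [ChainComplex.next_nat_succ, Category.assoc, hf, Preadditive.comp_neg,
      reassoc_of% hz, zero_comp, neg_zero]

lemma inv_d_eq_zero (f : ∀ n, C.X (n + 1) ≅ E.X n)
    (hf : ∀ n, (f (n + 1)).hom ≫ E.d (n + 1) n = -(C.d (n + 2) (n + 1) ≫ (f n).hom))
    (h₀ : IsZero (C.X 0)) (n : ℕ) {W : A} (z : W ⟶ E.X n)
    (hz : z ≫ E.d n ((ComplexShape.down ℕ).next n) = 0) :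
    (z ≫ (f n).inv) ≫ C.d (n + 1) n = 0 := by
  cases n with
  | zero => exact h₀.eq_of_tgt _ _
  | succ n =>
    rw [ChainComplex.next_nat_succ] at hz
    rw [← cancel_mono (f n).hom, Category.assoc, ← neg_inj, ← Preadditive.comp_neg, ← hf]
    simp [hz]

/-- If the complex `C` vanishes in degree `0` and is, up to a sign of the differential, the shift of
`E`, then `H_{n+1} C ≅ H_n E`. -/
lemma exists_homology_iso_of_shift (f : ∀ n, C.X (n + 1) ≅ E.X n)
    (hf : ∀ n, (f (n + 1)).hom ≫ E.d (n + 1) n = -(C.d (n + 2) (n + 1) ≫ (f n).hom))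
    (h₀ : IsZero (C.X 0)) (n : ℕ) :
    ∃ e : C.homology (n + 1) ≅ E.homology n,
      ∀ {W : A} (z : W ⟶ C.cycles (n + 1)) (z' : W ⟶ E.cycles n),
        z ≫ C.iCycles (n + 1) ≫ (f n).hom = z' ≫ E.iCycles n →
          z ≫ C.homologyπ (n + 1) ≫ e.hom = z' ≫ E.homologyπ n := by
  let c : C.cycles (n + 1) ⟶ E.cycles n :=
    E.liftCycles (C.iCycles (n + 1) ≫ (f n).hom) _ rfl
      (next_d_eq_zero f hf n _ (C.iCycles_d _ _))
  let c' : E.cycles n ⟶ C.cycles (n + 1) :=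
    C.liftCycles (E.iCycles n ≫ (f n).inv) n (by simp)
      (inv_d_eq_zero f hf h₀ n _ (E.iCycles_d _ _))
  have hc : c ≫ E.iCycles n = C.iCycles (n + 1) ≫ (f n).hom :=
    HomologicalComplex.liftCycles_i _ _ _ _ _
  have hc' : c' ≫ C.iCycles (n + 1) = E.iCycles n ≫ (f n).inv :=
    HomologicalComplex.liftCycles_i _ _ _ _ _
  have hcc' : c ≫ c' = 𝟙 _ := by
    rw [← cancel_mono (C.iCycles (n + 1)), Category.assoc, hc', reassoc_of% hc, Iso.hom_inv_id,
      Category.comp_id, Category.id_comp]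
  have hc'c : c' ≫ c = 𝟙 _ := by
    rw [← cancel_mono (E.iCycles n), Category.assoc, hc, reassoc_of% hc', Iso.inv_hom_id,
      Category.comp_id, Category.id_comp]
  have ht : C.toCycles (n + 2) (n + 1) ≫ c = -((f (n + 1)).hom ≫ E.toCycles (n + 1) n) := by
    rw [← cancel_mono (E.iCycles n), Category.assoc, hc, Preadditive.neg_comp, Category.assoc,
      HomologicalComplex.toCycles_i, HomologicalComplex.toCycles_i_assoc, hf, neg_neg]
  have ht' : E.toCycles (n + 1) n ≫ c' = -((f (n + 1)).inv ≫ C.toCycles (n + 2) (n + 1)) := by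
    rw [← cancel_epi (f (n + 1)).hom, Preadditive.comp_neg, Iso.hom_inv_id_assoc,
      ← Category.assoc, ← neg_inj, neg_neg, ← Preadditive.neg_comp, ← ht, Category.assoc, hcc',
      Category.comp_id]
  let u : C.homology (n + 1) ⟶ E.homology n :=
    (C.homologyIsCokernel (n + 2) (n + 1) (by simp)).desc (CokernelCofork.ofπ (c ≫ E.homologyπ n) (by
      rw [← Category.assoc, ht, Preadditive.neg_comp, Category.assoc,
        HomologicalComplex.toCycles_comp_homologyπ, comp_zero, neg_zero]))
  let u' : E.homology n ⟶ C.homology (n + 1) :=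
    (E.homologyIsCokernel (n + 1) n (by simp)).desc (CokernelCofork.ofπ (c' ≫ C.homologyπ (n + 1)) (by
      rw [← Category.assoc, ht', Preadditive.neg_comp, Category.assoc,
        HomologicalComplex.toCycles_comp_homologyπ, comp_zero, neg_zero]))
  have hu : C.homologyπ (n + 1) ≫ u = c ≫ E.homologyπ n :=
    (C.homologyIsCokernel (n + 2) (n + 1) (by simp)).fac _ WalkingParallelPair.one
  have hu' : E.homologyπ n ≫ u' = c' ≫ C.homologyπ (n + 1) :=
    (E.homologyIsCokernel (n + 1) n (by simp)).fac _ WalkingParallelPair.one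
  refine ⟨⟨u, u', ?_, ?_⟩, fun {W} z z' h => ?_⟩
  · rw [← cancel_epi (C.homologyπ (n + 1)), reassoc_of% hu, hu', reassoc_of% hcc',
      Category.comp_id]
  · rw [← cancel_epi (E.homologyπ n), reassoc_of% hu', hu, reassoc_of% hc'c, Category.comp_id]
  · have : z ≫ c = z' := by
      rw [← cancel_mono (E.iCycles n), Category.assoc, hc, h]
    dsimp
    rw [hu, reassoc_of% this]

end Shift

/-! ### The Künneth homomorphism of a complex with zero differential -/

noncomputable section ZeroDiff

variable {A₁ A₂ A : Type*} [Category* A₁] [Category* A₂] [Category* A] [Abelian A₁] [Abelian A₂]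
  [Abelian A] {t : A₁ ⥤ A₂ ⥤ A} [t.Additive] [∀ X, (t.obj X).Additive]
  {K : ChainComplex A₁ ℕ} (hK : ∀ i j, K.d i j = 0)

/-- In a complex with zero differential everything is a cycle. -/
def toCyclesOfZero (i : ℕ) : K.X i ⟶ K.cycles i :=
  K.liftCycles (𝟙 _) _ rfl (by rw [hK, comp_zero])

lemma toCyclesOfZero_i (i : ℕ) : toCyclesOfZero hK i ≫ K.iCycles i = 𝟙 _ :=
  HomologicalComplex.liftCycles_i _ _ _ _ _

lemma i_toCyclesOfZero (i : ℕ) : K.iCycles i ≫ toCyclesOfZero hK i = 𝟙 _ := by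
  rw [← cancel_mono (K.iCycles i), Category.assoc, toCyclesOfZero_i, Category.id_comp,
    Category.comp_id]

/-- A complex with zero differential is its own homology. -/
def toHomologyOfZero (i : ℕ) : K.X i ⟶ K.homology i := toCyclesOfZero hK i ≫ K.homologyπ i

lemma isIso_toHomologyOfZero (i : ℕ) : IsIso (toHomologyOfZero hK i) := by
  have : IsIso (toCyclesOfZero hK i) := ⟨_, toCyclesOfZero_i hK i, i_toCyclesOfZero hK i⟩
  have : IsIso (K.homologyπ i) := ShortComplex.isIso_homologyπ _ (hK _ _)
  exact IsIso.comp_isIso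

variable (t) (L : ChainComplex A₂ ℕ)

/-- The product `t(K_i, Z_j L) ⟶ Z_n t(K, L)`, for a complex `K` with zero differential. -/
def gradedCycles (i j n : ℕ) (h : i + j = n) :
    (t.obj (K.X i)).obj (L.cycles j) ⟶ (tensorComplex t K L).cycles n :=
  (t.map (toCyclesOfZero hK i)).app _ ≫ cyclesProduct t K L i j n h

lemma gradedCycles_i (i j n : ℕ) (h : i + j = n) :
    gradedCycles t hK L i j n h ≫ (tensorComplex t K L).iCycles n =
      (t.obj (K.X i)).map (L.iCycles j) ≫ ιTensor t K L i j n h := by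
  rw [gradedCycles, Category.assoc, cyclesProduct_i, ← NatTrans.naturality_assoc,
    ← NatTrans.comp_app_assoc, ← t.map_comp, toCyclesOfZero_i, t.map_id, NatTrans.id_app,
    Category.id_comp]

variable {t} (ht : RightExactBifunctor t)

/-- The map `t(K_i, H_j L) ⟶ H_n t(K, L)`, for a complex `K` with zero differential. -/
def gradedComponent (i j n : ℕ) (h : i + j = n) :
    (t.obj (K.X i)).obj (L.homology j) ⟶ (tensorComplex t K L).homology n :=
  (t.map (toHomologyOfZero hK i)).app _ ≫ kunnethComponent K L ht i j n h

lemma π_gradedComponent (i j n : ℕ) (h : i + j = n) :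
    (t.obj (K.X i)).map (L.homologyπ j) ≫ gradedComponent hK L ht i j n h =
      gradedCycles t hK L i j n h ≫ (tensorComplex t K L).homologyπ n := by
  rw [gradedComponent, gradedCycles, Category.assoc, ← π_kunnethComponent (ht := ht),
    toHomologyOfZero, t.map_comp, NatTrans.comp_app_assoc, NatTrans.naturality_assoc,
    NatTrans.naturality_assoc]

/-- The Künneth homomorphism of a complex `K` with zero differential, which is identified with its
homology. -/
def gradedKunneth (n : ℕ) :
    gradedSum (fun i j => (t.obj (K.X i)).obj (L.homology j)) 0 n ⟶
      (tensorComplex t K L).homology n :=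
  biproduct.desc fun p => gradedComponent hK L ht p.1.1 p.1.2 n p.2

lemma ι_gradedKunneth (n : ℕ) (p : {p : ℕ × ℕ // p.1 + p.2 + 0 = n}) :
    biproduct.ι (fun p : {p : ℕ × ℕ // p.1 + p.2 + 0 = n} =>
      (t.obj (K.X p.1.1)).obj (L.homology p.1.2)) p ≫ gradedKunneth hK L ht n =
      gradedComponent hK L ht p.1.1 p.1.2 n p.2 :=
  biproduct.ι_desc _ _

lemma isIso_gradedKunneth (n : ℕ) (h : IsIso (kunnethMap K L ht n)) :
    IsIso (gradedKunneth hK L ht n) := by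
  have e : gradedKunneth hK L ht n = biproduct.map (fun p : {p : ℕ × ℕ // p.1 + p.2 + 0 = n} =>
      (t.map (toHomologyOfZero hK p.1.1)).app (L.homology p.1.2)) ≫ kunnethMap K L ht n := by
    apply biproduct.hom_ext'
    intro p
    rw [biproduct.ι_map_assoc, ι_gradedKunneth, kunnethMap, biproduct.ι_desc,
      gradedComponent]
  have := isIso_toHomologyOfZero hK
  have : IsIso (biproduct.map (fun p : {p : ℕ × ℕ // p.1 + p.2 + 0 = n} =>
      (t.map (toHomologyOfZero hK p.1.1)).app (L.homology p.1.2))) :=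
    (biproduct.mapIso fun p : {p : ℕ × ℕ // p.1 + p.2 + 0 = n} =>
      (t.mapIso (asIso (toHomologyOfZero hK p.1.1))).app (L.homology p.1.2)).isIso_hom
  rw [e]
  infer_instance

include hK in
variable (t) in
lemma ιTensor_d_succ_of_zero (i j n : ℕ) (h : i + j = n) :
    ιTensor t K L i (j + 1) (n + 1) (by omega) ≫ (tensorComplex t K L).d (n + 1) n =
      ComplexShape.ε₂ (ComplexShape.down ℕ) (ComplexShape.down ℕ) (ComplexShape.down ℕ)
        (i, j + 1) • (t.obj (K.X i)).map (L.d (j + 1) j) ≫ ιTensor t K L i j n h := by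
  rw [ιTensor_d, tensorComplex_d₂_succ t K L i j n h]
  obtain _ | i := i
  · rw [tensorComplex_d₁_zero, zero_add]
  · rw [tensorComplex_d₁_succ t K L i (j + 1) n (by omega), hK, t.map_zero,
      zero_app, zero_comp, zero_add]

include hK in
variable (t) in
lemma ιTensor_d_zero_of_zero (i n m : ℕ) (h : i + 0 = n) :
    ιTensor t K L i 0 n h ≫ (tensorComplex t K L).d n m = 0 := by
  by_cases hm : m + 1 = n
  · rw [ιTensor_d, tensorComplex_d₂_zero, add_zero]
    obtain _ | i := i
    · rw [tensorComplex_d₁_zero]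
    · rw [tensorComplex_d₁_succ t K L i 0 m (by omega), hK, t.map_zero,
        zero_app, zero_comp]
  · rw [HomologicalComplex.shape _ _ _ hm, comp_zero]

variable {Q : ChainComplex A₁ ℕ} (hQ : ∀ i j, Q.d i j = 0) (h₀ : IsZero (Q.X 0))
  (s : ∀ i, Q.X (i + 1) ≅ K.X i)

include h₀

lemma isZero_tensor_of_isZero_zero (Y : A₂) : IsZero ((t.obj (Q.X 0)).obj Y) :=
  (t.flip.obj Y).map_isZero h₀

lemma isZero_tensorComplex_zero_of_isZero_zero : IsZero ((tensorComplex t Q L).X 0) := by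
  rw [IsZero.iff_id_eq_zero]
  refine tensorComplex_hom_ext fun i j h => ?_
  obtain rfl : i = 0 := by omega
  exact (isZero_tensor_of_isZero_zero h₀ (L.X j)).eq_of_src _ _

variable {L} in
lemma tensorComplex_hom_ext_of_isZero_zero {n : ℕ} {W : A}
    {x y : (tensorComplex t Q L).X (n + 1) ⟶ W}
    (h : ∀ (i j : ℕ) (h : i + j = n), ιTensor t Q L (i + 1) j (n + 1) (by omega) ≫ x =
      ιTensor t Q L (i + 1) j (n + 1) (by omega) ≫ y) : x = y := by
  refine tensorComplex_hom_ext fun i j hij => ?_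
  obtain _ | i := i
  · exact (isZero_tensor_of_isZero_zero h₀ (L.X j)).eq_of_src _ _
  · exact h i j (by omega)

omit h₀

variable (t) in
/-- If `Q` is the shift of `K`, given by isomorphisms `s` from `Q_{i+1}` to `K_i`, the map
`t(Q, L)_{n+1} ⟶ t(K, L)_n` which is `t(s_i, 1)` on the summand `(i + 1, j)`. -/
def unshift (n : ℕ) : (tensorComplex t Q L).X (n + 1) ⟶ (tensorComplex t K L).X n :=
  HomologicalComplex.mapBifunctorDesc fun i j h =>
    match i, h with
    | 0, _ => 0
    | i + 1, h => (t.map (s i).hom).app (L.X j) ≫ ιTensor t K L i j n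
        (Nat.succ_injective ((i.succ_add j).symm.trans h))

lemma ι_unshift (i j n : ℕ) (h : i + j = n) :
    ιTensor t Q L (i + 1) j (n + 1) (by omega) ≫ unshift t L s n =
      (t.map (s i).hom).app (L.X j) ≫ ιTensor t K L i j n h :=
  HomologicalComplex.ι_mapBifunctorDesc _ _ _ _

variable (t) in
/-- If `Q` is the shift of `K`, then `t(Q, L)` is, in each degree, the shift of `t(K, L)`. -/
def shiftIso (n : ℕ) : (tensorComplex t Q L).X (n + 1) ≅ (tensorComplex t K L).X n where
  hom := unshift t L s n
  inv := HomologicalComplex.mapBifunctorDesc fun i j h =>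
    (t.map (s i).inv).app (L.X j) ≫ ιTensor t Q L (i + 1) j (n + 1)
      (by have : i + j = n := h
          omega)
  hom_inv_id := by
    refine tensorComplex_hom_ext_of_isZero_zero h₀ fun i j h => ?_
    rw [← Category.assoc, ι_unshift L s i j n h, Category.assoc,
      HomologicalComplex.ι_mapBifunctorDesc, ← NatTrans.comp_app_assoc, ← t.map_comp,
      Iso.hom_inv_id, t.map_id, NatTrans.id_app, Category.id_comp, Category.comp_id]
  inv_hom_id := by
    refine tensorComplex_hom_ext fun i j h => ?_
    rw [HomologicalComplex.ι_mapBifunctorDesc_assoc, Category.assoc, ι_unshift L s i j n h,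
      ← NatTrans.comp_app_assoc, ← t.map_comp,
      Iso.inv_hom_id, t.map_id, NatTrans.id_app, Category.id_comp, Category.comp_id]

include hK hQ h₀ in
lemma unshift_d (n : ℕ) : unshift t L s (n + 1) ≫ (tensorComplex t K L).d (n + 1) n =
    -((tensorComplex t Q L).d (n + 2) (n + 1) ≫ unshift t L s n) := by
  refine tensorComplex_hom_ext_of_isZero_zero h₀ fun i j h => ?_
  rw [Preadditive.comp_neg, ← Category.assoc, ← Category.assoc, ι_unshift L s i j (n + 1) h,
    Category.assoc]
  obtain _ | j := j
  · rw [ιTensor_d_zero_of_zero t hK, ιTensor_d_zero_of_zero t hQ, comp_zero, zero_comp, neg_zero]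
  · -- the sign of `1 ⊗ ∂` on the summand `(i + 1, j)` is opposite to the one on `(i, j)`
    have hε : ComplexShape.ε₂ (ComplexShape.down ℕ) (ComplexShape.down ℕ) (ComplexShape.down ℕ)
        (i + 1, j + 1) = -ComplexShape.ε₂ (ComplexShape.down ℕ) (ComplexShape.down ℕ)
          (ComplexShape.down ℕ) (i, j + 1) := by
      change (-1 : ℤˣ) ^ (i + 1) = -(-1) ^ i
      rw [pow_succ, mul_neg_one]
    rw [ιTensor_d_succ_of_zero t hK L i j n (by omega),
      ιTensor_d_succ_of_zero t hQ L (i + 1) j (n + 1) (by omega), hε, Linear.comp_units_smul,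
      Linear.units_smul_comp, Category.assoc, ι_unshift L s i j n (by omega), Units.neg_smul,
      neg_neg, NatTrans.naturality_assoc]

include h₀ in
/-- If `Q` is the shift of the complex `K`, with zero differential, then `H_{n+1} t(Q, L)` is
`H_n t(K, L)`. -/
lemma exists_homology_shift_iso (n : ℕ) :
    ∃ e : (tensorComplex t Q L).homology (n + 1) ≅ (tensorComplex t K L).homology n,
      ∀ (i j : ℕ) (h : i + j = n),
        gradedComponent hQ L ht (i + 1) j (n + 1) (by omega) ≫ e.hom =
          (t.map (s i).hom).app (L.homology j) ≫ gradedComponent hK L ht i j n h := by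
  obtain ⟨e, he⟩ := exists_homology_iso_of_shift (shiftIso t L h₀ s) (unshift_d hK L hQ h₀ s)
    (isZero_tensorComplex_zero_of_isZero_zero L h₀) n
  refine ⟨e, fun i j h => ?_⟩
  have := ht.epi_obj_map (Q.X (i + 1)) (L.homologyπ j)
  rw [← cancel_epi ((t.obj (Q.X (i + 1))).map (L.homologyπ j)), ← Category.assoc,
    π_gradedComponent, Category.assoc, he _ ((t.map (s i).hom).app (L.cycles j) ≫
      gradedCycles t hK L i j n h), NatTrans.naturality_assoc, π_gradedComponent, Category.assoc]
  rw [← Category.assoc, gradedCycles_i, Category.assoc, Category.assoc, gradedCycles_i]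
  change _ ≫ _ ≫ unshift t L s n = _
  rw [ι_unshift L s i j n h, NatTrans.naturality_assoc]

include hK h₀ s in
/-- If the Künneth homomorphism of the complex `K`, with zero differential, is an isomorphism, then
so is that of its shift `Q`. -/
lemma isIso_desc_gradedComponent_of_shift (n : ℕ) (h : IsIso (kunnethMap K L ht n)) :
    IsIso (biproduct.desc fun p : {p : ℕ × ℕ // p.1 + p.2 + 0 = n} =>
      gradedComponent hQ L ht (p.1.1 + 1) p.1.2 (n + 1) (by have := p.2; omega)) := by
  obtain ⟨e, he⟩ := exists_homology_shift_iso hK L ht hQ h₀ s n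
  have := isIso_gradedKunneth hK L ht n h
  let σ := biproduct.mapIso fun p : {p : ℕ × ℕ // p.1 + p.2 + 0 = n} =>
    (t.mapIso (s p.1.1)).app (L.homology p.1.2)
  have h' : (biproduct.desc fun p : {p : ℕ × ℕ // p.1 + p.2 + 0 = n} =>
      gradedComponent hQ L ht (p.1.1 + 1) p.1.2 (n + 1) (by have := p.2; omega)) ≫ e.hom =
      σ.hom ≫ gradedKunneth hK L ht n := by
    apply biproduct.hom_ext'
    intro p
    dsimp only [σ]
    rw [biproduct.ι_desc_assoc, he p.1.1 p.1.2 p.2, biproduct.mapIso_hom, biproduct.ι_map_assoc,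
      ι_gradedKunneth]
    rfl
  rw [← isIso_comp_right_iff _ e.hom, h']
  infer_instance

end ZeroDiff

/-! ### The long exact sequence -/

section Exactness

variable {A : Type*} [Category* A] [Abelian A]

lemma mono_of_exact_epi_comp {X Y Z W : A} {f : X ⟶ Y} {e : Y ⟶ Z} {m : Z ⟶ W} [Epi e]
    {w : f ≫ e = 0} {w' : f ≫ e ≫ m = 0}
    (h' : (ShortComplex.mk f (e ≫ m) w').Exact) : Mono m := by
  rw [Preadditive.mono_iff_cancel_zero]
  intro V x hx
  obtain ⟨V₁, π₁, _, y, hy⟩ := surjective_up_to_refinements_of_epi e x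
  obtain ⟨V₂, π₂, _, z, hz⟩ := h'.exact_up_to_refinements y (by
    dsimp
    rw [← reassoc_of% hy, hx, comp_zero])
  dsimp at hz
  rw [← cancel_epi π₁, ← cancel_epi π₂, hy, reassoc_of% hz, w, comp_zero, comp_zero, comp_zero]

lemma exact_of_comp_exact {W X Y Z : A} {e : W ⟶ X} {f : X ⟶ Y} {g : Y ⟶ Z} {w : (e ≫ f) ≫ g = 0}
    (h : (ShortComplex.mk (e ≫ f) g w).Exact) (w' : f ≫ g = 0) :
    (ShortComplex.mk f g w').Exact :=
  exact_of_forall_comp_eq_zero fun x y hx hy => h.comp_eq_zero hx (by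
    dsimp at hy ⊢
    rw [Category.assoc, hy, comp_zero])

lemma epi_of_exact_comp_mono {X T Y Z : A} {p : X ⟶ T} {m : T ⟶ Y} {g : Y ⟶ Z} [Mono m]
    {w : (p ≫ m) ≫ g = 0} (h : (ShortComplex.mk (p ≫ m) g w).Exact) (hm : m ≫ g = 0) : Epi p := by
  rw [epi_iff_surjective_up_to_refinements]
  intro V x
  obtain ⟨V₁, π₁, _, y, hy⟩ := h.exact_up_to_refinements (x ≫ m) (by simp [hm])
  refine ⟨V₁, π₁, inferInstance, y, ?_⟩
  rw [← cancel_mono m, Category.assoc, hy, Category.assoc]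

lemma exact_of_comp_mono_exact {X T Y Z : A} {f : X ⟶ Y} {p : Y ⟶ T} {m : T ⟶ Z} [Mono m]
    {w : f ≫ p ≫ m = 0} (h : (ShortComplex.mk f (p ≫ m) w).Exact) (w' : f ≫ p = 0) :
    (ShortComplex.mk f p w').Exact :=
  exact_of_forall_comp_eq_zero fun x y hx hy => h.comp_eq_zero (by
    dsimp at hx ⊢
    rw [reassoc_of% hx, zero_comp]) hy

lemma exact_of_iso_comm {X Y Z X' Y' Z' : A} {f : X ⟶ Y} {g : Y ⟶ Z} {w : f ≫ g = 0}
    (h : (ShortComplex.mk f g w).Exact) {f' : X' ⟶ Y'} {g' : Y' ⟶ Z'} (w' : f' ≫ g' = 0)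
    (e₁ : X ≅ X') (e₂ : Y ≅ Y') (e₃ : Z ≅ Z') (h₁ : e₁.hom ≫ f' = f ≫ e₂.hom)
    (h₂ : e₂.hom ≫ g' = g ≫ e₃.hom) : (ShortComplex.mk f' g' w').Exact :=
  ShortComplex.exact_of_iso (ShortComplex.isoMk e₁ e₂ e₃ h₁ h₂) h

end Exactness

noncomputable section TensorShortExact

variable {A₁ A₂ A : Type*} [Category* A₁] [Category* A₂] [Category* A] [Abelian A₁] [Abelian A₂]
  [Abelian A] {t : A₁ ⥤ A₂ ⥤ A} [t.Additive] [∀ X, (t.obj X).Additive]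

variable (t) in
/-- The degree `n` part of `t(K, L)`, as a biproduct. -/
def tensorXIso (K : ChainComplex A₁ ℕ) (L : ChainComplex A₂ ℕ) (n : ℕ) :
    gradedSum (fun i j => (t.obj (K.X i)).obj (L.X j)) 0 n ≅ (tensorComplex t K L).X n where
  hom := biproduct.desc fun p => ιTensor t K L p.1.1 p.1.2 n p.2
  inv := HomologicalComplex.mapBifunctorDesc fun i j h =>
    biproduct.ι (fun p : {p : ℕ × ℕ // p.1 + p.2 + 0 = n} =>
      (t.obj (K.X p.1.1)).obj (L.X p.1.2)) ⟨(i, j), h⟩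
  hom_inv_id := by
    apply biproduct.hom_ext'
    intro p
    rw [biproduct.ι_desc_assoc, HomologicalComplex.ι_mapBifunctorDesc, Category.comp_id]
  inv_hom_id := by
    refine tensorComplex_hom_ext fun i j h => ?_
    rw [HomologicalComplex.ι_mapBifunctorDesc_assoc, biproduct.ι_desc, Category.comp_id]

variable (t) in
lemma tensorXIso_hom_tensorMap (L : ChainComplex A₂ ℕ) {K K' : ChainComplex A₁ ℕ} (φ : K ⟶ K')
    (n : ℕ) : (tensorXIso t K L n).hom ≫ (tensorMap t L φ).f n =
      biproduct.map (fun p : {p : ℕ × ℕ // p.1 + p.2 + 0 = n} =>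
        (t.map (φ.f p.1.1)).app (L.X p.1.2)) ≫ (tensorXIso t K' L n).hom := by
  apply biproduct.hom_ext'
  intro p
  rw [tensorXIso, biproduct.ι_desc_assoc, biproduct.ι_map_assoc, tensorXIso, biproduct.ι_desc,
    ιTensor_tensorMap]

lemma tensorMap_comp_eq_zero (L : ChainComplex A₂ ℕ) {Z K Q : ChainComplex A₁ ℕ} {a : Z ⟶ K}
    {b : K ⟶ Q} (w : ∀ i, a.f i ≫ b.f i = 0) : tensorMap t L a ≫ tensorMap t L b = 0 := by
  ext n : 1
  refine tensorComplex_hom_ext fun i j h => ?_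
  rw [HomologicalComplex.comp_f, ← Category.assoc, ιTensor_tensorMap, Category.assoc,
    ιTensor_tensorMap, ← NatTrans.comp_app_assoc, ← t.map_comp, w, t.map_zero, zero_app,
    zero_comp, HomologicalComplex.zero_f, comp_zero]

/-- A degreewise short exact sequence of complexes remains one after applying `t(-, L)` if its first
map remains a monomorphism. -/
lemma shortExact_tensorMap (ht : RightExactBifunctor t) (L : ChainComplex A₂ ℕ)
    {Z K Q : ChainComplex A₁ ℕ} {a : Z ⟶ K} {b : K ⟶ Q}
    (w : ∀ i, a.f i ≫ b.f i = 0)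
    (h : ∀ i, (ShortComplex.mk (a.f i) (b.f i) (w i)).ShortExact)
    (hm : ∀ i j, Mono ((t.map (a.f i)).app (L.X j))) :
    (ShortComplex.mk (tensorMap t L a) (tensorMap t L b) (tensorMap_comp_eq_zero L w)).ShortExact := by
  apply HomologicalComplex.shortExact_of_degreewise_shortExact
  intro n
  have hb : ∀ i j, Epi ((t.map (b.f i)).app (L.X j)) := fun i j =>
    have := (h i).epi_g
    ht.epi_map_app (b.f i) (L.X j)
  have ha' := (tensorXIso_hom_tensorMap t L a n)
  have hb' := (tensorXIso_hom_tensorMap t L b n)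
  have ex := exact_biproduct_map (J := {p : ℕ × ℕ // p.1 + p.2 + 0 = n})
    (fun p => (t.map (a.f p.1.1)).app (L.X p.1.2)) (fun p => (t.map (b.f p.1.1)).app (L.X p.1.2))
    _ (fun p => have := (h p.1.1).epi_g
      ht.exact_map_app (h p.1.1).exact (L.X p.1.2))
  exact
    { exact := exact_of_iso_comm ex _ (tensorXIso t Z L n) (tensorXIso t K L n)
        (tensorXIso t Q L n) ha' hb'
      mono_f := by
        have : Mono ((tensorXIso t Z L n).hom ≫ (tensorMap t L a).f n) := by
          rw [ha']
          infer_instance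
        change Mono ((tensorMap t L a).f n)
        exact (mono_comp_iff_of_isIso (tensorXIso t Z L n).hom _).1 this
      epi_g := by
        have : Epi ((tensorXIso t K L n).hom ≫ (tensorMap t L b).f n) := by
          rw [hb']
          infer_instance
        change Epi ((tensorMap t L b).f n)
        exact (epi_comp_iff_of_epi (tensorXIso t K L n).hom _).1 this }

end TensorShortExact

noncomputable section Connecting

variable {A₁ A₂ A : Type*} [Category* A₁] [Category* A₂] [Category* A] [Abelian A₁] [Abelian A₂]
  [Abelian A] {t : A₁ ⥤ A₂ ⥤ A} [t.Additive] [∀ X, (t.obj X).Additive]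
  (ht : RightExactBifunctor t) (L : ChainComplex A₂ ℕ) {Z K Q : ChainComplex A₁ ℕ}
  (hZ : ∀ i j, Z.d i j = 0) (hQ : ∀ i j, Q.d i j = 0) {a : Z ⟶ K} {b : K ⟶ Q}

/-- The map induced by `Z ⟶ K` in homology, on the summand `t(Z_i, H_j L)`. -/
lemma gradedComponent_homologyMap (z : ∀ i, Z.X i ⟶ K.cycles i)
    (hz : ∀ i, z i ≫ K.iCycles i = a.f i) (i j n : ℕ) (h : i + j = n) :
    gradedComponent hZ L ht i j n h ≫ HomologicalComplex.homologyMap (tensorMap t L a) n =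
      (t.map (z i ≫ K.homologyπ i)).app (L.homology j) ≫ kunnethComponent K L ht i j n h := by
  have := ht.epi_obj_map (Z.X i) (L.homologyπ j)
  have hc : gradedCycles t hZ L i j n h ≫ HomologicalComplex.cyclesMap (tensorMap t L a) n =
      (t.map (z i)).app (L.cycles j) ≫ cyclesProduct t K L i j n h := by
    rw [← cancel_mono ((tensorComplex t K L).iCycles n), Category.assoc,
      HomologicalComplex.cyclesMap_i, ← Category.assoc, gradedCycles_i, Category.assoc,
      ιTensor_tensorMap, Category.assoc, cyclesProduct_i, ← NatTrans.naturality_assoc,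
      ← NatTrans.comp_app_assoc, ← t.map_comp, hz]
  rw [← cancel_epi ((t.obj (Z.X i)).map (L.homologyπ j)), ← Category.assoc, π_gradedComponent,
    Category.assoc, HomologicalComplex.homologyπ_naturality, ← Category.assoc, hc, Category.assoc,
    ← π_kunnethComponent (ht := ht), NatTrans.naturality_assoc, t.map_comp,
    NatTrans.comp_app_assoc]

variable {w : tensorMap t L a ≫ tensorMap t L b = 0}
  (hT : (ShortComplex.mk (tensorMap t L a) (tensorMap t L b) w).ShortExact)

/-- The connecting homomorphism on the summand `t(Q_{i+1}, H_j L)`. -/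
lemma gradedComponent_δ (β : ∀ i, Q.X (i + 1) ⟶ Z.X i)
    (hβ : ∀ i, b.f (i + 1) ≫ β i ≫ a.f i = K.d (i + 1) i) (hb : ∀ i, Epi (b.f i))
    (i j n : ℕ) (h : i + j = n) :
    gradedComponent hQ L ht (i + 1) j (n + 1) (by omega) ≫ hT.δ (n + 1) n (by simp) =
      (t.map (β i)).app (L.homology j) ≫ gradedComponent hZ L ht i j n h := by
  have := ht.epi_obj_map (Q.X (i + 1)) (L.homologyπ j)
  have := hb (i + 1)
  have := ht.epi_map_app (b.f (i + 1)) (L.cycles j)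
  have e₁ : (t.map (b.f (i + 1))).app (L.cycles j) ≫
      gradedCycles t hQ L (i + 1) j (n + 1) (by omega) ≫ (tensorComplex t Q L).iCycles (n + 1) =
      ((t.obj (K.X (i + 1))).map (L.iCycles j) ≫ ιTensor t K L (i + 1) j (n + 1) (by omega)) ≫
        (tensorMap t L b).f (n + 1) := by
    rw [gradedCycles_i, Category.assoc, ιTensor_tensorMap, NatTrans.naturality_assoc]
  have e₂ : ((t.map (b.f (i + 1) ≫ β i)).app (L.cycles j) ≫ gradedCycles t hZ L i j n h ≫
      (tensorComplex t Z L).iCycles n) ≫ (tensorMap t L a).f n =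
      ((t.obj (K.X (i + 1))).map (L.iCycles j) ≫ ιTensor t K L (i + 1) j (n + 1) (by omega)) ≫
        (tensorComplex t K L).d (n + 1) n := by
    rw [gradedCycles_i, Category.assoc, Category.assoc, Category.assoc, ιTensor_tensorMap,
      ιTensor_d, Preadditive.comp_add, iCycles_d₂, add_zero, tensorComplex_d₁_succ t K L i j n h,
      ← hβ, ← NatTrans.naturality_assoc, ← NatTrans.comp_app_assoc,
      ← t.map_comp, Category.assoc]
  have key := hT.δ_eq (n + 1) n (by simp) (x₃ := (t.map (b.f (i + 1))).app (L.cycles j) ≫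
      gradedCycles t hQ L (i + 1) j (n + 1) (by omega) ≫ (tensorComplex t Q L).iCycles (n + 1))
    (by simp) _ e₁.symm _ e₂ _ rfl
  rw [← cancel_epi ((t.obj (Q.X (i + 1))).map (L.homologyπ j)),
    ← cancel_epi ((t.map (b.f (i + 1))).app (L.cycles j)), ← Category.assoc ((t.obj _).map _),
    π_gradedComponent]
  refine Eq.trans ?_ (key.trans ?_)
  · rw [Category.assoc, ← Category.assoc ((t.map (b.f (i + 1))).app (L.cycles j))]
    congr 1
    rw [← cancel_mono ((tensorComplex t Q L).iCycles (n + 1)), Category.assoc]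
    exact (HomologicalComplex.liftCycles_i _ _ _ _ _).symm
  · rw [NatTrans.naturality_assoc, π_gradedComponent, ← NatTrans.comp_app_assoc, ← t.map_comp]
    refine Eq.trans (congrArg (· ≫ (tensorComplex t Z L).homologyπ n) ?_) (Category.assoc _ _ _)
    rw [← cancel_mono ((tensorComplex t Z L).iCycles n), Category.assoc]
    exact HomologicalComplex.liftCycles_i _ _ _ _ _

end Connecting

/-! ### The Künneth short exact sequence -/

noncomputable section Kunneth

variable {A₁ A₂ A : Type*} [Category* A₁] [Category* A₂] [Category* A] [Abelian A₁] [Abelian A₂]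
  [Abelian A] {t : A₁ ⥤ A₂ ⥤ A} [t.Additive] [∀ X, (t.obj X).Additive]

/-- If `κ` is a monomorphism with cokernel the image of `b`, and `b` factors as an epimorphism `p`
followed by a monomorphism `m`, then `κ` and `p` form a short exact sequence. -/
lemma exists_shortExact_of_factor {X Y T V : A} {κ : X ⟶ Y} {b : Y ⟶ V} {w : κ ≫ b = 0}
    (ex : (ShortComplex.mk κ b w).Exact) (hκ : Mono κ) (p : Y ⟶ T) (hp : Epi p) (m : T ⟶ V)
    (hm : Mono m) (hpm : p ≫ m = b) :
    ∃ (p : Y ⟶ T) (h : κ ≫ p = 0), (ShortComplex.mk κ p h).ShortExact := by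
  subst hpm
  have h : κ ≫ p = 0 := by rw [← cancel_mono m, Category.assoc, w, zero_comp]
  exact ⟨p, h, { exact := exact_of_comp_mono_exact ex h }⟩

variable [EnoughProjectives A₁] [EnoughProjectives A₂] (ht : RightExactBifunctor t)

include ht in
/-- The direct sum of the exact sequences `0 ⟶ Tor₁(W, H) ⟶ t(X, H) ⟶ t(Y, H)` which come from short
exact sequences `X ⟶ Y ⟶ W` with `Tor₁(Y, H) = 0`. -/
lemma exists_exact_gradedSum_tor {X Y W : ℕ → A₁} {β : ∀ i, X i ⟶ Y i} {q : ∀ i, Y i ⟶ W i}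
    {w : ∀ i, β i ≫ q i = 0} (h : ∀ i, (ShortComplex.mk (β i) (q i) (w i)).ShortExact)
    (H : ℕ → A₂) (hY : ∀ i j, IsZero (tor₁ t (Y i) (H j))) (n : ℕ) :
    ∃ (δ : gradedSum (fun i j => tor₁ t (W i) (H j)) 1 (n + 1) ⟶
        gradedSum (fun i j => (t.obj (X i)).obj (H j)) 0 n)
      (w : δ ≫ biproduct.map (fun p : {p : ℕ × ℕ // p.1 + p.2 + 0 = n} =>
        (t.map (β p.1.1)).app (H p.1.2)) = 0), (ShortComplex.mk _ _ w).Exact ∧ Mono δ := by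
  choose δ w hδ hm using fun i j => exact_tor ht (h i) (H j)
  have hm' : ∀ i j, Mono (δ i j) := fun i j => hm i j (hY i j)
  have ex := exact_biproduct_map (J := {p : ℕ × ℕ // p.1 + p.2 + 0 = n})
    (fun p => δ p.1.1 p.1.2) (fun p => (t.map (β p.1.1)).app (H p.1.2))
    (fun p => w p.1.1 p.1.2) (fun p => hδ p.1.1 p.1.2)
  let e : gradedSum (fun i j => tor₁ t (W i) (H j)) 1 (n + 1) ≅
      gradedSum (fun i j => tor₁ t (W i) (H j)) 0 n :=
    biproduct.whiskerEquiv (f := fun p : {p : ℕ × ℕ // p.1 + p.2 + 1 = n + 1} =>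
        tor₁ t (W p.1.1) (H p.1.2))
      (g := fun p : {p : ℕ × ℕ // p.1 + p.2 + 0 = n} => tor₁ t (W p.1.1) (H p.1.2))
      (Equiv.subtypeEquivRight fun p => by omega) fun _ => Iso.refl _
  exact ⟨e.hom ≫ biproduct.map fun p => δ p.1.1 p.1.2, _, exact_epi_comp e.hom ex, mono_comp _ _⟩

variable {K Z Q : ChainComplex A₁ ℕ} {L : ChainComplex A₂ ℕ}
  (hZ : ∀ i j, Z.d i j = 0) (hQ : ∀ i j, Q.d i j = 0) {a : Z ⟶ K} {b : K ⟶ Q}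
  {w : ∀ i, a.f i ≫ b.f i = 0} (hK : ∀ i, (ShortComplex.mk (a.f i) (b.f i) (w i)).ShortExact)
  {β : ∀ i, Q.X (i + 1) ⟶ Z.X i} (hβ : ∀ i, b.f (i + 1) ≫ β i ≫ a.f i = K.d (i + 1) i)
  {z : ∀ i, Z.X i ⟶ K.cycles i} (hz : ∀ i, z i ≫ K.iCycles i = a.f i)
  {q : ∀ i, Z.X i ⟶ K.homology i} (hq : ∀ i, z i ≫ K.homologyπ i = q i)
  {w' : ∀ i, β i ≫ q i = 0} (hH : ∀ i, (ShortComplex.mk (β i) (q i) (w' i)).ShortExact)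
  (h₀ : IsZero (Q.X 0))
  (hαZ : ∀ n, IsIso (gradedKunneth hZ L ht n))
  (hαQ : ∀ n, IsIso (biproduct.desc fun p : {p : ℕ × ℕ // p.1 + p.2 + 0 = n} =>
    gradedComponent hQ L ht (p.1.1 + 1) p.1.2 (n + 1) (by have := p.2; omega)))
  (torQ : ∀ i j, IsZero (tor₁ t (Q.X (i + 1)) (L.X j)))
  (torZ : ∀ i j, IsZero (tor₁ t (Z.X i) (L.homology j)))

include hK hβ hz hq hH h₀ hαZ hαQ torQ torZ

/-- The Künneth short exact sequence, for a complex `K` sitting in a degreewise short exact sequence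
`Z ⟶ K ⟶ Q` where `Z` is its complex of cycles and `Q` its shifted complex of boundaries. -/
theorem exists_shortExact_kunnethMap (n : ℕ) :
    ∃ (p : (tensorComplex t K L).homology n ⟶
        gradedSum (fun i j => tor₁ t (K.homology i) (L.homology j)) 1 n)
      (h : kunnethMap K L ht n ≫ p = 0),
      (ShortComplex.mk (kunnethMap K L ht n) p h).ShortExact := by
  -- `a` is an isomorphism in degree `0`; in positive degrees the kernel is a quotient of `Tor₁`
  have hm : ∀ i j, Mono ((t.map (a.f i)).app (L.X j)) := fun i j => by
    obtain _ | i := i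
    · have := (hK 0).mono_f
      have := (hK 0).isIso_f_iff.2 h₀
      dsimp at this
      infer_instance
    · obtain ⟨δ, wδ, hδ, -⟩ := exact_tor ht (hK (i + 1)) (L.X j)
      exact hδ.mono_g ((torQ i j).eq_of_src _ _)
  have hT := shortExact_tensorMap ht L w hK hm
  have hab : tensorMap t L a ≫ tensorMap t L b = 0 := tensorMap_comp_eq_zero L w
  have epi_q : ∀ i, Epi (q i) := fun i => (hH i).epi_g
  -- In terms of the Künneth isomorphisms `α'` of `Q` and `gradedKunneth` of `Z`, the connecting
  -- homomorphism is `B`, whose cokernel is `P`.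
  let α' (n : ℕ) : gradedSum (fun i j => (t.obj (Q.X (i + 1))).obj (L.homology j)) 0 n ⟶
      (tensorComplex t Q L).homology (n + 1) :=
    biproduct.desc fun p : {p : ℕ × ℕ // p.1 + p.2 + 0 = n} =>
      gradedComponent hQ L ht (p.1.1 + 1) p.1.2 (n + 1) (by have := p.2; omega)
  let B (n : ℕ) := biproduct.map (fun p : {p : ℕ × ℕ // p.1 + p.2 + 0 = n} =>
    (t.map (β p.1.1)).app (L.homology p.1.2))
  let P (n : ℕ) := biproduct.map (fun p : {p : ℕ × ℕ // p.1 + p.2 + 0 = n} =>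
    (t.map (q p.1.1)).app (L.homology p.1.2))
  have exBP (n : ℕ) := exact_biproduct_map (J := {p : ℕ × ℕ // p.1 + p.2 + 0 = n})
    (fun p => (t.map (β p.1.1)).app (L.homology p.1.2))
    (fun p => (t.map (q p.1.1)).app (L.homology p.1.2)) _
    (fun p => ht.exact_map_app (hH p.1.1).exact (L.homology p.1.2))
  have exBP₀ : B n ≫ P n = 0 := by
    apply biproduct.hom_ext'
    intro p
    dsimp only [B, P]
    rw [biproduct.ι_map_assoc, biproduct.ι_map, ← NatTrans.comp_app_assoc, ← t.map_comp, w',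
      t.map_zero, zero_app, zero_comp, comp_zero]
  have hP (n : ℕ) : Epi (P n) :=
    have (p : {p : ℕ × ℕ // p.1 + p.2 + 0 = n}) := ht.epi_map_app
      (q p.1.1) (L.homology p.1.2)
    inferInstanceAs (Epi (biproduct.map _))
  have hB (n : ℕ) : α' n ≫ hT.δ (n + 1) n (by simp) = B n ≫ gradedKunneth hZ L ht n := by
    apply biproduct.hom_ext'
    intro p
    dsimp only [α', B]
    rw [biproduct.ι_desc_assoc, biproduct.ι_map_assoc, ι_gradedKunneth]
    exact gradedComponent_δ ht L hZ hQ hT β hβ (fun i => (hK i).epi_g) p.1.1 p.1.2 n p.2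
  have hPa : gradedKunneth hZ L ht n ≫ HomologicalComplex.homologyMap (tensorMap t L a) n =
      P n ≫ kunnethMap K L ht n := by
    apply biproduct.hom_ext'
    intro p
    dsimp only [P]
    rw [← Category.assoc, ι_gradedKunneth, biproduct.ι_map_assoc, kunnethMap,
      biproduct.ι_desc]
    rw [← hq]
    exact gradedComponent_homologyMap ht L hZ z hz p.1.1 p.1.2 n p.2
  have := hαZ
  have hα' : ∀ n, IsIso (α' n) := hαQ
  have ha : (inv (gradedKunneth hZ L ht n) ≫ P n) ≫ kunnethMap K L ht n =
      HomologicalComplex.homologyMap (tensorMap t L a) n := by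
    rw [Category.assoc, ← hPa, IsIso.inv_hom_id_assoc]
  -- `P`, and the map induced by `a`, which is `P` followed by `κ`, have the same kernel
  have hκ : Mono (kunnethMap K L ht n) := by
    have ex := hT.homology_exact₁ (n + 1) n (by simp)
    have hδ : hT.δ (n + 1) n (by simp) ≫ inv (gradedKunneth hZ L ht n) ≫ P n = 0 := by
      rw [← cancel_epi (α' n), reassoc_of% hB n, IsIso.hom_inv_id_assoc, exBP₀, comp_zero]
    have := hP n
    refine mono_of_exact_epi_comp (f := hT.δ (n + 1) n (by simp))
      (e := inv (gradedKunneth hZ L ht n) ≫ P n) (w := hδ)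
      (w' := by rw [← Category.assoc, hδ, zero_comp]) ?_
    convert ex using 2
  have ex : (ShortComplex.mk (kunnethMap K L ht n)
      (HomologicalComplex.homologyMap (tensorMap t L b) n) (by
        have := hP n
        rw [← cancel_epi (inv (gradedKunneth hZ L ht n) ≫ P n), ← Category.assoc, ha, comp_zero,
          ← HomologicalComplex.homologyMap_comp, hab,
          HomologicalComplex.homologyMap_zero])).Exact := by
    refine exact_of_comp_exact (e := inv (gradedKunneth hZ L ht n) ≫ P n) (w := ?_) ?_ _
    · rw [ha, ← HomologicalComplex.homologyMap_comp, hab, HomologicalComplex.homologyMap_zero]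
    · have := hT.homology_exact₂ n
      convert this using 2
  cases n with
  | zero =>
    -- there is no index `(i, j)` with `i + j + 1 = 0`
    have hT₀ : IsZero (gradedSum (fun i j => tor₁ t (K.homology i) (L.homology j)) 1 0) := by
      rw [IsZero.iff_id_eq_zero]
      apply biproduct.hom_ext'
      intro p
      exact absurd p.2 (by omega)
    have hQ₀ : IsZero ((tensorComplex t Q L).homology 0) :=
      ((isZero_tensorComplex_zero_of_isZero_zero L h₀).of_mono
        ((tensorComplex t Q L).iCycles 0)).of_epi ((tensorComplex t Q L).homologyπ 0)
    exact exists_shortExact_of_factor ex hκ 0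
      (by rw [Preadditive.epi_iff_cancel_zero]; exact fun _ g _ => hT₀.eq_of_src _ _) 0
      (by rw [Preadditive.mono_iff_cancel_zero]; exact fun _ g _ => hT₀.eq_of_tgt _ _)
      (hQ₀.eq_of_tgt _ _)
  | succ n =>
    obtain ⟨δ, wδ, exδ, mδ⟩ := exists_exact_gradedSum_tor ht hH (fun j => L.homology j)
      torZ n
    have hδ : (δ ≫ α' n) ≫ hT.δ (n + 1) n (by simp) = 0 := by
      rw [Category.assoc, hB, reassoc_of% wδ, zero_comp]
    have exδ' : (ShortComplex.mk (δ ≫ α' n) _ hδ).Exact :=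
      exact_of_iso_comm exδ _ (Iso.refl _) (asIso (α' n)) (asIso (gradedKunneth hZ L ht n))
        (Category.id_comp _) (hB n)
    have exb := hT.homology_exact₃ (n + 1) n (by simp)
    have hbδ : HomologicalComplex.homologyMap (tensorMap t L b) (n + 1) ≫
        hT.δ (n + 1) n (by simp) = 0 := hT.comp_δ _ _ _
    let p := exδ'.lift (HomologicalComplex.homologyMap (tensorMap t L b) (n + 1)) hbδ
    have hp : p ≫ δ ≫ α' n = HomologicalComplex.homologyMap (tensorMap t L b) (n + 1) :=
      exδ'.lift_f _ _
    refine exists_shortExact_of_factor ex hκ p ?_ (δ ≫ α' n) inferInstance hp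
    refine epi_of_exact_comp_mono (m := δ ≫ α' n) (g := hT.δ (n + 1) n (by simp)) (w := ?_) ?_ hδ
    · rw [hp]
      exact hbδ
    · convert exb using 2

end Kunneth

/-! ### Cycles and boundaries -/

noncomputable section Boundaries

variable {A₁ A₂ A : Type*} [Category* A₁] [Category* A₂] [Category* A] [Abelian A₁] [Abelian A₂]
  [Abelian A] {t : A₁ ⥤ A₂ ⥤ A} [t.Additive] [∀ X, (t.obj X).Additive]

variable (K : ChainComplex A₁ ℕ)

/-- The graded object of cycles of `K`, as a complex with zero differential. -/
abbrev cyclesComplex : ChainComplex A₁ ℕ := zeroDiff fun i => K.cycles i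

/-- The inclusion of the cycles. -/
def cyclesInclusion : cyclesComplex K ⟶ K where
  f i := K.iCycles i
  comm' i j _ := (K.iCycles_d i j).trans zero_comp.symm

open ZeroObject in
/-- The shifted graded object of boundaries of `K`, which is `0` in degree `0` and `B_i K` in degree
`i + 1`. -/
def shiftedBoundaries : ℕ → A₁
  | 0 => 0
  | i + 1 => boundaries K i

/-- The shifted graded object of boundaries of `K`, as a complex with zero differential. -/
abbrev boundariesComplex : ChainComplex A₁ ℕ := zeroDiff (shiftedBoundaries K)

/-- The differential of `K`, regarded as a map to the boundaries. -/
def toShiftedBoundaries : ∀ i, K.X i ⟶ shiftedBoundaries K i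
  | 0 => 0
  | i + 1 => factorThruImage (K.d (i + 1) i)

lemma d_factorThruImage (i : ℕ) : K.d (i + 2) (i + 1) ≫ factorThruImage (K.d (i + 1) i) = 0 := by
  rw [← cancel_mono (image.ι (K.d (i + 1) i)), Category.assoc, image.fac, K.d_comp_d, zero_comp]

/-- The differential of `K`, regarded as a chain map to the shifted complex of boundaries. -/
def toBoundaries : K ⟶ boundariesComplex K where
  f := toShiftedBoundaries K
  comm' i j h := by
    obtain rfl : j + 1 = i := h
    obtain _ | j := j
    · exact (comp_zero).trans comp_zero.symm
    · exact (comp_zero).trans (d_factorThruImage K j).symm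

lemma cyclesInclusion_toBoundaries (i : ℕ) :
    (cyclesInclusion K).f i ≫ (toBoundaries K).f i = 0 := by
  obtain _ | i := i
  · exact comp_zero
  · change K.iCycles (i + 1) ≫ factorThruImage (K.d (i + 1) i) = 0
    rw [← cancel_mono (image.ι (K.d (i + 1) i)), Category.assoc, image.fac, K.iCycles_d, zero_comp]

lemma shortExact_cycles_boundaries (i : ℕ) :
    (ShortComplex.mk ((cyclesInclusion K).f i) ((toBoundaries K).f i)
      (cyclesInclusion_toBoundaries K i)).ShortExact := by
  obtain _ | i := i
  · have : IsIso (K.iCycles 0) := ShortComplex.isIso_iCycles _ (K.shape _ _ (by simp))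
    have h₀ : IsZero (shiftedBoundaries K 0) := isZero_zero A₁
    exact
      { exact := (ShortComplex.exact_iff_epi _ (h₀.eq_of_tgt _ _)).2
          (inferInstanceAs (Epi (K.iCycles 0)))
        mono_f := inferInstanceAs (Mono (K.iCycles 0))
        epi_g := by
          rw [Preadditive.epi_iff_cancel_zero]
          exact fun _ g _ => h₀.eq_of_src _ _ }
  · have w : K.iCycles (i + 1) ≫ factorThruImage (K.d (i + 1) i) ≫ image.ι (K.d (i + 1) i) = 0 := by
      rw [image.fac, K.iCycles_d]
    have ex : (ShortComplex.mk (K.iCycles (i + 1)) _ w).Exact := by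
      have := ShortComplex.exact_of_f_is_kernel
        (ShortComplex.mk _ _ (K.iCycles_d (i + 1) i)) (K.cyclesIsKernel (i + 1) i (by simp))
      convert this using 2
      exact image.fac _
    exact
      { exact := exact_of_comp_mono_exact ex (cyclesInclusion_toBoundaries K (i + 1))
        mono_f := inferInstanceAs (Mono (K.iCycles (i + 1)))
        epi_g := inferInstanceAs (Epi (factorThruImage (K.d (i + 1) i))) }

/-- The inclusion of the boundaries into the cycles. -/
def boundariesToCycles (i : ℕ) : boundaries K i ⟶ K.cycles i :=
  K.liftCycles (image.ι (K.d (i + 1) i)) _ rfl (by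
    rw [← cancel_epi (factorThruImage (K.d (i + 1) i)), image.fac_assoc, K.d_comp_d, comp_zero])

lemma boundariesToCycles_i (i : ℕ) :
    boundariesToCycles K i ≫ K.iCycles i = image.ι (K.d (i + 1) i) :=
  HomologicalComplex.liftCycles_i _ _ _ _ _

lemma factorThruImage_boundariesToCycles (i : ℕ) :
    factorThruImage (K.d (i + 1) i) ≫ boundariesToCycles K i = K.toCycles (i + 1) i := by
  rw [← cancel_mono (K.iCycles i), Category.assoc, boundariesToCycles_i, image.fac,
    HomologicalComplex.toCycles_i]

lemma boundariesToCycles_π (i : ℕ) : boundariesToCycles K i ≫ K.homologyπ i = 0 := by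
  rw [← cancel_epi (factorThruImage (K.d (i + 1) i)), ← Category.assoc,
    factorThruImage_boundariesToCycles, HomologicalComplex.toCycles_comp_homologyπ, comp_zero]

lemma shortExact_boundaries_homology (i : ℕ) :
    (ShortComplex.mk (boundariesToCycles K i) (K.homologyπ i)
      (boundariesToCycles_π K i)).ShortExact where
  exact := by
    refine exact_of_comp_exact (e := factorThruImage (K.d (i + 1) i)) (w := ?_) ?_ _
    · rw [factorThruImage_boundariesToCycles, HomologicalComplex.toCycles_comp_homologyπ]
    · have := ShortComplex.exact_of_g_is_cokernel
        (ShortComplex.mk _ _ (K.toCycles_comp_homologyπ (i + 1) i))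
        (K.homologyIsCokernel (i + 1) i (by simp))
      convert this using 2
      exact factorThruImage_boundariesToCycles K i
  mono_f := by
    have : Mono (boundariesToCycles K i ≫ K.iCycles i) := by
      rw [boundariesToCycles_i]
      infer_instance
    exact mono_of_mono _ (K.iCycles i)
  epi_g := inferInstanceAs (Epi (K.homologyπ i))

variable {K} {L : ChainComplex A₂ ℕ}

/-- The algebraic Künneth theorem: the Künneth homomorphism is a monomorphism, with cokernel the sum
of the `Tor₁(H_i K, H_j L)`. -/
theorem AlgebraicKunnethConditions.exists_shortExact [EnoughProjectives A₁] [EnoughProjectives A₂]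
    (h : AlgebraicKunnethConditions t K L) (n : ℕ) :
    ∃ (p : (tensorComplex t K L).homology n ⟶
        gradedSum (fun i j => tor₁ t (K.homology i) (L.homology j)) 1 n)
      (w : kunnethMap K L h.rightExact n ≫ p = 0),
      (ShortComplex.mk (kunnethMap K L h.rightExact n) p w).ShortExact :=
  exists_shortExact_kunnethMap h.rightExact (Z := cyclesComplex K) (Q := boundariesComplex K)
    (fun _ _ => rfl) (fun _ _ => rfl) (shortExact_cycles_boundaries K)
    (β := boundariesToCycles K)
    (fun i => (congrArg (factorThruImage (K.d (i + 1) i) ≫ ·) (boundariesToCycles_i K i)).trans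
      (image.fac _))
    (z := fun i => 𝟙 (K.cycles i)) (fun _ => Category.id_comp _)
    (q := fun i => K.homologyπ i) (fun _ => Category.id_comp _)
    (shortExact_boundaries_homology K)
    (isZero_zero A₁) (fun n => isIso_gradedKunneth _ L h.rightExact n (h.isIso_cycles n))
    (fun n => isIso_desc_gradedComponent_of_shift (K := zeroDiff (boundaries K)) (fun _ _ => rfl) L
      h.rightExact _ (isZero_zero A₁) (fun i => Iso.refl (boundaries K i)) n (h.isIso_boundaries n))
    h.tor_boundaries h.tor_cycles n

end Boundaries

theorem theorem6p1 {D : Type u} [Category.{v} D] [MonoidalCategory D] [DoubleCategory.{w, v₁} D]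
    [FramedBicategory D] [ClosedFramedBicategory D] [AbelianFramedBicategory D]
    [MonoidalDoubleCategory D] [MonoidalAbelianFramedBicategory D]
    [∀ A B : D, EnoughProjectives (DoubleCategory.Hor A B)]
    [∀ A B : D, EnoughInjectives (DoubleCategory.Hor A B)]
    [∀ A B : D, HasCoproducts.{v₁} (DoubleCategory.Hor A B)]
    {C : Type*} [Category* C] [MonoidalCategory C] (M : C ⥤ FramedComplex D)
    (l : LeftComparison M) (r : RightComparison M) (ez : WeakEilenbergZilber M l r) (X Y : C)
    (hXY : AlgebraicKunnethConditions
      (tensFunctor (M.obj X).left (M.obj X).right (M.obj Y).left (M.obj Y).right)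
      (M.obj X).cplx (M.obj Y).cplx) (n : ℕ) :
    ∃ (ι : (resFunctor (l.at X Y) (r.at X Y)).obj
          (gradedSum (fun i j =>
            ((tensFunctor (M.obj X).left (M.obj X).right (M.obj Y).left (M.obj Y).right).obj
              ((M.obj X).cplx.homology i)).obj ((M.obj Y).cplx.homology j)) 0 n) ⟶
        (M.obj (X ⊗ Y)).cplx.homology n)
      (p : (M.obj (X ⊗ Y)).cplx.homology n ⟶ (resFunctor (l.at X Y) (r.at X Y)).obj
          (gradedSum (fun i j =>
            tor₁ (tensFunctor (M.obj X).left (M.obj X).right (M.obj Y).left (M.obj Y).right)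
              ((M.obj X).cplx.homology i) ((M.obj Y).cplx.homology j)) 1 n))
      (h : ι ≫ p = 0),
      (ShortComplex.mk ι p h).ShortExact ∧
        ι ≫ (ez.iso n X Y).hom = (resFunctor (l.at X Y) (r.at X Y)).map
          (kunnethMap (M.obj X).cplx (M.obj Y).cplx hXY.rightExact n) := by
  obtain ⟨p, w, hp⟩ := hXY.exists_shortExact n
  have hF := shortExact_map_resFunctor (l.at X Y) (r.at X Y) hp
  refine ⟨(resFunctor (l.at X Y) (r.at X Y)).map (kunnethMap _ _ hXY.rightExact n) ≫
      (ez.iso n X Y).inv,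
    (ez.iso n X Y).hom ≫ (resFunctor (l.at X Y) (r.at X Y)).map p, ?_, ?_, ?_⟩
  · rw [Category.assoc, Iso.inv_hom_id_assoc, ← Functor.map_comp, w, Functor.map_zero]
  · refine ShortComplex.shortExact_of_iso ?_ hF
    exact ShortComplex.isoMk (Iso.refl _) (ez.iso n X Y).symm (Iso.refl _) (Category.id_comp _)
      ((Iso.inv_hom_id_assoc _ _).trans (Category.comp_id _).symm)
  · rw [Category.assoc, Iso.inv_hom_id, Category.comp_id]
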